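/- **Theorem (reduction of the monotonicity of Fisher's information to inequalities on the sphere).** *Setting.* Let $d\ge 2$; $d\sigma$ denotes the surface measure on $\mathbb S^{d-1}$. A *collision kernel* is a measurable function $B=B(r,x)$ (where $r=|z|$, $x=\cos\theta$) which is nonnegative for $r>0$, $-1\le x<1$, is $C^1$ in $r>0$ for each $x\in[-1,1)$, has finite cross-section for momentum transfer $$M(z)=\int_{\mathbb S^{d-1}}\bigl(1-k\cdot\sigma\bigr)\,B(|z|,k\cdot\sigma)\,d\sigma<\infty\qquad (z\neq 0,\ k=z/|z|),$$ and satisfies $\int_{\mathbb R^d}\frac{|z|}{(1+|z|)^N}M(z)\,dz<\infty$ for some $N\in\mathbb N$. (Singularities at $\theta=0$ and $r=0$ are thus allowed.) For $v,v_*\in\mathbb R^d$, $\sigma\in\mathbb S^{d-1}$ put $k=\frac{v-v_*}{|v-v_*|}$, $v'=\frac{v+v_*}2+\frac{|v-v_*|}2\sigma$, $v'_*=\frac{v+v_*}2-\frac{|v-v_*|}2\sigma$ and $$Q(f,f)(v)=\int_{\mathbb R^d}\int_{\mathbb S^{d-1}}\bigl(f(v')f(v'_*)-f(v)f(v_*)\bigr)\,B(|v-v_*|,k\cdot\sigma)\,d\sigma\,dv_*,$$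 the angular integral being a principal value, in which the integrand is averaged over $\sigma$ and its reflection $2(k\cdot\sigma)k-\sigma$ about the axis $\mathbb Rk$ (this is the usual integral whenever the integrand is integrable). A *solution* of the Boltzmann equation with kernel $B$ on an interval $J\subset\mathbb R$ is a function $f=f(t,v)\ge 0$, $C^\infty$ in $v$, all of whose $v$-derivatives decay faster than any power of $|v|$, uniformly for $t$ in compact subsets of $J$, and with $\partial_t f(t,v)=Q(f(t),f(t))(v)$ for all $t\in J$, $v\in\mathbb R^d$. The Fisher information is $I(f)=\int_{\mathbb R^d}\frac{|\nabla f|^2}{f}\,dv\in[0,\infty]$ (integrand $0$ where $f=0$). Let $$\overline\gamma(B,r)=\sup_{-1\le x<1}\ \frac{r}{B(r,x)}\Bigl|\frac{\partial B}{\partial r}(r,x)\Bigr|\in[0,\infty],\qquad \overline\gamma(B)=\sup_{r>0}\overline\gamma(B,r)$$ (the quotient is $0$ where $B=0$). Write $\beta_r(x)=B(r,x)$, and call $\beta$ a *section* of $B$ if $\beta=\beta_r$ for some $r>0$. For $k,\sigma\in\mathbb S^{d-1}$ and $x,y\in\mathbb R^d$ let $$P_{k\sigma}x=(k\cdot\sigma)x+(x\cdot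 k)\sigma-(\sigma\cdot x)k,\qquad |y-x|^2_{k,\sigma}=|x|^2+|y|^2-2\,(P_{k\sigma}x)\cdot y .$$ Let $\nabla$ be the intrinsic gradient on $\mathbb S^{d-1}$, and for smooth $F:\mathbb S^{d-1}\to(0,\infty)$ let $\bigl|\nabla\log F(\sigma)-\nabla\log F(k)\bigr|^2_{k,\sigma}$ be the above quantity with $x=\nabla\log F(k)$, $y=\nabla\log F(\sigma)$. All double integrals below are over $\mathbb S^{d-1}\times\mathbb S^{d-1}$ and have values in $[0,\infty]$; an inequality $A\le\frac{c}{\gamma^2}G$ is understood as $\gamma^2A\le c\,G$ in $[0,\infty]$ with $0\cdot\infty=0$ (so it is void if $\gamma=0$). *Statement.* Let $B$ be a collision kernel. (i) Assume that for all even smooth $F:\mathbb S^{d-1}\to(0,\infty)$ and all $r>0$, $$\iint\frac{(F(\sigma)-F(k))^2}{F(k)+F(\sigma)}\,\beta_r(k\cdot\sigma)\,dk\,d\sigma\ \le\ \frac{2}{\overline\gamma(B,r)^2}\iint F(k)\,\bigl|\nabla\log F(\sigma)-\nabla\log F(k)\bigr|^2_{k,\sigma}\,\beta_r(k\cdot\sigma)\,dk\,d\sigma.\tag{1}$$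 Then $t\mapsto I(f(t))$ is nonincreasing on $J$ for every interval $J$ and every solution $f$ on $J$ of the spatially homogeneous Boltzmann equation with kernel $B$. (ii) Condition (1) (for all such $F$ and $r$) holds in particular if for all even smooth $F:\mathbb S^{d-1}\to(0,\infty)$ and all $r>0$, $$\iint\bigl(\sqrt{F(\sigma)}-\sqrt{F(k)}\bigr)^2\beta_r(k\cdot\sigma)\,dk\,d\sigma\ \le\ \frac{1}{\overline\gamma(B,r)^2}\iint F(k)\,\bigl|\nabla\log F(\sigma)-\nabla\log F(k)\bigr|^2_{k,\sigma}\,\beta_r(k\cdot\sigma)\,dk\,d\sigma.\tag{2}$$ (iii) Condition (2) holds in particular if for all even smooth $F:\mathbb S^{d-1}\to(0,\infty)$ and all sections $\beta$ of $B$, $$\iint\bigl(\sqrt{F(\sigma)}-\sqrt{F(k)}\bigr)^2\beta(k\cdot\sigma)\,dk\,d\sigma\ \le\ \frac{1}{\overline\gamma(B)^2}\iint F(k)\,\bigl|\nabla\log F(\sigma)-\nabla\log F(k)\bigr|^2_{k,\sigma}\,\beta(k\cdot\sigma)\,dk\,d\sigma.\tag{3}$$ -/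

import Mathlib

open MeasureTheory Set
open scoped ENNReal ContDiff

noncomputable section

namespace BoltzmannFisher

/-- The velocity space `ℝᵈ` with its Euclidean structure. -/
abbrev Vel (d : ℕ) : Type := EuclideanSpace ℝ (Fin d)

/-- The unit sphere `S^{d-1}` of `ℝᵈ`. -/
abbrev Sph (d : ℕ) : Type := Metric.sphere (0 : Vel d) 1

/-- The (unnormalised) surface measure `dσ` on `S^{d-1}`. -/
def surf (d : ℕ) : Measure (Sph d) := (volume : Measure (Vel d)).toSphere

/-- The direction `z / |z|`. -/
def dir {d : ℕ} (z : Vel d) : Vel d := ‖z‖⁻¹ • z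

lemma dir_mem_sphere {d : ℕ} {z : Vel d} (hz : z ≠ 0) : dir z ∈ Metric.sphere (0 : Vel d) 1 := by
  have : ‖z‖ ≠ 0 := norm_ne_zero_iff.mpr hz
  simp [dir, norm_smul, this]

/-! ### Collision kernels

A kernel is a function `B r x`, where `r = |v - v_*|` and `x = cos θ`. A kernel without cutoff is
infinite at `θ = 0`; the value `B r 1` is therefore never used in a pointwise condition (and the
integrals over the sphere do not see it). -/

/-- The cross-section for momentum transfer
`M(z) = ∫ (1 - k·σ) B(|z|, k·σ) dσ`, where `k = z / |z|`. -/
def momentumTransfer {d : ℕ} (B : ℝ → ℝ → ℝ) (z : Vel d) : ℝ≥0∞ :=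
  ∫⁻ σ : Sph d, ENNReal.ofReal
    ((1 - inner ℝ (dir z) (σ : Vel d)) * B ‖z‖ (inner ℝ (dir z) (σ : Vel d))) ∂(surf d)

/-- `B` is a collision kernel in dimension `d`: it is nonnegative, continuously differentiable in
`|z| > 0`, has a finite cross-section for momentum transfer `M`, and `|z| M(|z|)` is locally
integrable with at most polynomial growth (in the integrated sense). -/
structure IsCollisionKernel (d : ℕ) (B : ℝ → ℝ → ℝ) : Prop where
  measurable : Measurable (Function.uncurry B)
  nonneg : ∀ r : ℝ, 0 < r → ∀ x ∈ Ico (-1 : ℝ) 1, 0 ≤ B r x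
  contDiffOn : ∀ x ∈ Ico (-1 : ℝ) 1, ContDiffOn ℝ 1 (fun r => B r x) (Ioi 0)
  momentum_lt_top : ∀ z : Vel d, z ≠ 0 → momentumTransfer B z < ⊤
  tempered : ∃ N : ℕ,
    ∫⁻ z : Vel d, ENNReal.ofReal (‖z‖ / (1 + ‖z‖) ^ N) * momentumTransfer B z < ⊤

/-- `γ̄(B, r) = sup_θ (r / B) |∂B/∂r| (r, cos θ)`, with values in `[0, ∞]`. Where `B` vanishes, its
derivative in `r` vanishes too and the quotient is read as `0`. -/
def gammaBarAt (B : ℝ → ℝ → ℝ) (r : ℝ) : ℝ≥0∞ :=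
  ⨆ x ∈ Ico (-1 : ℝ) 1, ENNReal.ofReal (r / B r x * |deriv (fun s => B s x) r|)

/-- `γ̄(B) = sup_{r > 0} γ̄(B, r)`. -/
def gammaBar (B : ℝ → ℝ → ℝ) : ℝ≥0∞ := ⨆ r ∈ Ioi (0 : ℝ), gammaBarAt B r

/-- `β` is a section of `B`: `β = B(r, ·)` for some `r > 0`. -/
def IsSection (B : ℝ → ℝ → ℝ) (β : ℝ → ℝ) : Prop := ∃ r : ℝ, 0 < r ∧ β = B r

/-! ### The Boltzmann equation -/

/-- The product `f(v') f(v'_*)` of the values of `f` at the velocities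
`v' = (v + v_*)/2 + (|v - v_*|/2) σ` and `v'_* = (v + v_*)/2 - (|v - v_*|/2) σ`. -/
def postProd {d : ℕ} (f : Vel d → ℝ) (v w σ : Vel d) : ℝ :=
  f ((1 / 2 : ℝ) • (v + w) + (‖v - w‖ / 2) • σ) * f ((1 / 2 : ℝ) • (v + w) - (‖v - w‖ / 2) • σ)

/-- The reflection of `σ` about the axis `ℝ k`: it maps `cos θ k + sin θ φ` to
`cos θ k - sin θ φ`. -/
def axialReflection {d : ℕ} (k σ : Vel d) : Vel d := (2 * inner ℝ k σ) • k - σ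

/-- The angular integral `∫ (f' f'_* - f f_*) B dσ` for given `v` and `v_* = w`. When `B` is not
integrable this is a principal value, obtained by averaging the integrand over `σ` and its
reflection about the axis `k`, which leaves `k·σ` unchanged. See `angularCollision_eq`. -/
def angularCollision {d : ℕ} (B : ℝ → ℝ → ℝ) (f : Vel d → ℝ) (v w : Vel d) : ℝ :=
  ∫ σ : Sph d,
    ((postProd f v w σ + postProd f v w (axialReflection (dir (v - w)) σ)) / 2 - f v * f w)
      * B ‖v - w‖ (inner ℝ (dir (v - w)) (σ : Vel d)) ∂(surf d)

/-- The reflection about the axis `ℝ k`, `|k| = 1`, as a linear isometry. -/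
def axialIsometry {d : ℕ} (k : Vel d) : Vel d ≃ₗᵢ[ℝ] Vel d := (Submodule.span ℝ {k}).reflection

lemma axialIsometry_apply {d : ℕ} {k : Vel d} (hk : ‖k‖ = 1) (σ : Vel d) :
    axialIsometry k σ = axialReflection k σ := by
  simp [axialIsometry, axialReflection, Submodule.reflection_singleton_apply, hk, two_smul,
    two_mul, add_smul]

/-- The map induced on the sphere by a linear isometry. -/
def sphMap {d : ℕ} (A : Vel d ≃ₗᵢ[ℝ] Vel d) (σ : Sph d) : Sph d :=
  ⟨A σ, by simp⟩

open scoped Pointwise in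
lemma measurePreserving_sphMap {d : ℕ} (A : Vel d ≃ₗᵢ[ℝ] Vel d) :
    MeasurePreserving (sphMap A) (surf d) (surf d) := by
  have hm : Measurable (sphMap A) :=
    (A.continuous.measurable.comp measurable_subtype_coe).subtype_mk
  refine ⟨hm, Measure.ext fun s hs => ?_⟩
  rw [Measure.map_apply hm hs, surf, Measure.toSphere_apply' _ (hm hs),
    Measure.toSphere_apply' _ hs]
  congr 1
  have key : Ioo (0 : ℝ) 1 • ((↑) '' (sphMap A ⁻¹' s) : Set (Vel d))
      = A ⁻¹' (Ioo (0 : ℝ) 1 • ((↑) '' s : Set (Vel d))) := by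
    ext x
    simp only [Set.mem_smul, Set.mem_image, Set.mem_preimage]
    constructor
    · rintro ⟨r, hr, _, ⟨σ, hσ, rfl⟩, rfl⟩
      exact ⟨r, hr, _, ⟨sphMap A σ, hσ, rfl⟩, by simp [sphMap]⟩
    · rintro ⟨r, hr, _, ⟨σ, hσ, rfl⟩, hx⟩
      refine ⟨r, hr, A.symm σ, ⟨sphMap A.symm σ, ?_, rfl⟩, ?_⟩
      · have : sphMap A (sphMap A.symm σ) = σ := by ext1; simp [sphMap]
        rwa [this]
      · rw [← map_smul, hx]; simp
  rw [key]
  exact A.measurePreserving.measure_preimage_emb A.toHomeomorph.measurableEmbedding _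

/-- When the collision integrand is integrable over the sphere, `angularCollision` is the usual
angular integral `∫ (f' f'_* - f f_*) B dσ`. -/
theorem angularCollision_eq {d : ℕ} (B : ℝ → ℝ → ℝ) (f : Vel d → ℝ) (v w : Vel d) (hvw : v ≠ w)
    (h : Integrable (fun σ : Sph d => (postProd f v w σ - f v * f w)
      * B ‖v - w‖ (inner ℝ (dir (v - w)) (σ : Vel d))) (surf d)) :
    angularCollision B f v w = ∫ σ : Sph d, (postProd f v w σ - f v * f w)
      * B ‖v - w‖ (inner ℝ (dir (v - w)) (σ : Vel d)) ∂(surf d) := by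
  have hk : ‖dir (v - w)‖ = 1 := by
    simpa using dir_mem_sphere (sub_ne_zero.mpr hvw)
  set k := dir (v - w) with hkdef
  set g : Sph d → ℝ := fun σ => (postProd f v w σ - f v * f w)
      * B ‖v - w‖ (inner ℝ k (σ : Vel d)) with hg
  have hp := measurePreserving_sphMap (axialIsometry k)
  have hemb : MeasurableEmbedding (sphMap (axialIsometry k)) := by
    refine MeasurableEquiv.measurableEmbedding
      ⟨⟨sphMap (axialIsometry k), sphMap (axialIsometry k), ?_, ?_⟩, hp.measurable, hp.measurable⟩
    all_goals
      intro σ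
      ext1
      simp [sphMap, axialIsometry]
  have hgi : Integrable (fun σ => g (sphMap (axialIsometry k) σ)) (surf d) :=
    (hp.integrable_comp_emb hemb).mpr h
  have hint : ∫ σ, g (sphMap (axialIsometry k) σ) ∂(surf d) = ∫ σ, g σ ∂(surf d) :=
    hp.integral_comp hemb g
  have hsym : ∀ σ : Sph d, inner ℝ k (axialReflection k (σ : Vel d)) = inner ℝ k (σ : Vel d) := by
    intro σ
    simp [axialReflection, inner_sub_right, inner_smul_right, hk]
    ring
  have hsum : ∀ σ : Sph d,
      ((postProd f v w σ + postProd f v w (axialReflection k σ)) / 2 - f v * f w)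
        * B ‖v - w‖ (inner ℝ k (σ : Vel d))
      = (1 / 2) * (g σ + g (sphMap (axialIsometry k) σ)) := by
    intro σ
    simp only [hg, sphMap, axialIsometry_apply hk, hsym]
    ring
  rw [angularCollision]
  simp only [← hkdef, hsum]
  rw [integral_const_mul, integral_add h hgi, hint]
  ring

/-- Boltzmann's collision operator `Q(f, f)(v) = ∫∫ (f' f'_* - f f_*) B dσ dv_*`. -/
def boltzmannQ {d : ℕ} (B : ℝ → ℝ → ℝ) (f : Vel d → ℝ) (v : Vel d) : ℝ :=
  ∫ w : Vel d, angularCollision B f v w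

/-- `f = f(t, v)` is a (smooth, rapidly decaying) solution on the time interval `J` of the
spatially homogeneous Boltzmann equation `∂f/∂t = Q(f, f)` with kernel `B`. -/
structure IsBoltzmannSolution {d : ℕ} (B : ℝ → ℝ → ℝ) (J : Set ℝ) (f : ℝ → Vel d → ℝ) :
    Prop where
  nonneg : ∀ t ∈ J, ∀ v, 0 ≤ f t v
  smooth : ∀ t ∈ J, ContDiff ℝ ∞ (f t)
  decay : ∀ K : Set ℝ, K ⊆ J → IsCompact K → ∀ n m : ℕ, ∃ C : ℝ, ∀ t ∈ K, ∀ v : Vel d,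
    (1 + ‖v‖) ^ m * ‖iteratedFDeriv ℝ n (f t) v‖ ≤ C
  equation : ∀ t ∈ J, ∀ v : Vel d,
    HasDerivWithinAt (fun s => f s v) (boltzmannQ B (f t) v) J t

/-- The Fisher information `I(f) = ∫ |∇f|² / f dv` of a differentiable function `f ≥ 0`; the
integrand is `0` where `f` vanishes (there `∇f` vanishes as well). -/
def fisherInformation {d : ℕ} (f : Vel d → ℝ) : ℝ≥0∞ :=
  ∫⁻ v : Vel d, ENNReal.ofReal (‖gradient f v‖ ^ 2 / f v)

/-- The Fisher information is nonincreasing along solutions of the spatially homogeneous Boltzmann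
equation with kernel `B` in dimension `d`. -/
def FisherNonincreasing (d : ℕ) (B : ℝ → ℝ → ℝ) : Prop :=
  ∀ (J : Set ℝ) (f : ℝ → Vel d → ℝ), J.OrdConnected → IsBoltzmannSolution B J f →
    AntitoneOn (fun t => fisherInformation (f t)) J

/-! ### Functions on the sphere -/

/-- The extension of a function on the sphere to `ℝᵈ \ {0}`, homogeneous of degree `0`. -/
def homExt {d : ℕ} (F : Sph d → ℝ) (x : Vel d) : ℝ :=
  if h : x = 0 then 0 else F ⟨dir x, dir_mem_sphere h⟩

/-- The intrinsic gradient on the sphere: the gradient of the `0`-homogeneous extension. -/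
def sphGrad {d : ℕ} (F : Sph d → ℝ) (σ : Sph d) : Vel d := gradient (homExt F) (σ : Vel d)

/-- `F` is a smooth positive even function on the sphere. -/
structure IsAdmissible {d : ℕ} (F : Sph d → ℝ) : Prop where
  pos : ∀ σ, 0 < F σ
  even : ∀ σ, F (-σ) = F σ
  smooth : ContDiffOn ℝ ∞ (homExt F) {0}ᶜ

/-- `P_{kσ} x = (k·σ) x + (x·k) σ - (σ·x) k`. -/
def transport {d : ℕ} (k σ x : Vel d) : Vel d :=
  inner ℝ k σ • x + inner ℝ x k • σ - inner ℝ σ x • k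

/-- `|y - x|²_{k,σ} = |x|² + |y|² - 2 (P_{kσ} x)·y`. -/
def twistedSq {d : ℕ} (k σ x y : Vel d) : ℝ :=
  ‖x‖ ^ 2 + ‖y‖ ^ 2 - 2 * inner ℝ (transport k σ x) y

/-- `∫∫ (F(σ) - F(k))² / (F(k) + F(σ)) β(k·σ) dk dσ`. -/
def ratioForm {d : ℕ} (β : ℝ → ℝ) (F : Sph d → ℝ) : ℝ≥0∞ :=
  ∫⁻ k : Sph d, ∫⁻ σ : Sph d, ENNReal.ofReal
    ((F σ - F k) ^ 2 / (F k + F σ) * β (inner ℝ (k : Vel d) (σ : Vel d))) ∂(surf d) ∂(surf d)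

/-- `∫∫ (√F(σ) - √F(k))² β(k·σ) dk dσ`. -/
def sqrtForm {d : ℕ} (β : ℝ → ℝ) (F : Sph d → ℝ) : ℝ≥0∞ :=
  ∫⁻ k : Sph d, ∫⁻ σ : Sph d, ENNReal.ofReal
    ((√(F σ) - √(F k)) ^ 2 * β (inner ℝ (k : Vel d) (σ : Vel d))) ∂(surf d) ∂(surf d)

/-- `∫∫ F(k) |∇log F(σ) - ∇log F(k)|²_{k,σ} β(k·σ) dk dσ`. -/
def gradForm {d : ℕ} (β : ℝ → ℝ) (F : Sph d → ℝ) : ℝ≥0∞ :=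
  ∫⁻ k : Sph d, ∫⁻ σ : Sph d, ENNReal.ofReal
    (F k * twistedSq (k : Vel d) (σ : Vel d) (sphGrad (fun τ => Real.log (F τ)) k)
        (sphGrad (fun τ => Real.log (F τ)) σ)
      * β (inner ℝ (k : Vel d) (σ : Vel d))) ∂(surf d) ∂(surf d)

/-! ### The three criteria

An inequality `A ≤ (c / γ̄²) G` is written `γ̄² A ≤ c G` in `[0, ∞]`, so that it is void when
`γ̄ = 0`. -/

/-- The criterion with `(F(σ) - F(k))² / (F(k) + F(σ))`. -/
def Criterion1 (d : ℕ) (B : ℝ → ℝ → ℝ) : Prop :=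
  ∀ F : Sph d → ℝ, IsAdmissible F → ∀ r : ℝ, 0 < r →
    gammaBarAt B r ^ 2 * ratioForm (B r) F ≤ 2 * gradForm (B r) F

/-- The criterion with `(√F(σ) - √F(k))²`. -/
def Criterion2 (d : ℕ) (B : ℝ → ℝ → ℝ) : Prop :=
  ∀ F : Sph d → ℝ, IsAdmissible F → ∀ r : ℝ, 0 < r →
    gammaBarAt B r ^ 2 * sqrtForm (B r) F ≤ gradForm (B r) F

/-- The criterion with `(√F(σ) - √F(k))²` and the uniform constant `γ̄(B)`, for all sections. -/
def Criterion3 (d : ℕ) (B : ℝ → ℝ → ℝ) : Prop :=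
  ∀ F : Sph d → ℝ, IsAdmissible F → ∀ β : ℝ → ℝ, IsSection B β →
    gammaBar B ^ 2 * sqrtForm β F ≤ gradForm β F

end BoltzmannFisher

end

/-!
The implications between the criteria are elementary: `(a - b)² / (a + b) ≤ 2 (√a - √b)²`, and
`γ̄(B, r) ≤ γ̄(B)`. The substance is that the first criterion makes Fisher's information decrease.

*Splitting the dissipation.* The derivative of `∫ |∇f|² / f` in the direction `Q(f, f)` is
`∫ Q(f, f) φ` with `φ = -(2 Δ log f + |∇ log f|²)` (`fisherVariation`). Let `F = f ⊗ f`, seen as a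
function of the centre of mass `c`, the relative speed `r` and the direction `k` of a pair of
velocities; a collision replaces `k` by `σ`. Symmetrisation turns `∫ Q(f, f) φ` into an integral of
`(F(σ) - F(k)) (φ + φ_*)(k) B` over the parameters `(r, c, k, σ)`
(`integral_collisionIntegrand_mul`), and `fisherVariation_add` writes `φ + φ_*` as the sum of the
corresponding second-order expressions in `log F` for translations of `c`, for dilations of `r` and
for rotations of `k`. Translations and simultaneous rotations of `k` and `σ` preserve the measure
and `k · σ`, so that for such a flow with derivation `X` the contribution is
`-∫ F(k) (X log F(σ) - X log F(k))² B` (`SymmetryFlow.dissipation`). For translations this is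
nonpositive and is dropped. For the rotations, the sum over the coordinate planes is exactly the
form `|∇ log F(σ) - ∇ log F(k)|²_{k,σ}` of the criterion (`IsTame.twistedSq_eq`).

*The radial part.* The kernel depends on `r`, so that integration by parts in `r`
(`integral_radialCross`) leaves a term with `∂B/∂r` next to the negative square. Completing the
square (`neg_mul_sub_le`) bounds the sum of both by the integral of
`(F(σ) - F(k))² / (F(k) + F(σ)) · (r |∂B/∂r| / B)² B / (2 r²)`. For fixed `r` and `c` the function
`k ↦ F` is even, smooth and positive on the sphere, and the criterion bounds this integral by the
rotational dissipation (`IsTame.lintegral_radialDensity_le`). Hence `∫ Q(f, f) φ ≤ 0`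
(`IsTame.integral_boltzmannQ_mul_fisherVariation_nonpos`). As `B` may be singular at `r = 0` and at
`k = σ`, the computation is made for kernels cut off at grazing collisions and, on a logarithmic
scale, at small and large `r`. The derivative of the cutoff contributes an error of size
`O(1 / n)` against a fixed integrable function (`IsTame.exists_dissipation_bound`), while the second
order vanishing of the symmetrised collision integrand at `k = σ`
(`abs_pairProd_average_sub_le`) gives the domination needed to remove the cutoff.

*Functions with zeros and fast decay.* The above requires `f > 0` and bounded derivatives of
`log f` (`IsTame`). A solution `f` is replaced by `f + ε (1 + |v|²)⁻ᵐ`, which satisfies both. As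
`|∇f|² / f` is jointly convex in `f` and `∇f`, Fisher's information lies above its tangents
(`IsTame.fisherIntegral_sub_le`). Therefore the information of the regularised solution is
Lipschitz in time, and its derivative is at most `∫ Q(f, f) φ` with `φ` taken at the regularised
function; by the nonpositivity this is at most `∫ (Q(f, f) - Q(f_ε, f_ε)) φ`, which is bounded by
`defect`. The defect tends to zero with `ε` by dominated convergence: a nonnegative `f` with
bounded second derivatives satisfies `|∇f|² ≤ C f`, and the second derivatives vanish almost
everywhere on `{f = 0}`. This proves `IsDissipativePath.fisherIntegral_le`, and the theorem
follows.
-/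


noncomputable section
namespace BoltzmannFisher

/-! ### The elementary implications between the criteria -/

lemma sq_sub_div_add_le {a b : ℝ} (ha : 0 < a) (hb : 0 < b) :
    (a - b) ^ 2 / (b + a) ≤ 2 * (√a - √b) ^ 2 := by
  have ha' := Real.sq_sqrt ha.le
  have hb' := Real.sq_sqrt hb.le
  rw [div_le_iff₀ (by positivity)]
  set x := √a
  set y := √b
  rw [← ha', ← hb']
  nlinarith [mul_nonneg (sq_nonneg (x - y)) (sq_nonneg (x - y))]

lemma inner_sph_mem_Icc {d : ℕ} (k σ : Sph d) :
    inner ℝ (k : Vel d) (σ : Vel d) ∈ Icc (-1 : ℝ) 1 := by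
  have h := abs_real_inner_le_norm (k : Vel d) (σ : Vel d)
  simp only [norm_eq_of_mem_sphere, mul_one] at h
  exact abs_le.mp h

lemma eq_of_one_le_inner {d : ℕ} {k σ : Sph d} (h : 1 ≤ inner ℝ (k : Vel d) (σ : Vel d)) :
    k = σ := by
  have h1 : inner ℝ (k : Vel d) (σ : Vel d) = 1 := le_antisymm (inner_sph_mem_Icc k σ).2 h
  exact Subtype.ext ((inner_eq_one_iff_of_norm_eq_one (by simp) (by simp)).mp h1)

lemma ratioForm_le {d : ℕ} {β : ℝ → ℝ} (hβ : ∀ x ∈ Ico (-1 : ℝ) 1, 0 ≤ β x) {F : Sph d → ℝ}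
    (hF : ∀ σ, 0 < F σ) : ratioForm β F ≤ 2 * sqrtForm β F := by
  have h2 : (2 : ℝ≥0∞) ≠ ⊤ := by simp
  rw [ratioForm, sqrtForm, ← lintegral_const_mul' _ _ h2]
  refine lintegral_mono fun k => ?_
  rw [← lintegral_const_mul' _ _ h2]
  refine lintegral_mono fun σ => ?_
  refine le_of_le_of_eq (ENNReal.ofReal_le_ofReal (q := 2 * ((√(F σ) - √(F k)) ^ 2
    * β (inner ℝ (k : Vel d) (σ : Vel d)))) ?_) (by rw [ENNReal.ofReal_mul (by norm_num)]; simp)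
  rcases lt_or_ge (inner ℝ (k : Vel d) (σ : Vel d)) 1 with h | h
  · rw [← mul_assoc]
    exact mul_le_mul_of_nonneg_right (sq_sub_div_add_le (hF σ) (hF k))
      (hβ _ ⟨(inner_sph_mem_Icc k σ).1, h⟩)
  · simp [eq_of_one_le_inner h]

theorem criterion1_of_criterion2 {d : ℕ} {B : ℝ → ℝ → ℝ} (hB : IsCollisionKernel d B)
    (h : Criterion2 d B) : Criterion1 d B := by
  intro F hF r hr
  calc gammaBarAt B r ^ 2 * ratioForm (B r) F
      ≤ gammaBarAt B r ^ 2 * (2 * sqrtForm (B r) F) :=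
        mul_le_mul_right (ratioForm_le (hB.nonneg r hr) hF.pos) _
    _ = 2 * (gammaBarAt B r ^ 2 * sqrtForm (B r) F) := by ring
    _ ≤ 2 * gradForm (B r) F := mul_le_mul_right (h F hF r hr) _

theorem criterion2_of_criterion3 {d : ℕ} {B : ℝ → ℝ → ℝ} (h : Criterion3 d B) :
    Criterion2 d B := by
  intro F hF r hr
  refine le_trans (mul_le_mul_left (pow_le_pow_left' ?_ 2) _) (h F hF (B r) ⟨r, hr, rfl⟩)
  exact le_iSup₂ (f := fun r (_ : r ∈ Ioi (0 : ℝ)) => gammaBarAt B r) r hr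

/-! ### Polar coordinates for pairs of velocities -/

instance {d : ℕ} : IsFiniteMeasure (surf d) := by unfold surf; infer_instance

/-- The measure `r ^ (d - 1) dr` on the half-line `r > 0`. -/
def radial (d : ℕ) : Measure ℝ :=
  (volume.restrict (Ioi 0)).withDensity fun r => ENNReal.ofReal (r ^ (d - 1))

instance {d : ℕ} : SFinite (radial d) := by unfold radial; infer_instance

lemma ae_radial_pos (d : ℕ) : ∀ᵐ r ∂(radial d), 0 < r :=
  (withDensity_absolutelyContinuous _ _).ae_le (ae_restrict_mem measurableSet_Ioi)

lemma measurePreserving_val_volumeIoiPow (d : ℕ) :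
    MeasurePreserving (Subtype.val : Ioi (0 : ℝ) → ℝ) (Measure.volumeIoiPow (d - 1))
      (radial d) := by
  refine ⟨measurable_subtype_coe, Measure.ext fun s hs => ?_⟩
  rw [Measure.map_apply measurable_subtype_coe hs, Measure.volumeIoiPow,
    withDensity_apply _ (measurable_subtype_coe hs), radial, withDensity_apply _ hs,
    setLIntegral_subtype measurableSet_Ioi _ fun a : ℝ ↦ ENNReal.ofReal (a ^ (d - 1)),
    Measure.restrict_restrict hs]
  congr 2
  rw [Subtype.image_preimage_coe, inter_comm]

lemma measurePreserving_polar {d : ℕ} (hd : 2 ≤ d) :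
    MeasurePreserving (fun p : ℝ × Sph d => p.1 • (p.2 : Vel d)) ((radial d).prod (surf d))
      volume := by
  have : Nonempty (Fin d) := ⟨⟨0, by omega⟩⟩
  have h1 := (volume : Measure (Vel d)).measurePreserving_homeomorphUnitSphereProd
  have h2 := h1.symm (homeomorphUnitSphereProd (Vel d)).toMeasurableEquiv
  have h3 : MeasurePreserving (Subtype.val : ({0}ᶜ : Set (Vel d)) → Vel d)
      ((volume : Measure (Vel d)).comap (↑)) volume := by
    refine ⟨measurable_subtype_coe, ?_⟩
    rw [map_comap_subtype_coe (measurableSet_singleton _).compl, Measure.restrict_eq_self_of_ae_mem]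
    exact compl_mem_ae_iff.mpr (measure_singleton _)
  have h4 := h3.comp h2
  simp only [finrank_euclideanSpace, Fintype.card_fin] at h4
  have h5 : MeasurePreserving (Prod.map (Subtype.val : Ioi (0 : ℝ) → ℝ) (id : Sph d → Sph d))
      ((Measure.volumeIoiPow (d - 1)).prod (surf d)) ((radial d).prod (surf d)) :=
    (measurePreserving_val_volumeIoiPow d).prod (MeasurePreserving.id _)
  have h6 := h4.comp (Measure.measurePreserving_swap (μ := Measure.volumeIoiPow (d - 1))
    (ν := surf d))
  have hm : Measurable (fun p : ℝ × Sph d => p.1 • (p.2 : Vel d)) := by fun_prop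
  refine ⟨hm, ?_⟩
  rw [← h5.map_eq, Measure.map_map hm h5.measurable, ← h6.map_eq]
  rfl

/-- The space of parameters `(r, c, k, σ)`: relative speed, centre of mass, and the directions of
the relative velocity before and after the collision. -/
abbrev Param (d : ℕ) : Type := ℝ × (Vel d × (Sph d × Sph d))

/-- The measure `r ^ (d - 1) dr dc dk dσ` on the parameters of a collision. -/
def paramMeasure (d : ℕ) : Measure (Param d) :=
  (radial d).prod (volume.prod ((surf d).prod (surf d)))

instance {d : ℕ} : SFinite (paramMeasure d) := by unfold paramMeasure; infer_instance

lemma ae_param_pos (d : ℕ) : ∀ᵐ q ∂(paramMeasure d), 0 < q.1 :=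
  Measure.quasiMeasurePreserving_fst.ae (ae_radial_pos d)

lemma measurePreserving_centre {d : ℕ} :
    MeasurePreserving (fun p : Vel d × Vel d => (p.1 + (1 / 2 : ℝ) • p.2, p.1 - (1 / 2 : ℝ) • p.2))
      (volume.prod volume) (volume.prod volume) := by
  have h0 := Measure.measurePreserving_swap (μ := (volume : Measure (Vel d)))
    (ν := (volume : Measure (Vel d)))
  have h1 : MeasurePreserving (fun p : Vel d × Vel d => (p.1, p.2 + (1 / 2 : ℝ) • p.1))
      (volume.prod volume) (volume.prod volume) :=
    (MeasurePreserving.id (volume : Measure (Vel d))).skew_product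
      (g := fun z c => c + (1 / 2 : ℝ) • z) (by fun_prop)
      (ae_of_all _ fun z => (measurePreserving_add_right volume _).map_eq)
  have h2 : MeasurePreserving (fun p : Vel d × Vel d => (p.1, p.1 - p.2))
      (volume.prod volume) (volume.prod volume) :=
    (MeasurePreserving.id (volume : Measure (Vel d))).skew_product
      (g := fun v z => v - z) (by fun_prop)
      (ae_of_all _ fun v => (Measure.measurePreserving_sub_left volume v).map_eq)
  convert h2.comp (h0.comp (h1.comp h0)) using 1
  funext p
  simp only [Function.comp, Prod.swap, Prod.mk.injEq, true_and]
  module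

/-- In the parameters of a collision the measure `dv dv_* dσ` is `r ^ (d - 1) dr dc dk dσ`. -/
lemma measurePreserving_param {d : ℕ} (hd : 2 ≤ d) :
    MeasurePreserving (fun q : Param d => ((q.2.1 + (q.1 / 2) • (q.2.2.1 : Vel d),
        q.2.1 - (q.1 / 2) • (q.2.2.1 : Vel d)), q.2.2.2))
      (paramMeasure d) ((volume.prod volume).prod (surf d)) := by
  set ν : Measure (Vel d) := volume
  set s := surf d
  set ρ := radial d
  have a1 : MeasurePreserving (Prod.map (id : ℝ → ℝ) (MeasurableEquiv.prodAssoc.symm :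
      Vel d × (Sph d × Sph d) → (Vel d × Sph d) × Sph d)) (ρ.prod (ν.prod (s.prod s)))
      (ρ.prod ((ν.prod s).prod s)) :=
    (MeasurePreserving.id _).prod ((measurePreserving_prodAssoc ν s s).symm _)
  have a2 := (measurePreserving_prodAssoc ρ (ν.prod s) s).symm
  have b1 := (measurePreserving_prodAssoc ρ ν s).symm
  have b2 : MeasurePreserving (Prod.map Prod.swap id : (ℝ × Vel d) × Sph d → _)
      ((ρ.prod ν).prod s) ((ν.prod ρ).prod s) :=
    Measure.measurePreserving_swap.prod (MeasurePreserving.id _)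
  have b3 := measurePreserving_prodAssoc ν ρ s
  have b4 : MeasurePreserving (Prod.map id (fun p : ℝ × Sph d => p.1 • (p.2 : Vel d)) :
      Vel d × (ℝ × Sph d) → _) (ν.prod (ρ.prod s)) (ν.prod ν) :=
    (MeasurePreserving.id _).prod (measurePreserving_polar hd)
  have b := measurePreserving_centre.comp (b4.comp (b3.comp (b2.comp b1)))
  have a3 := (b.prod (MeasurePreserving.id s)).comp (a2.comp a1)
  change MeasurePreserving _ (ρ.prod (ν.prod (s.prod s))) _
  convert a3 using 1
  funext q
  refine Prod.ext (Prod.ext ?_ ?_) rfl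
  · change q.2.1 + (q.1 / 2) • (q.2.2.1 : Vel d)
      = q.2.1 + (1 / 2 : ℝ) • (q.1 • (q.2.2.1 : Vel d))
    rw [smul_smul]; ring_nf
  · change q.2.1 - (q.1 / 2) • (q.2.2.1 : Vel d)
      = q.2.1 - (1 / 2 : ℝ) • (q.1 • (q.2.2.1 : Vel d))
    rw [smul_smul]; ring_nf


/-! ### Algebraic weights and integrability against the kernel -/

/-- The decay weight `(1 + |c|² + r²)⁻ᵐ` in the centre of mass `c` and the relative speed `r`. -/
def pairDecay {d : ℕ} (m : ℕ) (r : ℝ) (c : Vel d) : ℝ := ((1 + ‖c‖ ^ 2 + r ^ 2) ^ m)⁻¹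

/-- The decay weight `(1 + |v|²)⁻ᵐ`. -/
def decay {d : ℕ} (m : ℕ) (v : Vel d) : ℝ := ((1 + ‖v‖ ^ 2) ^ m)⁻¹

lemma decay_pos {d : ℕ} (m : ℕ) (v : Vel d) : 0 < decay m v := by unfold decay; positivity

lemma pairDecay_pos {d : ℕ} (m : ℕ) (r : ℝ) (c : Vel d) : 0 < pairDecay m r c := by
  unfold pairDecay; positivity

lemma continuous_decay {d : ℕ} (m : ℕ) : Continuous (decay m : Vel d → ℝ) := by
  unfold decay
  exact Continuous.inv₀ (by fun_prop) fun v => by positivity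

lemma measurable_pairDecay {d : ℕ} (m : ℕ) :
    Measurable fun q : Param d => pairDecay m q.1 q.2.1 := by
  unfold pairDecay; fun_prop

lemma integrable_decay {d m : ℕ} (hm : d < 2 * m) : Integrable (decay m : Vel d → ℝ) := by
  have h := integrable_rpow_neg_one_add_norm_sq (E := Vel d) (μ := volume) (r := 2 * m)
    (by simp; exact_mod_cast hm)
  refine h.congr (ae_of_all _ fun v => ?_)
  simp only [decay]
  rw [show (-(2 * (m : ℝ)) / 2) = -(m : ℝ) by ring, Real.rpow_neg (by positivity),
    Real.rpow_natCast]

lemma one_add_pow_le {r : ℝ} (hr : 0 ≤ r) (N : ℕ) :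
    (1 + r) ^ (N + 1) ≤ 2 ^ (N + 1) * (1 + r ^ 2) ^ (N + 1) := by
  rw [← mul_pow]
  gcongr
  nlinarith [sq_nonneg (r - 1)]

/-- The decay weight absorbs the growth `1 + r` and the polynomial growth of the kernel. -/
lemma one_add_mul_pairDecay_le {d m N : ℕ} (hm : N + 1 ≤ m) {r : ℝ} (hr : 0 ≤ r) (c : Vel d)
    {A : ℝ} (hA : 0 < A) (hAc : A ≤ 1 + ‖c‖ ^ 2 + r ^ 2) :
    r * (1 + r) * pairDecay m r c
      ≤ 2 ^ (N + 1) * (A ^ (m - (N + 1)))⁻¹ * (r / (1 + r) ^ N) := by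
  have h1 : (1 + ‖c‖ ^ 2 + r ^ 2) ^ m
      = (1 + ‖c‖ ^ 2 + r ^ 2) ^ (m - (N + 1)) * (1 + ‖c‖ ^ 2 + r ^ 2) ^ (N + 1) := by
    rw [← pow_add]; congr 1; omega
  have h2 : A ^ (m - (N + 1)) * ((1 + r) ^ (N + 1) / 2 ^ (N + 1)) ≤ (1 + ‖c‖ ^ 2 + r ^ 2) ^ m := by
    rw [h1]
    gcongr
    rw [div_le_iff₀ (by positivity), mul_comm]
    refine (one_add_pow_le hr N).trans ?_
    gcongr
    nlinarith [sq_nonneg ‖c‖]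
  have h3 : pairDecay m r c ≤ (A ^ (m - (N + 1)) * ((1 + r) ^ (N + 1) / 2 ^ (N + 1)))⁻¹ := by
    unfold pairDecay; gcongr
  calc r * (1 + r) * pairDecay m r c
      ≤ r * (1 + r) * (A ^ (m - (N + 1)) * ((1 + r) ^ (N + 1) / 2 ^ (N + 1)))⁻¹ := by gcongr
    _ = _ := by
      have : (1 + r) ≠ 0 := by positivity
      field_simp
      ring

lemma measurable_kernel {d : ℕ} {B : ℝ → ℝ → ℝ} (hB : Measurable (Function.uncurry B)) :
    Measurable fun q : Param d => B q.1 (inner ℝ (q.2.2.1 : Vel d) (q.2.2.2 : Vel d)) :=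
  hB.comp (f := fun q : Param d => (q.1, inner ℝ (q.2.2.1 : Vel d) (q.2.2.2 : Vel d)))
    (by fun_prop)

lemma measurable_momentumTransfer {d : ℕ} {B : ℝ → ℝ → ℝ} (hB : Measurable (Function.uncurry B)) :
    Measurable (momentumTransfer B : Vel d → ℝ≥0∞) := by
  unfold momentumTransfer dir
  refine Measurable.lintegral_prod_right' (f := fun p : Vel d × Sph d => ENNReal.ofReal
    ((1 - inner ℝ (‖p.1‖⁻¹ • p.1) (p.2 : Vel d)) * B ‖p.1‖ (inner ℝ (‖p.1‖⁻¹ • p.1) (p.2 : Vel d))))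
    ?_
  have : Measurable fun p : Vel d × Sph d => inner ℝ (‖p.1‖⁻¹ • p.1) (p.2 : Vel d) := by fun_prop
  exact ((measurable_const.sub this).mul
    (hB.comp (f := fun p : Vel d × Sph d => (‖p.1‖, inner ℝ (‖p.1‖⁻¹ • p.1) (p.2 : Vel d)))
      (by fun_prop))).ennreal_ofReal

lemma norm_smul_sph {d : ℕ} {r : ℝ} (hr : 0 < r) (k : Sph d) : ‖r • (k : Vel d)‖ = r := by
  simp [norm_smul, abs_of_pos hr]

lemma dir_smul_sph {d : ℕ} {r : ℝ} (hr : 0 < r) (k : Sph d) : dir (r • (k : Vel d)) = k := by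
  rw [dir, norm_smul_sph hr, smul_smul, inv_mul_cancel₀ hr.ne', one_smul]

lemma one_sub_inner_mul_nonneg {d : ℕ} {B : ℝ → ℝ → ℝ} (hB : IsCollisionKernel d B) {r : ℝ}
    (hr : 0 < r) {k σ : Sph d} : 0 ≤ (1 - inner ℝ (k : Vel d) (σ : Vel d))
      * B r (inner ℝ (k : Vel d) (σ : Vel d)) := by
  rcases lt_or_ge (inner ℝ (k : Vel d) (σ : Vel d)) 1 with h | h
  · exact mul_nonneg (by linarith) (hB.nonneg r hr _ ⟨(inner_sph_mem_Icc k σ).1, h⟩)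
  · rw [le_antisymm (inner_sph_mem_Icc k σ).2 h]; simp

/-- The dominating function for all collision integrals:
`r (1 + r) (1 + |c|² + r²)⁻ᵐ (1 - k·σ) B(r, k·σ)`. -/
def dominant {d : ℕ} (B : ℝ → ℝ → ℝ) (m : ℕ) (q : Param d) : ℝ :=
  q.1 * (1 + q.1) * pairDecay m q.1 q.2.1 *
    ((1 - inner ℝ (q.2.2.1 : Vel d) (q.2.2.2 : Vel d))
      * B q.1 (inner ℝ (q.2.2.1 : Vel d) (q.2.2.2 : Vel d)))

lemma dominant_nonneg {d : ℕ} {B : ℝ → ℝ → ℝ} (hB : IsCollisionKernel d B) (m : ℕ) {q : Param d}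
    (hq : 0 < q.1) : 0 ≤ dominant B m q := by
  have := pairDecay_pos m q.1 q.2.1
  exact mul_nonneg (by positivity) (one_sub_inner_mul_nonneg hB hq)

lemma measurable_dominant {d : ℕ} {B : ℝ → ℝ → ℝ} (hB : Measurable (Function.uncurry B)) (m : ℕ) :
    Measurable (dominant B m : Param d → ℝ) := by
  unfold dominant
  have := measurable_pairDecay (d := d) m
  have := measurable_kernel (d := d) hB
  fun_prop

/-- The growth condition on the momentum transfer makes the kernel integrable against the weights
`pairDecay m` for large `m`, once multiplied by `r (1 + r) (1 - k·σ)`. -/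
theorem integrable_dominant {d : ℕ} (hd : 2 ≤ d) {B : ℝ → ℝ → ℝ} (hB : IsCollisionKernel d B) :
    ∃ m₀, ∀ m ≥ m₀, Integrable (dominant B m) (paramMeasure d) := by
  obtain ⟨N, hN⟩ := hB.tempered
  refine ⟨N + 1 + d, fun m hm => ⟨(measurable_dominant hB.measurable m).aestronglyMeasurable, ?_⟩⟩
  have hM := measurable_momentumTransfer (d := d) hB.measurable
  have hdec : Integrable (decay (m - (N + 1)) : Vel d → ℝ) := integrable_decay (by omega)
  have hK : Measurable fun q : Param d => ENNReal.ofReal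
      ((1 - inner ℝ (q.2.2.1 : Vel d) (q.2.2.2 : Vel d))
      * B q.1 (inner ℝ (q.2.2.1 : Vel d) (q.2.2.2 : Vel d))) :=
    (Measurable.mul (by fun_prop) (measurable_kernel hB.measurable)).ennreal_ofReal
  have hdm : Measurable (decay (m - (N + 1)) : Vel d → ℝ) := (continuous_decay _).measurable
  calc ∫⁻ q, ‖dominant B m q‖ₑ ∂(paramMeasure d)
      ≤ ∫⁻ q : Param d, ENNReal.ofReal (2 ^ (N + 1)) * (ENNReal.ofReal (decay (m - (N + 1)) q.2.1) *
          (ENNReal.ofReal (q.1 / (1 + q.1) ^ N) * ENNReal.ofReal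
      ((1 - inner ℝ (q.2.2.1 : Vel d) (q.2.2.2 : Vel d))
      * B q.1 (inner ℝ (q.2.2.1 : Vel d) (q.2.2.2 : Vel d))))) ∂(paramMeasure d) := by
        refine lintegral_mono_ae ?_
        filter_upwards [ae_param_pos d] with q hq
        have hn := one_sub_inner_mul_nonneg hB hq (k := q.2.2.1) (σ := q.2.2.2)
        rw [Real.enorm_eq_ofReal (dominant_nonneg hB m hq), ← ENNReal.ofReal_mul (by positivity),
          ← ENNReal.ofReal_mul (decay_pos _ _).le, ← ENNReal.ofReal_mul (by positivity)]
        refine ENNReal.ofReal_le_ofReal ?_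
        rw [← mul_assoc, ← mul_assoc]
        refine mul_le_mul_of_nonneg_right ?_ hn
        exact one_add_mul_pairDecay_le (by omega) hq.le q.2.1 (A := 1 + ‖q.2.1‖ ^ 2) (by positivity)
          (by nlinarith [sq_nonneg q.1])
    _ = ENNReal.ofReal (2 ^ (N + 1)) * ((∫⁻ c : Vel d, ENNReal.ofReal (decay (m - (N + 1)) c)) *
          ∫⁻ z : Vel d, ENNReal.ofReal (‖z‖ / (1 + ‖z‖) ^ N) * momentumTransfer B z) := by
        rw [lintegral_const_mul _ (by fun_prop)]
        congr 1
        rw [paramMeasure, lintegral_prod _ (by fun_prop)]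
        have e1 : ∀ᵐ r ∂(radial d), ∫⁻ y : Vel d × (Sph d × Sph d),
            ENNReal.ofReal (decay (m - (N + 1)) y.1) * (ENNReal.ofReal (r / (1 + r) ^ N) *
              ENNReal.ofReal ((1 - inner ℝ (y.2.1 : Vel d) (y.2.2 : Vel d))
              * B r (inner ℝ (y.2.1 : Vel d) (y.2.2 : Vel d))))
                ∂(volume.prod ((surf d).prod (surf d)))
            = (∫⁻ c : Vel d, ENNReal.ofReal (decay (m - (N + 1)) c)) *
              ∫⁻ k : Sph d, ENNReal.ofReal (‖r • (k : Vel d)‖ / (1 + ‖r • (k : Vel d)‖) ^ N)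
                * momentumTransfer B (r • (k : Vel d)) ∂(surf d) := by
          filter_upwards [ae_radial_pos d] with r hr
          have hKr : Measurable fun y : Sph d × Sph d => ENNReal.ofReal
              ((1 - inner ℝ (y.1 : Vel d) (y.2 : Vel d)) * B r (inner ℝ (y.1 : Vel d) (y.2 : Vel d))) :=
            hK.comp (f := fun y : Sph d × Sph d => ((r, ((0 : Vel d), y)) : Param d)) (by fun_prop)
          rw [lintegral_prod_mul (f := fun c : Vel d => ENNReal.ofReal (decay (m - (N + 1)) c))
            (g := fun y : Sph d × Sph d => ENNReal.ofReal (r / (1 + r) ^ N) * ENNReal.ofReal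
              ((1 - inner ℝ (y.1 : Vel d) (y.2 : Vel d))
              * B r (inner ℝ (y.1 : Vel d) (y.2 : Vel d)))) (by fun_prop)
            (hKr.const_mul _).aemeasurable, lintegral_prod _ (hKr.const_mul _).aemeasurable]
          congr 1
          refine lintegral_congr fun k => ?_
          have hKk : Measurable fun y : Sph d => ENNReal.ofReal
              ((1 - inner ℝ (k : Vel d) (y : Vel d)) * B r (inner ℝ (k : Vel d) (y : Vel d))) :=
            hKr.comp (f := fun y : Sph d => (k, y)) (by fun_prop)
          rw [lintegral_const_mul _ hKk]
          simp only [momentumTransfer, norm_smul_sph hr, dir_smul_sph hr]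
        rw [lintegral_congr_ae e1, lintegral_const_mul _ (by fun_prop),
          ← (measurePreserving_polar hd).lintegral_comp (f := fun z : Vel d =>
            ENNReal.ofReal (‖z‖ / (1 + ‖z‖) ^ N) * momentumTransfer B z) (by fun_prop),
          lintegral_prod _ (by fun_prop)]
    _ < ⊤ := by
        refine ENNReal.mul_lt_top ENNReal.ofReal_lt_top (ENNReal.mul_lt_top ?_ hN)
        have := hdec.lintegral_lt_top
        exact this


/-! ### Functions with algebraic decay and the collision operator -/

/-- `f` is smooth, and `f`, `∇f`, `D²f` are bounded by `C (1 + |v|²)⁻ᵐ`. -/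
structure HasDecay {d : ℕ} (m : ℕ) (C : ℝ) (f : Vel d → ℝ) : Prop where
  smooth : ContDiff ℝ ∞ f
  bound : ∀ v, |f v| ≤ C * decay m v
  bound_grad : ∀ v, ‖gradient f v‖ ≤ C * decay m v
  bound_hess : ∀ v, ‖fderiv ℝ (gradient f) v‖ ≤ C * decay m v

lemma contDiff_gradient {d : ℕ} {f : Vel d → ℝ} (hf : ContDiff ℝ ∞ f) :
    ContDiff ℝ ∞ (gradient f) := by
  have h1 : ContDiff ℝ ∞ (fderiv ℝ f) := hf.fderiv_right (by simp)
  exact (InnerProductSpace.toDual ℝ (Vel d)).symm.contDiff.comp h1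

lemma hasDerivAt_comp_curve {d : ℕ} {f : Vel d → ℝ} (hf : ContDiff ℝ ∞ f) {a : ℝ → Vel d}
    {a' : Vel d} {s : ℝ} (ha : HasDerivAt a a' s) :
    HasDerivAt (fun s => f (a s)) (inner ℝ (gradient f (a s)) a') s := by
  have h := (hf.differentiable (by simp) (a s)).hasGradientAt.hasFDerivAt.comp_hasDerivAt s ha
  simpa [Function.comp_def] using h

lemma hasDerivAt_gradient_comp_curve {d : ℕ} {f : Vel d → ℝ} (hf : ContDiff ℝ ∞ f) {a : ℝ → Vel d}
    {a' : Vel d} {s : ℝ} (ha : HasDerivAt a a' s) :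
    HasDerivAt (fun s => gradient f (a s)) (fderiv ℝ (gradient f) (a s) a') s :=
  ((contDiff_gradient hf).differentiable (by simp) (a s)).hasFDerivAt.comp_hasDerivAt s ha

lemma abs_mul_le_mul {x y a b : ℝ} (hx : |x| ≤ a) (hy : |y| ≤ b) : |x * y| ≤ a * b := by
  rw [abs_mul]
  exact mul_le_mul hx hy (abs_nonneg _) ((abs_nonneg _).trans hx)

/-- A bound for symmetric second differences. -/
lemma abs_symm_diff_le {h h' h'' : ℝ → ℝ} {K : ℝ} (h1 : ∀ s, HasDerivAt h (h' s) s)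
    (h2 : ∀ s, HasDerivAt h' (h'' s) s) (hK : ∀ s, |h'' s| ≤ K) {θ : ℝ} (hθ : 0 ≤ θ) :
    |(h θ + h (-θ)) / 2 - h 0| ≤ K * θ ^ 2 := by
  have hd' : ∀ s ∈ Icc (0 : ℝ) θ, |h' s - h' (-s)| ≤ 2 * K * θ := by
    intro s hs
    have := convex_univ.norm_image_sub_le_of_norm_hasDerivWithin_le (f := h')
      (fun x _ => (h2 x).hasDerivWithinAt) (fun x _ => hK x) (mem_univ (-s)) (mem_univ s)
    rw [Real.norm_eq_abs, Real.norm_eq_abs, show s - -s = 2 * s by ring,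
      abs_of_nonneg (by linarith [hs.1] : (0 : ℝ) ≤ 2 * s)] at this
    have hK0 : 0 ≤ K := (abs_nonneg _).trans (hK 0)
    nlinarith [hs.2]
  have hg : ∀ s, HasDerivAt (fun s => (h s + h (-s)) / 2) ((h' s - h' (-s)) / 2) s := by
    intro s
    have := (h1 (-s)).comp s (hasDerivAt_neg s)
    exact (((h1 s).add this).div_const 2).congr_deriv (by ring)
  have := (convex_Icc (0 : ℝ) θ).norm_image_sub_le_of_norm_hasDerivWithin_le (C := K * θ)
    (f := fun s => (h s + h (-s)) / 2)
    (fun x _ => (hg x).hasDerivWithinAt)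
    (fun x hx => by rw [Real.norm_eq_abs, abs_div, abs_two]; linarith [hd' x hx])
    (left_mem_Icc.mpr hθ) (right_mem_Icc.mpr hθ)
  rw [Real.norm_eq_abs, Real.norm_eq_abs, sub_zero, abs_of_nonneg hθ] at this
  calc _ = |(h θ + h (-θ)) / 2 - (h 0 + h (-0)) / 2| := by congr 1; simp
    _ ≤ _ := this
    _ = _ := by ring

/-- The tensor product `f ⊗ f` as a function of the relative speed `r`, the centre of mass `c` and
the direction `k` of the relative velocity. -/
def pairProd {d : ℕ} (f : Vel d → ℝ) (r : ℝ) (c k : Vel d) : ℝ :=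
  f (c + (r / 2) • k) * f (c - (r / 2) • k)

lemma pairProd_neg {d : ℕ} (f : Vel d → ℝ) (r : ℝ) (c k : Vel d) :
    pairProd f r c (-k) = pairProd f r c k := by
  simp [pairProd, mul_comm, sub_eq_add_neg]

lemma postProd_eq_pairProd {d : ℕ} (f : Vel d → ℝ) (v w σ : Vel d) :
    postProd f v w σ = pairProd f ‖v - w‖ ((1 / 2 : ℝ) • (v + w)) σ := rfl

lemma smul_dir {d : ℕ} (z : Vel d) : ‖z‖ • dir z = z := by
  rcases eq_or_ne z 0 with rfl | hz
  · simp
  · rw [dir, smul_smul, mul_inv_cancel₀ (norm_ne_zero_iff.mpr hz), one_smul]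

lemma mul_eq_pairProd {d : ℕ} (f : Vel d → ℝ) (v w : Vel d) :
    f v * f w = pairProd f ‖v - w‖ ((1 / 2 : ℝ) • (v + w)) (dir (v - w)) := by
  have h : (‖v - w‖ / 2) • dir (v - w) = (1 / 2 : ℝ) • (v - w) := by
    conv_rhs => rw [← smul_dir (v - w), smul_smul]
    congr 1; ring
  rw [pairProd, h]
  congr 2 <;> module

lemma decay_mul_decay_le {d : ℕ} (m : ℕ) (r : ℝ) (c : Vel d) {k : Vel d} (hk : ‖k‖ = 1) :
    decay m (c + (r / 2) • k) * decay m (c - (r / 2) • k) ≤ 2 ^ m * pairDecay m r c := by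
  have h := parallelogram_law_with_norm ℝ c ((r / 2) • k)
  have h2 : ‖(r / 2) • k‖ ^ 2 = r ^ 2 / 4 := by
    rw [norm_smul, hk, mul_one, Real.norm_eq_abs, sq_abs]; ring
  unfold decay pairDecay
  rw [← mul_inv, ← mul_pow, ← inv_pow, ← inv_pow, ← mul_pow]
  refine pow_le_pow_left₀ (by positivity) ?_ m
  rw [← div_eq_mul_inv, inv_eq_one_div, div_le_div_iff₀ (by positivity) (by positivity)]
  nlinarith [sq_nonneg ‖c‖, sq_nonneg r, mul_nonneg (sq_nonneg ‖c + (r / 2) • k‖)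
    (sq_nonneg ‖c - (r / 2) • k‖)]

/-- The product `f(v') f(v'_*)`, averaged over `σ` and its reflection about `k`, differs from
`f(v) f(v_*)` by `O(r (1 + r) (1 - k·σ))`: the two outgoing directions are the points at angle `± θ`
on a great circle through `k`, so that only second derivatives along this circle count. -/
lemma abs_pairProd_average_sub_le {d m : ℕ} {C : ℝ} {f : Vel d → ℝ} (hf : HasDecay m C f)
    {r : ℝ} (hr : 0 ≤ r) (c : Vel d) {k σ : Vel d} (hk : ‖k‖ = 1) (hσ : ‖σ‖ = 1) :
    |(pairProd f r c σ + pairProd f r c (axialReflection k σ)) / 2 - pairProd f r c k|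
      ≤ 5 * 2 ^ m * C ^ 2 * (r * (1 + r) * pairDecay m r c * (1 - inner ℝ k σ)) := by
  have hkk : inner ℝ k k = 1 := by rw [real_inner_self_eq_norm_sq, hk]; norm_num
  have hσσ : inner ℝ σ σ = 1 := by rw [real_inner_self_eq_norm_sq, hσ]; norm_num
  set x := inner ℝ k σ with hx
  have hxI : x ∈ Icc (-1 : ℝ) 1 := by
    have h := abs_real_inner_le_norm k σ
    rw [hk, hσ, mul_one] at h
    exact abs_le.mp h
  have hP := pairDecay_pos m r c
  have hrhs : 0 ≤ 5 * 2 ^ m * C ^ 2 * (r * (1 + r) * pairDecay m r c * (1 - x)) := by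
    have : 0 ≤ 1 - x := by linarith [hxI.2]
    positivity
  rcases eq_or_ne (1 - x ^ 2) 0 with h0 | h0
  · -- here `σ = k` or `σ = -k`, and all three products agree
    rcases eq_or_ne x 1 with h1 | h1
    · have : k = σ := (inner_eq_one_iff_of_norm_eq_one hk hσ).mp h1
      have h2 : axialReflection k σ = k := by
        rw [axialReflection, ← this, hkk]; module
      rw [h2, ← this]
      simpa [this] using hrhs
    · have h1' : x = -1 := by
        have : (x - 1) * (x + 1) = 0 := by linarith
        rcases mul_eq_zero.mp this with h | h
        · exact absurd (by linarith) h1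
        · linarith
      have : k = -σ := by
        refine (inner_eq_one_iff_of_norm_eq_one (𝕜 := ℝ) hk (by simpa using hσ)).mp ?_
        rw [inner_neg_right, ← hx, h1']; norm_num
      have h3 : σ = -k := by rw [this, neg_neg]
      have h2 : axialReflection k σ = -k := by
        rw [axialReflection, ← hx, h1', h3]; module
      rw [h2, h3, pairProd_neg]
      simpa using hrhs
  have hs2 : 0 < 1 - x ^ 2 := lt_of_le_of_ne (by nlinarith [hxI.1, hxI.2]) (Ne.symm h0)
  set s := √(1 - x ^ 2) with hsdef
  have hs : 0 < s := Real.sqrt_pos.mpr hs2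
  have hss : s ^ 2 = 1 - x ^ 2 := Real.sq_sqrt hs2.le
  -- `φ` is the unit vector orthogonal to `k` in the plane of `k` and `σ`; the great circle `e` passes
  -- through `k` at `0`, and through `σ` and its axial reflection at the angles `± arccos x`
  set φ : Vel d := s⁻¹ • (σ - x • k) with hφ
  have hkφ : inner ℝ k φ = 0 := by
    rw [hφ, inner_smul_right, inner_sub_right, inner_smul_right, hkk, ← hx]; ring
  have hφφ : inner ℝ φ φ = 1 := by
    rw [hφ, inner_smul_right, inner_smul_left, inner_sub_right, inner_sub_left, inner_sub_left,
      inner_smul_right, inner_smul_left, inner_smul_right, inner_smul_left, hkk, hσσ,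
      real_inner_comm k σ, ← hx]
    simp only [conj_trivial]
    field_simp
    rw [hss]; ring
  have hφσ : s • φ = σ - x • k := by rw [hφ, smul_smul, mul_inv_cancel₀ hs.ne', one_smul]
  set e : ℝ → Vel d := fun t => Real.cos t • k + Real.sin t • φ with he
  set e1 : ℝ → Vel d := fun t => -Real.sin t • k + Real.cos t • φ with he1
  have hφk : inner ℝ φ k = 0 := by rw [real_inner_comm, hkφ]
  have hen : ∀ t, ‖e t‖ = 1 := by
    intro t
    rw [← sq_eq_sq₀ (norm_nonneg _) zero_le_one, ← real_inner_self_eq_norm_sq]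
    simp only [he, inner_add_left, inner_add_right, inner_smul_left, inner_smul_right, hkk, hkφ,
      hφk, hφφ, conj_trivial]
    nlinarith [Real.sin_sq_add_cos_sq t]
  have he1n : ∀ t, ‖e1 t‖ = 1 := by
    intro t
    rw [← sq_eq_sq₀ (norm_nonneg _) zero_le_one, ← real_inner_self_eq_norm_sq]
    simp only [he1, inner_add_left, inner_add_right, inner_smul_left, inner_smul_right, hkk, hkφ,
      hφk, hφφ, conj_trivial]
    nlinarith [Real.sin_sq_add_cos_sq t]
  have hde : ∀ t, HasDerivAt e (e1 t) t := fun t =>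
    ((Real.hasDerivAt_cos t).smul_const k).add ((Real.hasDerivAt_sin t).smul_const φ)
  have hde1 : ∀ t, HasDerivAt e1 (-e t) t := by
    intro t
    have := ((Real.hasDerivAt_sin t).neg.smul_const k).add ((Real.hasDerivAt_cos t).smul_const φ)
    exact this.congr_deriv (by simp only [he]; module)
  set ρ := r / 2 with hρ
  set a : ℝ → Vel d := fun t => c + ρ • e t
  set b : ℝ → Vel d := fun t => c - ρ • e t
  have hda : ∀ t, HasDerivAt a (ρ • e1 t) t := fun t => ((hde t).const_smul ρ).const_add c
  have hdb : ∀ t, HasDerivAt b (-(ρ • e1 t)) t := fun t => ((hde t).const_smul ρ).const_sub c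
  have hda1 : ∀ t, HasDerivAt (fun t => ρ • e1 t) (-(ρ • e t)) t := fun t =>
    ((hde1 t).const_smul ρ).congr_deriv (smul_neg _ _)
  have hdb1 : ∀ t, HasDerivAt (fun t => -(ρ • e1 t)) (- -(ρ • e t)) t := fun t => (hda1 t).neg
  set g := gradient f
  have h1 : ∀ t, HasDerivAt (fun t => f (a t) * f (b t))
      (inner ℝ (g (a t)) (ρ • e1 t) * f (b t) + f (a t) * inner ℝ (g (b t)) (-(ρ • e1 t))) t :=
    fun t => (hasDerivAt_comp_curve hf.smooth (hda t)).mul (hasDerivAt_comp_curve hf.smooth (hdb t))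
  have h2 := fun t => ((((hasDerivAt_gradient_comp_curve hf.smooth (hda t)).inner ℝ (hda1 t)).mul
    (hasDerivAt_comp_curve hf.smooth (hdb t))).add ((hasDerivAt_comp_curve hf.smooth (hda t)).mul
    ((hasDerivAt_gradient_comp_curve hf.smooth (hdb t)).inner ℝ (hdb1 t))))
  have hC : 0 ≤ C := by
    have := (abs_nonneg _).trans (hf.bound 0)
    exact nonneg_of_mul_nonneg_left this (decay_pos m 0)
  have hρ0 : 0 ≤ ρ := by positivity
  have hn1 : ∀ t, ‖ρ • e1 t‖ = ρ := fun t => by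
    rw [norm_smul, he1n, mul_one, Real.norm_of_nonneg hρ0]
  have hn0 : ∀ t, ‖ρ • e t‖ = ρ := fun t => by
    rw [norm_smul, hen, mul_one, Real.norm_of_nonneg hρ0]
  -- the symmetric second difference along `e` is controlled by the second derivative
  have key := abs_symm_diff_le (K := 2 ^ m * C ^ 2 * (r * (1 + r) * pairDecay m r c)) h1 h2 ?_
    (Real.arccos_nonneg x)
  · have hc1 : Real.cos (Real.arccos x) = x := Real.cos_arccos hxI.1 hxI.2
    have hs1 : Real.sin (Real.arccos x) = s := Real.sin_arccos x
    have ep : e (Real.arccos x) = σ := by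
      simp only [he, hc1, hs1, hφσ]; module
    have em : e (-Real.arccos x) = axialReflection k σ := by
      simp only [he, Real.cos_neg, Real.sin_neg, hc1, hs1, neg_smul, hφσ, axialReflection, ← hx]
      module
    have e0 : e 0 = k := by simp [he]
    -- `cos θ ≤ 1 - 2 θ² / π²` and `π² ≤ 10`
    have hθ : Real.arccos x ^ 2 ≤ 5 * (1 - x) := by
      have := Real.cos_le_one_sub_mul_cos_sq (x := Real.arccos x)
        (by rw [abs_of_nonneg (Real.arccos_nonneg x)]; exact Real.arccos_le_pi x)
      rw [hc1] at this
      have hpi : Real.pi ^ 2 ≤ 10 := by nlinarith [Real.pi_lt_d2, Real.pi_pos]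
      have hpi' : 0 < Real.pi ^ 2 := by positivity
      have h5 : (2 / 10) * Real.arccos x ^ 2 ≤ 2 / Real.pi ^ 2 * Real.arccos x ^ 2 := by gcongr
      linarith
    simp only [a, b, ep, em, e0] at key
    refine key.trans ?_
    calc _ ≤ 2 ^ m * C ^ 2 * (r * (1 + r) * pairDecay m r c) * (5 * (1 - x)) := by gcongr
      _ = _ := by ring
  · intro t
    have hD := decay_mul_decay_le m r c (hen t)
    have iA : ∀ (u w : Vel d), |inner ℝ u w| ≤ ‖u‖ * ‖w‖ := abs_real_inner_le_norm
    set Da := decay m (a t)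
    set Db := decay m (b t)
    have hDa : 0 < Da := decay_pos _ _
    have hDb : 0 < Db := decay_pos _ _
    have fa := hf.bound (a t)
    have fb := hf.bound (b t)
    have ga : ‖g (a t)‖ ≤ C * Da := hf.bound_grad (a t)
    have gb : ‖g (b t)‖ ≤ C * Db := hf.bound_grad (b t)
    have Ha : ‖fderiv ℝ g (a t) (ρ • e1 t)‖ ≤ C * Da * ρ := by
      refine (ContinuousLinearMap.le_opNorm _ _).trans ?_
      rw [hn1]; gcongr; exact hf.bound_hess _
    have Hb : ‖fderiv ℝ g (b t) (-(ρ • e1 t))‖ ≤ C * Db * ρ := by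
      refine (ContinuousLinearMap.le_opNorm _ _).trans ?_
      rw [norm_neg, hn1]; gcongr; exact hf.bound_hess _
    have t1 : |inner ℝ (g (a t)) (-(ρ • e t)) + inner ℝ (fderiv ℝ g (a t) (ρ • e1 t)) (ρ • e1 t)|
        ≤ C * Da * ρ + C * Da * ρ * ρ := by
      refine (abs_add_le _ _).trans (add_le_add ?_ ?_)
      · refine (iA _ _).trans ?_
        rw [norm_neg, hn0]; gcongr
      · refine (iA _ _).trans ?_
        rw [hn1]; gcongr
    have t2 : |inner ℝ (g (b t)) (- -(ρ • e t))
        + inner ℝ (fderiv ℝ g (b t) (-(ρ • e1 t))) (-(ρ • e1 t))| ≤ C * Db * ρ + C * Db * ρ * ρ := by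
      refine (abs_add_le _ _).trans (add_le_add ?_ ?_)
      · refine (iA _ _).trans ?_
        rw [neg_neg, hn0]; gcongr
      · refine (iA _ _).trans ?_
        rw [norm_neg, hn1]; gcongr
    have t3 : |inner ℝ (g (a t)) (ρ • e1 t)| ≤ C * Da * ρ := by
      refine (iA _ _).trans ?_
      rw [hn1]; gcongr
    have t4 : |inner ℝ (g (b t)) (-(ρ • e1 t))| ≤ C * Db * ρ := by
      refine (iA _ _).trans ?_
      rw [norm_neg, hn1]; gcongr
    calc _ ≤ ((C * Da * ρ + C * Da * ρ * ρ) * (C * Db) + (C * Da * ρ) * (C * Db * ρ))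
        + ((C * Da * ρ) * (C * Db * ρ) + (C * Da) * (C * Db * ρ + C * Db * ρ * ρ)) := by
          exact (abs_add_le _ _).trans (add_le_add ((abs_add_le _ _).trans
            (add_le_add (abs_mul_le_mul t1 fb) (abs_mul_le_mul t3 t4)))
            ((abs_add_le _ _).trans (add_le_add (abs_mul_le_mul t3 t4) (abs_mul_le_mul fa t2))))
      _ = C ^ 2 * (r * (1 + r)) * (Da * Db) := by rw [hρ]; ring
      _ ≤ C ^ 2 * (r * (1 + r)) * (2 ^ m * pairDecay m r c) := by gcongr
      _ = _ := by ring


/-- The integrand of `angularCollision`. -/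
def collisionIntegrand {d : ℕ} (B : ℝ → ℝ → ℝ) (f : Vel d → ℝ) (v w σ : Vel d) : ℝ :=
  ((postProd f v w σ + postProd f v w (axialReflection (dir (v - w)) σ)) / 2 - f v * f w)
    * B ‖v - w‖ (inner ℝ (dir (v - w)) σ)

/-- The dominating function `dominant` in the variables `v`, `v_*`, `σ`. -/
def velDominant {d : ℕ} (B : ℝ → ℝ → ℝ) (m : ℕ) (v w σ : Vel d) : ℝ :=
  ‖v - w‖ * (1 + ‖v - w‖) * pairDecay m ‖v - w‖ ((1 / 2 : ℝ) • (v + w)) *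
    ((1 - inner ℝ (dir (v - w)) σ) * B ‖v - w‖ (inner ℝ (dir (v - w)) σ))

lemma continuous_postProd {d : ℕ} {f : Vel d → ℝ} (hf : Continuous f) :
    Continuous fun p : (Vel d × Vel d) × Vel d => postProd f p.1.1 p.1.2 p.2 := by
  unfold postProd
  fun_prop

lemma measurable_dir {d : ℕ} : Measurable (dir : Vel d → Vel d) := by unfold dir; fun_prop

lemma measurable_vel_kernel {d : ℕ} {B : ℝ → ℝ → ℝ} (hB : Measurable (Function.uncurry B)) :
    Measurable fun p : (Vel d × Vel d) × Sph d =>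
      B ‖p.1.1 - p.1.2‖ (inner ℝ (dir (p.1.1 - p.1.2)) (p.2 : Vel d)) := by
  have := measurable_dir (d := d)
  exact hB.comp (f := fun p : (Vel d × Vel d) × Sph d =>
    (‖p.1.1 - p.1.2‖, inner ℝ (dir (p.1.1 - p.1.2)) (p.2 : Vel d))) (by fun_prop)

lemma measurable_collisionIntegrand {d : ℕ} {B : ℝ → ℝ → ℝ} (hB : Measurable (Function.uncurry B))
    {f : Vel d → ℝ} (hf : Continuous f) : Measurable fun p : (Vel d × Vel d) × Sph d =>
      collisionIntegrand B f p.1.1 p.1.2 (p.2 : Vel d) := by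
  have h1 := (continuous_postProd hf).measurable
  have h2 := measurable_dir (d := d)
  have h3 : Measurable fun p : (Vel d × Vel d) × Sph d =>
      axialReflection (dir (p.1.1 - p.1.2)) (p.2 : Vel d) := by
    unfold axialReflection; fun_prop
  have h4 : Measurable fun p : (Vel d × Vel d) × Sph d => postProd f p.1.1 p.1.2 (p.2 : Vel d) :=
    h1.comp (f := fun p : (Vel d × Vel d) × Sph d => (p.1, (p.2 : Vel d))) (by fun_prop)
  have h5 := h1.comp (f := fun p : (Vel d × Vel d) × Sph d =>
    (p.1, axialReflection (dir (p.1.1 - p.1.2)) (p.2 : Vel d))) (measurable_fst.prodMk h3)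
  exact (((h4.add h5).div_const 2).sub (by fun_prop)).mul (measurable_vel_kernel hB)

lemma measurable_velDominant {d : ℕ} {B : ℝ → ℝ → ℝ} (hB : Measurable (Function.uncurry B))
    (m : ℕ) : Measurable fun p : (Vel d × Vel d) × Sph d =>
      velDominant B m p.1.1 p.1.2 (p.2 : Vel d) := by
  have h2 := measurable_dir (d := d)
  unfold velDominant pairDecay
  exact Measurable.mul (by fun_prop) (Measurable.mul (by fun_prop) (measurable_vel_kernel hB))

lemma dir_inner_mem {d : ℕ} {z : Vel d} (hz : z ≠ 0) (σ : Sph d) :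
    inner ℝ (dir z) (σ : Vel d) ∈ Icc (-1 : ℝ) 1 :=
  inner_sph_mem_Icc ⟨dir z, dir_mem_sphere hz⟩ σ

lemma velDominant_nonneg {d : ℕ} {B : ℝ → ℝ → ℝ} (hB : IsCollisionKernel d B) (m : ℕ)
    (v w : Vel d) (σ : Sph d) : 0 ≤ velDominant B m v w (σ : Vel d) := by
  rcases eq_or_ne v w with rfl | h
  · simp [velDominant]
  · have hz : v - w ≠ 0 := sub_ne_zero.mpr h
    have := one_sub_inner_mul_nonneg hB (norm_pos_iff.mpr hz) (k := ⟨dir _, dir_mem_sphere hz⟩)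
      (σ := σ)
    have h2 := pairDecay_pos m ‖v - w‖ ((1 / 2 : ℝ) • (v + w))
    exact mul_nonneg (by positivity) this

/-- Any kernel `b` below `B` leads to a collision integrand dominated by `velDominant B`. -/
lemma abs_collisionIntegrand_le {d m : ℕ} {B b : ℝ → ℝ → ℝ}
    (hb : ∀ r, 0 < r → ∀ x ∈ Ico (-1 : ℝ) 1, |b r x| ≤ B r x) {C : ℝ} {f : Vel d → ℝ}
    (hf : HasDecay m C f) (v w : Vel d) (σ : Sph d) :
    |collisionIntegrand b f v w (σ : Vel d)|
      ≤ 5 * 2 ^ m * C ^ 2 * velDominant B m v w (σ : Vel d) := by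
  rcases eq_or_ne v w with rfl | hvw
  · simp [collisionIntegrand, velDominant, postProd, smul_smul, ← two_smul ℝ v]
  have hz : v - w ≠ 0 := sub_ne_zero.mpr hvw
  have hr : 0 < ‖v - w‖ := norm_pos_iff.mpr hz
  have hk : ‖dir (v - w)‖ = 1 := by simpa using dir_mem_sphere hz
  have h1 := abs_pairProd_average_sub_le hf hr.le ((1 / 2 : ℝ) • (v + w)) hk
    (norm_eq_of_mem_sphere σ)
  have hx := dir_inner_mem hz σ
  rw [collisionIntegrand, velDominant, abs_mul]
  simp only [postProd_eq_pairProd, mul_eq_pairProd f v w]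
  rcases lt_or_ge (inner ℝ (dir (v - w)) (σ : Vel d)) 1 with h | h
  · calc _ ≤ 5 * 2 ^ m * C ^ 2 * (‖v - w‖ * (1 + ‖v - w‖)
          * pairDecay m ‖v - w‖ ((1 / 2 : ℝ) • (v + w)) * (1 - inner ℝ (dir (v - w)) (σ : Vel d)))
          * B ‖v - w‖ (inner ℝ (dir (v - w)) (σ : Vel d)) := by
          gcongr
          · exact (abs_nonneg _).trans h1
          · exact hb _ hr _ ⟨hx.1, h⟩
      _ = _ := by ring
  · have h0 : inner ℝ (dir (v - w)) (σ : Vel d) = 1 := le_antisymm hx.2 h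
    rw [h0, sub_self, mul_zero, mul_zero] at h1
    rw [abs_nonpos_iff.mp h1, h0]
    simp

/-- The integral of the dominating function over `(v_*, σ)` is finite for each `v` and decays
algebraically in `v`. -/
theorem exists_lintegral_velDominant_le {d : ℕ} {B : ℝ → ℝ → ℝ} (hB : IsCollisionKernel d B) :
    ∃ N₀ : ℕ, ∀ m ≥ N₀, ∃ K : ℝ, 0 ≤ K ∧ ∀ v : Vel d,
      ∫⁻ p : Vel d × Sph d, ENNReal.ofReal (velDominant B m v p.1 (p.2 : Vel d))
        ∂(volume.prod (surf d)) ≤ ENNReal.ofReal (K * decay (m - N₀) v) := by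
  obtain ⟨N, hN⟩ := hB.tempered
  refine ⟨N + 1, fun m hm => ?_⟩
  set T := ∫⁻ z : Vel d, ENNReal.ofReal (‖z‖ / (1 + ‖z‖) ^ N) * momentumTransfer B z with hT
  refine ⟨2 ^ (N + 1) * 2 ^ (m - (N + 1)) * T.toReal, by positivity, fun v => ?_⟩
  have hmeas := (measurable_velDominant (d := d) hB.measurable m).ennreal_ofReal
  have hM := measurable_momentumTransfer (d := d) hB.measurable
  have hmeas_v : Measurable fun p : Vel d × Sph d =>
      ENNReal.ofReal (velDominant B m v p.1 (p.2 : Vel d)) :=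
    hmeas.comp (f := fun p : Vel d × Sph d => ((v, p.1), p.2)) (by fun_prop)
  rw [lintegral_prod _ hmeas_v.aemeasurable]
  calc ∫⁻ w : Vel d, ∫⁻ σ : Sph d, ENNReal.ofReal (velDominant B m v w (σ : Vel d)) ∂(surf d)
      ≤ ∫⁻ w : Vel d, ENNReal.ofReal (2 ^ (N + 1) * 2 ^ (m - (N + 1)) * decay (m - (N + 1)) v) *
        (ENNReal.ofReal (‖v - w‖ / (1 + ‖v - w‖) ^ N) * momentumTransfer B (v - w)) := by
        refine lintegral_mono fun w => ?_
        have hP := pairDecay_pos m ‖v - w‖ ((1 / 2 : ℝ) • (v + w))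
        have e1 : ∀ σ : Sph d, ENNReal.ofReal (velDominant B m v w (σ : Vel d))
            = ENNReal.ofReal (‖v - w‖ * (1 + ‖v - w‖)
              * pairDecay m ‖v - w‖ ((1 / 2 : ℝ) • (v + w))) * ENNReal.ofReal
              ((1 - inner ℝ (dir (v - w)) (σ : Vel d))
                * B ‖v - w‖ (inner ℝ (dir (v - w)) (σ : Vel d))) := fun σ => by
          rw [velDominant, ENNReal.ofReal_mul (by positivity)]
        simp only [e1]
        rw [lintegral_const_mul' _ _ ENNReal.ofReal_ne_top, ← mul_assoc,
          ← ENNReal.ofReal_mul (by have := decay_pos (m - (N + 1)) v; positivity)]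
        refine mul_le_mul_left (ENNReal.ofReal_le_ofReal ?_) _
        have hA : (1 + ‖v‖ ^ 2) / 2 ≤ 1 + ‖(1 / 2 : ℝ) • (v + w)‖ ^ 2 + ‖v - w‖ ^ 2 := by
          have h := parallelogram_law_with_norm ℝ v w
          rw [norm_smul, mul_pow]
          norm_num
          nlinarith [sq_nonneg ‖w‖, sq_nonneg ‖v - w‖]
        refine (one_add_mul_pairDecay_le (N := N) hm (norm_nonneg _) _ (by positivity) hA).trans
          (le_of_eq ?_)
        rw [decay, div_pow, inv_div]
        field_simp
    _ = ENNReal.ofReal (2 ^ (N + 1) * 2 ^ (m - (N + 1)) * decay (m - (N + 1)) v) * T := by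
        rw [lintegral_const_mul _ (by fun_prop), lintegral_sub_left_eq_self
          (fun z : Vel d => ENNReal.ofReal (‖z‖ / (1 + ‖z‖) ^ N) * momentumTransfer B z) v]
    _ = _ := by
        conv_lhs => rw [← ENNReal.ofReal_toReal hN.ne]
        rw [← ENNReal.ofReal_mul (by have := decay_pos (m - (N + 1)) v; positivity)]
        congr 1; ring

lemma integrable_velDominant_slice {d m : ℕ} {B : ℝ → ℝ → ℝ} (hB : IsCollisionKernel d B)
    {K : ℝ} {N₀ : ℕ} (hK : ∀ v : Vel d, ∫⁻ p : Vel d × Sph d,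
      ENNReal.ofReal (velDominant B m v p.1 (p.2 : Vel d)) ∂(volume.prod (surf d))
        ≤ ENNReal.ofReal (K * decay (m - N₀) v)) (v : Vel d) :
    Integrable (fun p : Vel d × Sph d => velDominant B m v p.1 (p.2 : Vel d))
      (volume.prod (surf d)) := by
  refine ⟨((measurable_velDominant hB.measurable m).comp
    (f := fun p : Vel d × Sph d => ((v, p.1), p.2)) (by fun_prop)).aestronglyMeasurable, ?_⟩
  refine lt_of_le_of_lt ?_ ((hK v).trans_lt ENNReal.ofReal_lt_top)
  exact lintegral_mono fun p => (Real.enorm_eq_ofReal (velDominant_nonneg hB m v p.1 p.2)).le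

lemma integrable_collisionIntegrand_slice {d m : ℕ} {B : ℝ → ℝ → ℝ} (hB : IsCollisionKernel d B)
    {v : Vel d} (hv : Integrable (fun p : Vel d × Sph d => velDominant B m v p.1 (p.2 : Vel d))
      (volume.prod (surf d))) {C : ℝ} {f : Vel d → ℝ} (hf : HasDecay m C f) :
    Integrable (fun p : Vel d × Sph d => collisionIntegrand B f v p.1 (p.2 : Vel d))
      (volume.prod (surf d)) := by
  refine (hv.const_mul (5 * 2 ^ m * C ^ 2)).mono'
    ((measurable_collisionIntegrand hB.measurable hf.smooth.continuous).comp
    (f := fun p : Vel d × Sph d => ((v, p.1), p.2)) (by fun_prop)).aestronglyMeasurable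
    (ae_of_all _ fun p => ?_)
  exact abs_collisionIntegrand_le (fun r hr x hx => (abs_of_nonneg (hB.nonneg r hr x hx)).le) hf
    v p.1 p.2

lemma boltzmannQ_eq {d m : ℕ} {B : ℝ → ℝ → ℝ} (hB : IsCollisionKernel d B)
    {v : Vel d} (hv : Integrable (fun p : Vel d × Sph d => velDominant B m v p.1 (p.2 : Vel d))
      (volume.prod (surf d))) {C : ℝ} {f : Vel d → ℝ} (hf : HasDecay m C f) :
    boltzmannQ B f v = ∫ p : Vel d × Sph d, collisionIntegrand B f v p.1 (p.2 : Vel d)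
      ∂(volume.prod (surf d)) :=
  (integral_prod _ (integrable_collisionIntegrand_slice hB hv hf)).symm

lemma abs_boltzmannQ_le {d m : ℕ} {B : ℝ → ℝ → ℝ} (hB : IsCollisionKernel d B)
    {v : Vel d} (hv : Integrable (fun p : Vel d × Sph d => velDominant B m v p.1 (p.2 : Vel d))
      (volume.prod (surf d))) {C : ℝ} {f : Vel d → ℝ} (hf : HasDecay m C f) :
    |boltzmannQ B f v| ≤ 5 * 2 ^ m * C ^ 2 *
      ∫ p : Vel d × Sph d, velDominant B m v p.1 (p.2 : Vel d) ∂(volume.prod (surf d)) := by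
  rw [boltzmannQ_eq hB hv hf, ← integral_const_mul]
  refine abs_integral_le_integral_abs.trans ?_
  exact integral_mono (integrable_collisionIntegrand_slice hB hv hf).abs (hv.const_mul _)
    fun p => abs_collisionIntegrand_le
      (fun r hr x hx => (abs_of_nonneg (hB.nonneg r hr x hx)).le) hf v p.1 p.2

lemma integral_velDominant_le {d m : ℕ} {B : ℝ → ℝ → ℝ} (hB : IsCollisionKernel d B) {v : Vel d}
    {A : ℝ} (hA : 0 ≤ A) (h : ∫⁻ p : Vel d × Sph d,
      ENNReal.ofReal (velDominant B m v p.1 (p.2 : Vel d)) ∂(volume.prod (surf d))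
        ≤ ENNReal.ofReal A) (hv : Integrable (fun p : Vel d × Sph d =>
          velDominant B m v p.1 (p.2 : Vel d)) (volume.prod (surf d))) :
    ∫ p : Vel d × Sph d, velDominant B m v p.1 (p.2 : Vel d) ∂(volume.prod (surf d)) ≤ A := by
  have h0 : 0 ≤ᵐ[volume.prod (surf d)] fun p : Vel d × Sph d =>
      velDominant B m v p.1 (p.2 : Vel d) := ae_of_all _ fun p => velDominant_nonneg hB m v p.1 p.2
  rw [integral_eq_lintegral_of_nonneg_ae h0 hv.aestronglyMeasurable]
  exact ENNReal.toReal_le_of_le_ofReal hA h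

/-- The collision operator preserves algebraic decay up to a fixed loss in the exponent. -/
theorem exists_boltzmannQ_bound {d : ℕ} {B : ℝ → ℝ → ℝ} (hB : IsCollisionKernel d B) :
    ∃ N₀ : ℕ, ∀ m ≥ N₀, ∃ K : ℝ, 0 ≤ K ∧
      (∀ v : Vel d, Integrable (fun p : Vel d × Sph d => velDominant B m v p.1 (p.2 : Vel d))
        (volume.prod (surf d))) ∧
      ∀ (C : ℝ) (f : Vel d → ℝ), HasDecay m C f → ∀ v,
        |boltzmannQ B f v| ≤ K * C ^ 2 * decay (m - N₀) v := by
  obtain ⟨N₀, h⟩ := exists_lintegral_velDominant_le hB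
  refine ⟨N₀, fun m hm => ?_⟩
  obtain ⟨K, hK0, hK⟩ := h m hm
  have hv := integrable_velDominant_slice hB hK
  refine ⟨5 * 2 ^ m * K, by positivity, hv, fun C f hf v => ?_⟩
  have h1 := abs_boltzmannQ_le hB (hv v) hf
  have h2 := integral_velDominant_le hB (mul_nonneg hK0 (decay_pos (m - N₀) v).le) (hK v) (hv v)
  refine h1.trans ((mul_le_mul_of_nonneg_left h2 (by positivity)).trans (le_of_eq ?_))
  ring

/-- Quadratic expansion of `Q(f + ε g)`, with the polar form written in terms of `Q` itself. -/
lemma boltzmannQ_add_smul {d m : ℕ} {B : ℝ → ℝ → ℝ} (hB : IsCollisionKernel d B)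
    {v : Vel d} (hv : Integrable (fun p : Vel d × Sph d => velDominant B m v p.1 (p.2 : Vel d))
      (volume.prod (surf d))) {C₁ C₂ C₃ C₄ : ℝ} {f g : Vel d → ℝ} (hf : HasDecay m C₁ f)
    (hg : HasDecay m C₂ g) (hfg : HasDecay m C₃ fun v => f v + g v) (ε : ℝ)
    (hε : HasDecay m C₄ fun v => f v + ε * g v) :
    boltzmannQ B (fun v => f v + ε * g v) v = boltzmannQ B f v
      + ε * (boltzmannQ B (fun v => f v + g v) v - boltzmannQ B f v - boltzmannQ B g v)
      + ε ^ 2 * boltzmannQ B g v := by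
  rw [boltzmannQ_eq hB hv hf, boltzmannQ_eq hB hv hg, boltzmannQ_eq hB hv hfg,
    boltzmannQ_eq hB hv hε]
  have i1 := integrable_collisionIntegrand_slice hB hv hf
  have i2 := integrable_collisionIntegrand_slice hB hv hg
  have i3 := integrable_collisionIntegrand_slice hB hv hfg
  have i31 : Integrable (fun p : Vel d × Sph d =>
      collisionIntegrand B (fun v => f v + g v) v p.1 (p.2 : Vel d)
        - collisionIntegrand B f v p.1 (p.2 : Vel d)) (volume.prod (surf d)) := i3.sub i1
  have i312 : Integrable (fun p : Vel d × Sph d =>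
      collisionIntegrand B (fun v => f v + g v) v p.1 (p.2 : Vel d)
        - collisionIntegrand B f v p.1 (p.2 : Vel d) - collisionIntegrand B g v p.1 (p.2 : Vel d))
      (volume.prod (surf d)) := i31.sub i2
  rw [← integral_sub i3 i1, ← integral_sub i31 i2, ← integral_const_mul, ← integral_const_mul,
    ← integral_add i1 (i312.const_mul _), ← integral_add _ (i2.const_mul _)]
  · refine integral_congr_ae (ae_of_all _ fun p => ?_)
    simp only [collisionIntegrand, postProd]
    ring
  · exact i1.add (i312.const_mul _)


/-! ### Dissipation along measure-preserving flows -/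

/-- If `G'` is the derivative of `G` along a measure-preserving flow, then `∫ G' = 0`. -/
theorem integral_eq_zero_of_flow {α : Type*} [MeasurableSpace α] {μ : Measure α} [SFinite μ]
    {T : ℝ → α → α} (hT : Measurable (Function.uncurry T))
    (hmp : ∀ s, MeasurePreserving (T s) μ μ) {G G' : α → ℝ} (hG : Integrable G μ)
    (hG' : Integrable G' μ) (hm : Measurable G')
    (hder : ∀ x s, HasDerivAt (fun s => G (T s x)) (G' (T s x)) s) : ∫ x, G' x ∂μ = 0 := by
  set ν : Measure ℝ := volume.restrict (Ioc 0 1)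
  have hm' : Measurable (Function.uncurry fun s x => G' (T s x)) := hm.comp hT
  have hH : Integrable (Function.uncurry fun s x => G' (T s x)) (ν.prod μ) := by
    refine ⟨hm'.aestronglyMeasurable, ?_⟩
    rw [HasFiniteIntegral, lintegral_prod _ hm'.enorm.aemeasurable]
    have : ∀ s, ∫⁻ x, ‖Function.uncurry (fun s x => G' (T s x)) (s, x)‖ₑ ∂μ
        = ∫⁻ x, ‖G' x‖ₑ ∂μ := fun s => (hmp s).lintegral_comp hm.enorm
    simp only [this]
    simpa [ν, hasFiniteIntegral_iff_enorm] using hG'.2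
  have h1 : ∫ s, ∫ x, G' (T s x) ∂μ ∂ν = ∫ x, G' x ∂μ := by
    have : ∀ s, ∫ x, G' (T s x) ∂μ = ∫ x, G' x ∂μ := fun s => by
      rw [← integral_map (hmp s).aemeasurable hm.aestronglyMeasurable, (hmp s).map_eq]
    simp only [this]
    simp [ν]
  have h2 : ∀ s, Integrable (fun x => G (T s x)) μ ∧ ∫ x, G (T s x) ∂μ = ∫ x, G x ∂μ := by
    intro s
    have hGs : AEStronglyMeasurable G (Measure.map (T s) μ) := by
      rw [(hmp s).map_eq]; exact hG.1
    refine ⟨(hmp s).integrable_comp_of_integrable hG, ?_⟩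
    rw [← integral_map (hmp s).aemeasurable hGs, (hmp s).map_eq]
  rw [← h1, integral_integral_swap hH]
  have h3 : ∀ᵐ x ∂μ, ∫ s, G' (T s x) ∂ν = G (T 1 x) - G (T 0 x) := by
    filter_upwards [hH.prod_left_ae] with x hx
    have hx' : IntervalIntegrable (fun s => G' (T s x)) volume 0 1 :=
      (intervalIntegrable_iff_integrableOn_Ioc_of_le zero_le_one).mpr hx
    rw [← intervalIntegral.integral_eq_sub_of_hasDerivAt (fun s _ => hder x s) hx',
      intervalIntegral.integral_of_le zero_le_one]
  rw [integral_congr_ae h3, integral_sub (h2 1).1 (h2 0).1, (h2 1).2, (h2 0).2, sub_self]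

/-- A nonnegative kernel, supported in a compact range of relative speeds, that is integrable
against `pairDecay m`. -/
structure IsCutoffKernel (d m : ℕ) (R : ℝ) (b : ℝ → ℝ → ℝ) : Prop where
  measurable : Measurable (Function.uncurry b)
  nonneg : ∀ r x, 0 ≤ b r x
  pos : 0 < R
  support : ∀ r x, b r x ≠ 0 → r ∈ Icc R⁻¹ R
  integrable : Integrable (fun q : Param d => pairDecay m q.1 q.2.1
    * b q.1 (inner ℝ (q.2.2.1 : Vel d) (q.2.2.2 : Vel d))) (paramMeasure d)

lemma IsCutoffKernel.integrable_mul {d m : ℕ} {R : ℝ} {b : ℝ → ℝ → ℝ}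
    (hb : IsCutoffKernel d m R b) {g : Param d → ℝ} (hg : Measurable g) {A : ℝ}
    (h : ∀ q : Param d, q.1 ∈ Icc R⁻¹ R → |g q| ≤ A * pairDecay m q.1 q.2.1) :
    Integrable (fun q : Param d => g q * b q.1 (inner ℝ (q.2.2.1 : Vel d) (q.2.2.2 : Vel d)))
      (paramMeasure d) := by
  refine (hb.integrable.const_mul A).mono'
    (hg.mul (measurable_kernel hb.measurable)).aestronglyMeasurable (ae_of_all _ fun q => ?_)
  have h0 := hb.nonneg q.1 (inner ℝ (q.2.2.1 : Vel d) (q.2.2.2 : Vel d))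
  rw [Real.norm_eq_abs, abs_mul, abs_of_nonneg h0, ← mul_assoc]
  rcases h0.eq_or_lt with h1 | h1
  · simp [← h1]
  · exact mul_le_mul_of_nonneg_right (h q (hb.support _ _ h1.ne')) h0

lemma measurePreserving_param_prod {d : ℕ} {T : Sph d × Sph d → Sph d × Sph d}
    (hT : MeasurePreserving T ((surf d).prod (surf d)) ((surf d).prod (surf d))) {S : Vel d → Vel d}
    (hS : MeasurePreserving S volume volume) :
    MeasurePreserving (fun q : Param d => ((q.1, (S q.2.1, T q.2.2)) : Param d)) (paramMeasure d)
      (paramMeasure d) :=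
  (MeasurePreserving.id _).prod (hS.prod hT)

lemma measurePreserving_param_swap (d : ℕ) :
    MeasurePreserving (fun q : Param d => ((q.1, (q.2.1, (q.2.2.2, q.2.2.1))) : Param d))
      (paramMeasure d) (paramMeasure d) :=
  measurePreserving_param_prod (T := Prod.swap) Measure.measurePreserving_swap
    (MeasurePreserving.id _)

/-- Integrals against a kernel depending on `r` and `k·σ` only are symmetric in `k` and `σ`. -/
lemma integral_kernel_swap {d : ℕ} {b : ℝ → ℝ → ℝ} (hb : Measurable (Function.uncurry b))
    {g : Param d → ℝ} (hg : Measurable g) :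
    ∫ q : Param d, g (q.1, (q.2.1, (q.2.2.2, q.2.2.1)))
        * b q.1 (inner ℝ (q.2.2.1 : Vel d) (q.2.2.2 : Vel d)) ∂(paramMeasure d)
      = ∫ q : Param d, g q * b q.1 (inner ℝ (q.2.2.1 : Vel d) (q.2.2.2 : Vel d))
        ∂(paramMeasure d) := by
  have hs := measurePreserving_param_swap d
  have hm : Measurable fun q : Param d =>
      g q * b q.1 (inner ℝ (q.2.2.1 : Vel d) (q.2.2.2 : Vel d)) := hg.mul (measurable_kernel hb)
  conv_rhs => rw [← hs.map_eq]
  rw [integral_map hs.aemeasurable hm.aestronglyMeasurable]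
  refine integral_congr_ae (ae_of_all _ fun q => ?_)
  simp only [real_inner_comm]

/-- The symmetrisation behind every dissipation estimate. Here `F` stands for `f ⊗ f`, and `u`, `v`
for first and second derivatives of `log F`; the derivative of `(F' - F) (u' - u)` is
`(F' u' - F u) (u' - u) + (F' - F) (v' - v)`. -/
theorem dissipation_symmetrisation {d m : ℕ} {R : ℝ} {b : ℝ → ℝ → ℝ}
    (hb : IsCutoffKernel d m R b) {F u v : ℝ × (Vel d × Sph d) → ℝ} (hF : Measurable F)
    (hu : Measurable u) (hv : Measurable v) {A : ℝ}
    (hFA : ∀ p, p.1 ∈ Icc R⁻¹ R → |F p| ≤ A * pairDecay m p.1 p.2.1)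
    (huA : ∀ p, p.1 ∈ Icc R⁻¹ R → |u p| ≤ A) (hvA : ∀ p, p.1 ∈ Icc R⁻¹ R → |v p| ≤ A) :
    ∫ q : Param d, ((F (q.1, q.2.1, q.2.2.2) - F (q.1, q.2.1, q.2.2.1))
        * (-2 * v (q.1, q.2.1, q.2.2.1) - u (q.1, q.2.1, q.2.2.1) ^ 2))
        * b q.1 (inner ℝ (q.2.2.1 : Vel d) (q.2.2.2 : Vel d)) ∂(paramMeasure d)
      = ∫ q : Param d, ((F (q.1, q.2.1, q.2.2.2) * u (q.1, q.2.1, q.2.2.2)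
          - F (q.1, q.2.1, q.2.2.1) * u (q.1, q.2.1, q.2.2.1))
          * (u (q.1, q.2.1, q.2.2.2) - u (q.1, q.2.1, q.2.2.1))
          + (F (q.1, q.2.1, q.2.2.2) - F (q.1, q.2.1, q.2.2.1))
          * (v (q.1, q.2.1, q.2.2.2) - v (q.1, q.2.1, q.2.2.1)))
          * b q.1 (inner ℝ (q.2.2.1 : Vel d) (q.2.2.2 : Vel d)) ∂(paramMeasure d)
        - ∫ q : Param d, (F (q.1, q.2.1, q.2.2.1)
          * (u (q.1, q.2.1, q.2.2.2) - u (q.1, q.2.1, q.2.2.1)) ^ 2)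
          * b q.1 (inner ℝ (q.2.2.1 : Vel d) (q.2.2.2 : Vel d)) ∂(paramMeasure d) := by
  set Fk : Param d → ℝ := fun q => F (q.1, q.2.1, q.2.2.1) with hFk
  set Fs : Param d → ℝ := fun q => F (q.1, q.2.1, q.2.2.2) with hFs
  set uk : Param d → ℝ := fun q => u (q.1, q.2.1, q.2.2.1) with huk
  set us : Param d → ℝ := fun q => u (q.1, q.2.1, q.2.2.2) with hus
  set vk : Param d → ℝ := fun q => v (q.1, q.2.1, q.2.2.1) with hvk
  set vs : Param d → ℝ := fun q => v (q.1, q.2.1, q.2.2.2) with hvs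
  set β : Param d → ℝ := fun q => b q.1 (inner ℝ (q.2.2.1 : Vel d) (q.2.2.2 : Vel d)) with hβ
  have mFk : Measurable Fk := hF.comp (by fun_prop)
  have mFs : Measurable Fs := hF.comp (by fun_prop)
  have muk : Measurable uk := hu.comp (by fun_prop)
  have mus : Measurable us := hu.comp (by fun_prop)
  have mvk : Measurable vk := hv.comp (by fun_prop)
  have mvs : Measurable vs := hv.comp (by fun_prop)
  -- every term is a multiple of `F` or `F'` by a bounded function
  have int : ∀ (g h : Param d → ℝ), Measurable g → Measurable h → ∀ D : ℝ,
      (∀ q, q.1 ∈ Icc R⁻¹ R → |g q| ≤ A * pairDecay m q.1 q.2.1) →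
      (∀ q, q.1 ∈ Icc R⁻¹ R → |h q| ≤ D) → Integrable (fun q => g q * h q * β q)
        (paramMeasure d) := by
    intro g h hg hh D h1 h2
    refine hb.integrable_mul (A := A * D) (hg.mul hh) fun q hq => ?_
    refine (abs_mul_le_mul (h1 q hq) (h2 q hq)).trans (le_of_eq (by ring))
  have bFk : ∀ q : Param d, q.1 ∈ Icc R⁻¹ R → |Fk q| ≤ A * pairDecay m q.1 q.2.1 :=
    fun q hq => hFA _ hq
  have bFs : ∀ q : Param d, q.1 ∈ Icc R⁻¹ R → |Fs q| ≤ A * pairDecay m q.1 q.2.1 :=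
    fun q hq => hFA _ hq
  have b1 : ∀ (s t w z : ℝ), |s| ≤ A → |t| ≤ A → |w| ≤ A → |z| ≤ A → ∀ x : ℝ,
      (x = -2 * s - t ^ 2 ∨ x = (t - w) ^ 2 ∨ x = w * (t - w) + (s - z)) →
      |x| ≤ 4 * A ^ 2 + 2 * A := by
    intro s t w z hs ht hw hz x hx
    have hA : 0 ≤ A := (abs_nonneg _).trans hs
    have hs' := abs_le.mp hs
    have ht' := abs_le.mp ht
    have hw' := abs_le.mp hw
    have hz' := abs_le.mp hz
    have q1 : |t * t| ≤ A * A := abs_mul_le_mul ht ht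
    have q2 : |w * w| ≤ A * A := abs_mul_le_mul hw hw
    have q3 : |w * t| ≤ A * A := abs_mul_le_mul hw ht
    have q1' := abs_le.mp q1
    have q2' := abs_le.mp q2
    have q3' := abs_le.mp q3
    rcases hx with rfl | rfl | rfl <;> rw [abs_le] <;> constructor <;> nlinarith
  have I1 : Integrable (fun q => Fs q * (-2 * vk q - uk q ^ 2) * β q) (paramMeasure d) :=
    int _ _ mFs (by fun_prop) _ bFs fun q hq => b1 (vk q) (uk q) (uk q) (uk q) (hvA _ hq)
      (huA _ hq) (huA _ hq) (huA _ hq) _ (Or.inl rfl)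
  have I2 : Integrable (fun q => Fk q * (-2 * vk q - uk q ^ 2) * β q) (paramMeasure d) :=
    int _ _ mFk (by fun_prop) _ bFk fun q hq => b1 (vk q) (uk q) (uk q) (uk q) (hvA _ hq)
      (huA _ hq) (huA _ hq) (huA _ hq) _ (Or.inl rfl)
  have I3 : Integrable (fun q => Fk q * (us q - uk q) ^ 2 * β q) (paramMeasure d) :=
    int _ _ mFk (by fun_prop) _ bFk fun q hq => b1 (vk q) (us q) (uk q) (uk q) (hvA _ hq)
      (huA _ hq) (huA _ hq) (huA _ hq) _ (Or.inr (Or.inl rfl))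
  have I4 : Integrable (fun q => Fs q * (us q - uk q) ^ 2 * β q) (paramMeasure d) :=
    int _ _ mFs (by fun_prop) _ bFs fun q hq => b1 (vk q) (us q) (uk q) (uk q) (hvA _ hq)
      (huA _ hq) (huA _ hq) (huA _ hq) _ (Or.inr (Or.inl rfl))
  have I5 : Integrable (fun q => Fs q * (-2 * vs q - us q ^ 2) * β q) (paramMeasure d) :=
    int _ _ mFs (by fun_prop) _ bFs fun q hq => b1 (vs q) (us q) (us q) (us q) (hvA _ hq)
      (huA _ hq) (huA _ hq) (huA _ hq) _ (Or.inl rfl)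
  have I6 : Integrable (fun q => Fk q * (-2 * vs q - us q ^ 2) * β q) (paramMeasure d) :=
    int _ _ mFk (by fun_prop) _ bFk fun q hq => b1 (vs q) (us q) (us q) (us q) (hvA _ hq)
      (huA _ hq) (huA _ hq) (huA _ hq) _ (Or.inl rfl)
  have E1 : ∫ q, (Fk q - Fs q) * (-2 * vs q - us q ^ 2) * β q ∂(paramMeasure d)
      = ∫ q, (Fs q - Fk q) * (-2 * vk q - uk q ^ 2) * β q ∂(paramMeasure d) :=
    integral_kernel_swap hb.measurable
      (g := fun q => (Fs q - Fk q) * (-2 * vk q - uk q ^ 2)) (by fun_prop)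
  have E2 : ∫ q, Fs q * (uk q - us q) ^ 2 * β q ∂(paramMeasure d)
      = ∫ q, Fk q * (us q - uk q) ^ 2 * β q ∂(paramMeasure d) :=
    integral_kernel_swap hb.measurable (g := fun q => Fk q * (us q - uk q) ^ 2) (by fun_prop)
  have E2' : ∫ q, Fs q * (us q - uk q) ^ 2 * β q ∂(paramMeasure d)
      = ∫ q, Fk q * (us q - uk q) ^ 2 * β q ∂(paramMeasure d) := by
    rw [← E2]
    refine integral_congr_ae (ae_of_all _ fun q => ?_)
    simp only; ring
  have J1 : Integrable (fun q => (Fs q - Fk q) * (-2 * vk q - uk q ^ 2) * β q) (paramMeasure d) :=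
    (I1.sub I2).congr (ae_of_all _ fun q => by simp only [Pi.sub_apply]; ring)
  have J2 : Integrable (fun q => (Fk q - Fs q) * (-2 * vs q - us q ^ 2) * β q) (paramMeasure d) :=
    (I6.sub I5).congr (ae_of_all _ fun q => by simp only [Pi.sub_apply]; ring)
  have key : ∫ q, ((Fs q * us q - Fk q * uk q) * (us q - uk q) + (Fs q - Fk q) * (vs q - vk q))
        * β q ∂(paramMeasure d)
      = (1 / 2) * (∫ q, (Fs q - Fk q) * (-2 * vk q - uk q ^ 2) * β q ∂(paramMeasure d)
        + ∫ q, (Fk q - Fs q) * (-2 * vs q - us q ^ 2) * β q ∂(paramMeasure d)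
        + (∫ q, Fk q * (us q - uk q) ^ 2 * β q ∂(paramMeasure d)
        + ∫ q, Fs q * (us q - uk q) ^ 2 * β q ∂(paramMeasure d))) := by
    have J3 : Integrable (fun q => Fk q * (us q - uk q) ^ 2 * β q
        + Fs q * (us q - uk q) ^ 2 * β q) (paramMeasure d) := I3.add I4
    have J4 : Integrable (fun q => (Fs q - Fk q) * (-2 * vk q - uk q ^ 2) * β q
        + (Fk q - Fs q) * (-2 * vs q - us q ^ 2) * β q) (paramMeasure d) := J1.add J2
    rw [← integral_add I3 I4, ← integral_add J1 J2, ← integral_add J4 J3, ← integral_const_mul]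
    refine integral_congr_ae (ae_of_all _ fun q => ?_)
    simp only; ring
  rw [key, E1, E2']
  ring


/-! ### Derivatives of the logarithm of `f ⊗ f` -/

/-- The score `∇ log f`. -/
def score {d : ℕ} (f : Vel d → ℝ) : Vel d → Vel d := gradient fun v => Real.log (f v)

/-- `f` is positive with algebraic decay, and `log f` has bounded first and second derivatives. -/
structure IsTame {d : ℕ} (m : ℕ) (C L : ℝ) (f : Vel d → ℝ) : Prop extends HasDecay m C f where
  pos : ∀ v, 0 < f v
  bound_score : ∀ v, ‖score f v‖ ≤ L
  bound_hess_log : ∀ v, ‖fderiv ℝ (score f) v‖ ≤ L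

/-- `f ⊗ f` at the pair with centre of mass `c` and half relative velocity `y`. -/
def tensorSq {d : ℕ} (f : Vel d → ℝ) (c y : Vel d) : ℝ := f (c + y) * f (c - y)

/-- The derivative of `log (f ⊗ f)` when `c` moves with velocity `e` and `y` with velocity `ξ`. -/
def logDeriv₁ {d : ℕ} (f : Vel d → ℝ) (c y e ξ : Vel d) : ℝ :=
  inner ℝ (score f (c + y)) (e + ξ) + inner ℝ (score f (c - y)) (e - ξ)

/-- The second derivative of `log (f ⊗ f)` when `c` moves with constant velocity `e` and `y` with
velocity `ξ` and acceleration `η`. -/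
def logDeriv₂ {d : ℕ} (f : Vel d → ℝ) (c y e ξ η : Vel d) : ℝ :=
  inner ℝ (fderiv ℝ (score f) (c + y) (e + ξ)) (e + ξ)
    + inner ℝ (fderiv ℝ (score f) (c - y) (e - ξ)) (e - ξ)
    + inner ℝ (score f (c + y) - score f (c - y)) η

section Tame

variable {d m : ℕ} {C L : ℝ} {f : Vel d → ℝ}

lemma IsTame.smooth_log (hf : IsTame m C L f) : ContDiff ℝ ∞ fun v => Real.log (f v) :=
  hf.smooth.log fun v => (hf.pos v).ne'

lemma IsTame.contDiff_score (hf : IsTame m C L f) : ContDiff ℝ ∞ (score f) :=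
  contDiff_gradient hf.smooth_log

lemma IsTame.continuous_fderiv_score (hf : IsTame m C L f) :
    Continuous (fderiv ℝ (score f)) :=
  hf.contDiff_score.continuous_fderiv (by simp)

lemma IsTame.nonneg_L (hf : IsTame m C L f) : 0 ≤ L := (norm_nonneg _).trans (hf.bound_score 0)

lemma IsTame.gradient_eq (hf : IsTame m C L f) (v : Vel d) : gradient f v = f v • score f v := by
  have h1 := (hf.smooth.differentiable (by simp) v).hasGradientAt.hasFDerivAt
  have h2 := h1.log (hf.pos v).ne'
  have h3 : score f v = (f v)⁻¹ • gradient f v := by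
    refine HasGradientAt.gradient ?_
    rw [hasGradientAt_iff_hasFDerivAt, map_smul]
    exact h2
  rw [h3, smul_smul, mul_inv_cancel₀ (hf.pos v).ne', one_smul]

lemma IsTame.tensorSq_pos (hf : IsTame m C L f) (c y : Vel d) : 0 < tensorSq f c y :=
  mul_pos (hf.pos _) (hf.pos _)

lemma IsTame.lipschitz_score (hf : IsTame m C L f) (v w : Vel d) :
    ‖score f v - score f w‖ ≤ L * ‖v - w‖ :=
  convex_univ.norm_image_sub_le_of_norm_fderiv_le
    (fun x _ => hf.contDiff_score.differentiable (by simp) x) (fun x _ => hf.bound_hess_log x)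
    (mem_univ w) (mem_univ v)

lemma IsTame.hasDerivAt_tensorSq (hf : IsTame m C L f) {c y : ℝ → Vel d} {e ξ : Vel d} {s : ℝ}
    (hc : HasDerivAt c e s) (hy : HasDerivAt y ξ s) :
    HasDerivAt (fun s => tensorSq f (c s) (y s))
      (tensorSq f (c s) (y s) * logDeriv₁ f (c s) (y s) e ξ) s := by
  have h := (hasDerivAt_comp_curve hf.smooth (hc.add hy)).mul
    (hasDerivAt_comp_curve hf.smooth (hc.sub hy))
  refine h.congr_deriv ?_
  simp only [Pi.add_apply, Pi.sub_apply, hf.gradient_eq, inner_smul_left, tensorSq, logDeriv₁,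
    conj_trivial]
  ring

lemma IsTame.hasDerivAt_logDeriv₁ (hf : IsTame m C L f) {c y ξ : ℝ → Vel d} {e η : Vel d} {s : ℝ}
    (hc : HasDerivAt c e s) (hy : HasDerivAt y (ξ s) s) (hξ : HasDerivAt ξ η s) :
    HasDerivAt (fun s => logDeriv₁ f (c s) (y s) e (ξ s))
      (logDeriv₂ f (c s) (y s) e (ξ s) η) s := by
  have h := ((hasDerivAt_gradient_comp_curve hf.smooth_log (hc.add hy)).inner ℝ
    (hξ.const_add e)).add ((hasDerivAt_gradient_comp_curve hf.smooth_log (hc.sub hy)).inner ℝ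
    (hξ.const_sub e))
  refine h.congr_deriv ?_
  simp only [logDeriv₂, score, inner_sub_left, inner_neg_right, Pi.add_apply, Pi.sub_apply]
  ring

lemma abs_tensorSq_le (hf : HasDecay m C f) (r : ℝ) (c : Vel d) {k : Vel d} (hk : ‖k‖ = 1) :
    |tensorSq f c ((r / 2) • k)| ≤ 2 ^ m * C ^ 2 * pairDecay m r c := by
  have hC : 0 ≤ C := nonneg_of_mul_nonneg_left ((abs_nonneg _).trans (hf.bound 0)) (decay_pos m 0)
  calc _ ≤ (C * decay m (c + (r / 2) • k)) * (C * decay m (c - (r / 2) • k)) :=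
        abs_mul_le_mul (hf.bound _) (hf.bound _)
    _ = C ^ 2 * (decay m (c + (r / 2) • k) * decay m (c - (r / 2) • k)) := by ring
    _ ≤ C ^ 2 * (2 ^ m * pairDecay m r c) :=
        mul_le_mul_of_nonneg_left (decay_mul_decay_le m r c hk) (by positivity)
    _ = _ := by ring

lemma IsTame.abs_logDeriv₁_le (hf : IsTame m C L f) (c y e ξ : Vel d) :
    |logDeriv₁ f c y e ξ| ≤ 2 * L * (‖e‖ + ‖ξ‖) := by
  have hL := hf.nonneg_L
  have h1 := (abs_real_inner_le_norm (score f (c + y)) (e + ξ)).trans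
    (mul_le_mul (hf.bound_score _) (norm_add_le e ξ) (norm_nonneg _) hL)
  have h2 := (abs_real_inner_le_norm (score f (c - y)) (e - ξ)).trans
    (mul_le_mul (hf.bound_score _) (norm_sub_le e ξ) (norm_nonneg _) hL)
  refine (abs_add_le _ _).trans ?_
  linarith

lemma IsTame.abs_logDeriv₂_le (hf : IsTame m C L f) (c y e ξ η : Vel d) :
    |logDeriv₂ f c y e ξ η| ≤ 2 * L * ((‖e‖ + ‖ξ‖) ^ 2 + ‖η‖) := by
  have hL := hf.nonneg_L
  have key : ∀ v w : Vel d, ‖w‖ ≤ ‖e‖ + ‖ξ‖ →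
      |inner ℝ (fderiv ℝ (score f) v w) w| ≤ L * (‖e‖ + ‖ξ‖) ^ 2 := by
    intro v w hw
    calc _ ≤ ‖fderiv ℝ (score f) v w‖ * ‖w‖ := abs_real_inner_le_norm _ _
      _ ≤ (L * ‖w‖) * ‖w‖ := by
        gcongr
        exact (ContinuousLinearMap.le_opNorm _ _).trans (by gcongr; exact hf.bound_hess_log v)
      _ = L * ‖w‖ ^ 2 := by ring
      _ ≤ _ := by gcongr
  have h3 : |inner ℝ (score f (c + y) - score f (c - y)) η| ≤ 2 * L * ‖η‖ := by
    refine (abs_real_inner_le_norm _ _).trans ?_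
    gcongr
    refine (norm_sub_le _ _).trans ?_
    linarith [hf.bound_score (c + y), hf.bound_score (c - y)]
  refine (abs_add_three _ _ _).trans ?_
  linarith [key (c + y) (e + ξ) (norm_add_le _ _), key (c - y) (e - ξ) (norm_sub_le _ _)]

end Tame

/-! ### One-parameter families of symmetries -/

/-- A one-parameter family of symmetries of the collision parameters: translations of the centre of
mass with velocity `e`, and isometries `rot s` acting on `k` and `σ`, with generator `gen`. -/
structure SymmetryFlow (d : ℕ) where
  /-- The velocity of the translation of the centre of mass. -/
  e : Vel d
  /-- The generator of the isometries. -/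
  gen : Vel d →L[ℝ] Vel d
  /-- The isometries. -/
  rot : ℝ → (Vel d ≃ₗᵢ[ℝ] Vel d)
  /-- `rot` is the flow of the linear vector field `gen`. -/
  hasDerivAt_rot : ∀ x s, HasDerivAt (fun s => rot s x) (gen (rot s x)) s
  /-- The flow is jointly continuous. -/
  continuous_rot : Continuous fun p : ℝ × Vel d => rot p.1 p.2

namespace SymmetryFlow

variable {d m : ℕ} (X : SymmetryFlow d)

/-- The induced flow on the collision parameters. -/
def flow (s : ℝ) (q : Param d) : Param d :=
  (q.1, (q.2.1 + s • X.e, (sphMap (X.rot s) q.2.2.1, sphMap (X.rot s) q.2.2.2)))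

lemma measurable_flow : Measurable (Function.uncurry X.flow) := by
  have h := X.continuous_rot
  have h1 : Continuous fun p : ℝ × Sph d => sphMap (X.rot p.1) p.2 :=
    (h.comp (f := fun p : ℝ × Sph d => (p.1, (p.2 : Vel d))) (by fun_prop)).subtype_mk _
  have h2 : Continuous fun p : ℝ × Param d => sphMap (X.rot p.1) p.2.2.2.1 :=
    h1.comp (f := fun p : ℝ × Param d => (p.1, p.2.2.2.1)) (by fun_prop)
  have h3 : Continuous fun p : ℝ × Param d => sphMap (X.rot p.1) p.2.2.2.2 :=
    h1.comp (f := fun p : ℝ × Param d => (p.1, p.2.2.2.2)) (by fun_prop)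
  refine Continuous.measurable ?_
  unfold Function.uncurry flow
  fun_prop

lemma measurePreserving_flow (s : ℝ) :
    MeasurePreserving (X.flow s) (paramMeasure d) (paramMeasure d) :=
  measurePreserving_param_prod
    ((measurePreserving_sphMap (X.rot s)).prod (measurePreserving_sphMap (X.rot s)))
    (measurePreserving_add_right volume _)

/-- The first derivative of `log (f ⊗ f)` along the flow. -/
def first (f : Vel d → ℝ) (r : ℝ) (c k : Vel d) : ℝ :=
  logDeriv₁ f c ((r / 2) • k) X.e ((r / 2) • X.gen k)

/-- The second derivative of `log (f ⊗ f)` along the flow. -/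
def second (f : Vel d → ℝ) (r : ℝ) (c k : Vel d) : ℝ :=
  logDeriv₂ f c ((r / 2) • k) X.e ((r / 2) • X.gen k) ((r / 2) • X.gen (X.gen k))

variable {C L : ℝ} {f : Vel d → ℝ}

lemma continuous_first (hf : IsTame m C L f) :
    Continuous fun p : ℝ × (Vel d × Vel d) => X.first f p.1 p.2.1 p.2.2 := by
  have := hf.contDiff_score.continuous
  unfold first logDeriv₁
  fun_prop

lemma continuous_second (hf : IsTame m C L f) :
    Continuous fun p : ℝ × (Vel d × Vel d) => X.second f p.1 p.2.1 p.2.2 := by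
  have := hf.contDiff_score.continuous
  have := hf.continuous_fderiv_score
  unfold second logDeriv₂
  fun_prop

lemma abs_first_le (hf : IsTame m C L f) {R r : ℝ} (hr : 0 ≤ r) (hrR : r ≤ R) (c : Vel d)
    {k : Vel d} (hk : ‖k‖ = 1) : |X.first f r c k| ≤ 2 * L * (‖X.e‖ + R * ‖X.gen‖) := by
  have hL := hf.nonneg_L
  refine (hf.abs_logDeriv₁_le _ _ _ _).trans ?_
  have h1 : ‖X.gen k‖ ≤ ‖X.gen‖ := by simpa [hk] using X.gen.le_opNorm k
  have h2 : r / 2 ≤ R := by linarith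
  have h3 : 0 ≤ R := hr.trans hrR
  rw [norm_smul, Real.norm_of_nonneg (by positivity : 0 ≤ r / 2)]
  gcongr

lemma abs_second_le (hf : IsTame m C L f) {R r : ℝ} (hr : 0 ≤ r) (hrR : r ≤ R) (c : Vel d)
    {k : Vel d} (hk : ‖k‖ = 1) :
    |X.second f r c k| ≤ 2 * L * ((‖X.e‖ + R * ‖X.gen‖) ^ 2 + R * ‖X.gen‖ ^ 2) := by
  have hL := hf.nonneg_L
  refine (hf.abs_logDeriv₂_le _ _ _ _ _).trans ?_
  have h1 : ‖X.gen k‖ ≤ ‖X.gen‖ := by simpa [hk] using X.gen.le_opNorm k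
  rw [norm_smul, norm_smul, Real.norm_of_nonneg (by positivity : 0 ≤ r / 2)]
  have h2 : r / 2 ≤ R := by linarith
  have h3 : 0 ≤ R := hr.trans hrR
  have h4 : ‖X.gen (X.gen k)‖ ≤ ‖X.gen‖ ^ 2 := by
    refine (X.gen.le_opNorm _).trans ?_
    rw [sq]; gcongr
  gcongr

lemma hasDerivAt_smul_rot (r : ℝ) (k : Vel d) (s : ℝ) :
    HasDerivAt (fun s => (r / 2) • X.rot s k) ((r / 2) • X.gen (X.rot s k)) s :=
  (X.hasDerivAt_rot k s).const_smul (r / 2)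

lemma hasDerivAt_smul_gen (r : ℝ) (k : Vel d) (s : ℝ) :
    HasDerivAt (fun s => (r / 2) • X.gen (X.rot s k)) ((r / 2) • X.gen (X.gen (X.rot s k))) s :=
  (X.gen.hasFDerivAt.comp_hasDerivAt s (X.hasDerivAt_rot k s)).const_smul (r / 2)

lemma hasDerivAt_translate (c : Vel d) (s : ℝ) :
    HasDerivAt (fun s : ℝ => c + s • X.e) X.e s := by
  simpa using ((hasDerivAt_id s).smul_const X.e).const_add c

lemma hasDerivAt_pairProd (hf : IsTame m C L f) (r : ℝ) (c k : Vel d) (s : ℝ) :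
    HasDerivAt (fun s => pairProd f r (c + s • X.e) (X.rot s k))
      (pairProd f r (c + s • X.e) (X.rot s k) * X.first f r (c + s • X.e) (X.rot s k)) s :=
  hf.hasDerivAt_tensorSq (X.hasDerivAt_translate c s) (X.hasDerivAt_smul_rot r k s)

lemma hasDerivAt_first (hf : IsTame m C L f) (r : ℝ) (c k : Vel d) (s : ℝ) :
    HasDerivAt (fun s => X.first f r (c + s • X.e) (X.rot s k))
      (X.second f r (c + s • X.e) (X.rot s k)) s :=
  hf.hasDerivAt_logDeriv₁ (X.hasDerivAt_translate c s) (X.hasDerivAt_smul_rot r k s)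
    (X.hasDerivAt_smul_gen r k s)

end SymmetryFlow


namespace SymmetryFlow

variable {d m : ℕ} {C L R : ℝ} {f : Vel d → ℝ} {b : ℝ → ℝ → ℝ}

lemma _root_.BoltzmannFisher.continuous_pairProd (hf : Continuous f) :
    Continuous fun p : ℝ × (Vel d × Vel d) => pairProd f p.1 p.2.1 p.2.2 := by
  unfold pairProd; fun_prop

/-- For the derivation along a flow that preserves the measure and `k·σ`, the first variation of the
corresponding part of Fisher's information equals minus the integral of a square. -/
theorem dissipation (X : SymmetryFlow d) (hb : IsCutoffKernel d m R b) (hf : IsTame m C L f) :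
    ∫ q : Param d, ((pairProd f q.1 q.2.1 q.2.2.2 - pairProd f q.1 q.2.1 q.2.2.1)
        * (-2 * X.second f q.1 q.2.1 q.2.2.1 - X.first f q.1 q.2.1 q.2.2.1 ^ 2))
        * b q.1 (inner ℝ (q.2.2.1 : Vel d) (q.2.2.2 : Vel d)) ∂(paramMeasure d)
      = - ∫ q : Param d, (pairProd f q.1 q.2.1 q.2.2.1
          * (X.first f q.1 q.2.1 q.2.2.2 - X.first f q.1 q.2.1 q.2.2.1) ^ 2)
          * b q.1 (inner ℝ (q.2.2.1 : Vel d) (q.2.2.2 : Vel d)) ∂(paramMeasure d) := by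
  have hL := hf.nonneg_L
  have hR := hb.pos
  set A₁ : ℝ := 2 ^ m * C ^ 2
  set A₂ : ℝ := 2 * L * (‖X.e‖ + R * ‖X.gen‖)
  set A₃ : ℝ := 2 * L * ((‖X.e‖ + R * ‖X.gen‖) ^ 2 + R * ‖X.gen‖ ^ 2)
  have hA₁ : 0 ≤ A₁ := by positivity
  have hA₂ : 0 ≤ A₂ := by positivity
  have hA₃ : 0 ≤ A₃ := by positivity
  set A := A₁ + A₂ + A₃ with hA
  have mk (g : ℝ × (Vel d × Vel d) → ℝ) (hg : Continuous g) :
      Measurable fun p : ℝ × (Vel d × Sph d) => g (p.1, (p.2.1, (p.2.2 : Vel d))) :=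
    (hg.comp (by fun_prop)).measurable
  have mF := mk _ (continuous_pairProd hf.smooth.continuous)
  have mu := mk _ (X.continuous_first hf)
  have mv := mk _ (X.continuous_second hf)
  have bF : ∀ (r : ℝ) (c : Vel d) (k : Sph d),
      |pairProd f r c k| ≤ A * pairDecay m r c := fun r c k => by
    refine (abs_tensorSq_le hf.toHasDecay r c (norm_eq_of_mem_sphere k)).trans ?_
    have := pairDecay_pos m r c
    gcongr
    linarith
  have bu : ∀ (r : ℝ) (c : Vel d) (k : Sph d), r ∈ Icc R⁻¹ R → |X.first f r c k| ≤ A :=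
    fun r c k hr => (X.abs_first_le hf ((inv_pos.mpr hR).le.trans hr.1) hr.2 c
      (norm_eq_of_mem_sphere k)).trans (by linarith)
  have bv : ∀ (r : ℝ) (c : Vel d) (k : Sph d), r ∈ Icc R⁻¹ R → |X.second f r c k| ≤ A :=
    fun r c k hr => (X.abs_second_le hf ((inv_pos.mpr hR).le.trans hr.1) hr.2 c
      (norm_eq_of_mem_sphere k)).trans (by linarith)
  have h := dissipation_symmetrisation hb mF mu mv (A := A) (fun p _ => bF _ _ _)
    (fun p hp => bu _ _ _ hp) (fun p hp => bv _ _ _ hp)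
  rw [h]
  -- the remaining integrand is a derivative along the flow
  have hm2 (g : ℝ × (Vel d × Vel d) → ℝ) (hg : Continuous g) :
      Measurable (fun q : Param d => g (q.1, (q.2.1, (q.2.2.1 : Vel d)))) ∧
      Measurable (fun q : Param d => g (q.1, (q.2.1, (q.2.2.2 : Vel d)))) :=
    ⟨(hg.comp (by fun_prop)).measurable, (hg.comp (by fun_prop)).measurable⟩
  obtain ⟨mF1, mF2⟩ := hm2 _ (continuous_pairProd hf.smooth.continuous)
  obtain ⟨mu1, mu2⟩ := hm2 _ (X.continuous_first hf)
  obtain ⟨mv1, mv2⟩ := hm2 _ (X.continuous_second hf)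
  have mb := measurable_kernel (d := d) hb.measurable
  have hinv : ∀ (q : Param d) (s : ℝ), inner ℝ ((X.flow s q).2.2.1 : Vel d) ((X.flow s q).2.2.2 : Vel d)
      = inner ℝ (q.2.2.1 : Vel d) (q.2.2.2 : Vel d) := fun q s =>
    (X.rot s).inner_map_map _ _
  have hzero := integral_eq_zero_of_flow X.measurable_flow X.measurePreserving_flow
    (G := fun q : Param d => ((pairProd f q.1 q.2.1 q.2.2.2 - pairProd f q.1 q.2.1 q.2.2.1)
        * (X.first f q.1 q.2.1 q.2.2.2 - X.first f q.1 q.2.1 q.2.2.1))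
        * b q.1 (inner ℝ (q.2.2.1 : Vel d) (q.2.2.2 : Vel d)))
    (G' := fun q : Param d => ((pairProd f q.1 q.2.1 q.2.2.2 * X.first f q.1 q.2.1 q.2.2.2
          - pairProd f q.1 q.2.1 q.2.2.1 * X.first f q.1 q.2.1 q.2.2.1)
          * (X.first f q.1 q.2.1 q.2.2.2 - X.first f q.1 q.2.1 q.2.2.1)
          + (pairProd f q.1 q.2.1 q.2.2.2 - pairProd f q.1 q.2.1 q.2.2.1)
          * (X.second f q.1 q.2.1 q.2.2.2 - X.second f q.1 q.2.1 q.2.2.1))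
          * b q.1 (inner ℝ (q.2.2.1 : Vel d) (q.2.2.2 : Vel d))) ?_ ?_
    (Measurable.mul (by fun_prop) mb) ?_
  · rw [hzero, zero_sub]
  · refine hb.integrable_mul (A := (A + A) * (A + A)) (by fun_prop) fun q hq => ?_
    have h1 := (abs_sub (pairProd f q.1 q.2.1 q.2.2.2) (pairProd f q.1 q.2.1 q.2.2.1)).trans
      (add_le_add (bF _ _ _) (bF _ _ _))
    have h2 := (abs_sub (X.first f q.1 q.2.1 q.2.2.2) (X.first f q.1 q.2.1 q.2.2.1)).trans
      (add_le_add (bu _ _ _ hq) (bu _ _ _ hq))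
    exact (abs_mul_le_mul h1 h2).trans (le_of_eq (by ring))
  · refine hb.integrable_mul (A := 2 * A * A * (A + A) + (A + A) * (A + A)) (by fun_prop)
      fun q hq => ?_
    have h1 := (abs_sub (pairProd f q.1 q.2.1 q.2.2.2) (pairProd f q.1 q.2.1 q.2.2.1)).trans
      (add_le_add (bF _ _ _) (bF _ _ _))
    have h2 := (abs_sub (X.first f q.1 q.2.1 q.2.2.2) (X.first f q.1 q.2.1 q.2.2.1)).trans
      (add_le_add (bu _ _ _ hq) (bu _ _ _ hq))
    have h3 := (abs_sub (X.second f q.1 q.2.1 q.2.2.2) (X.second f q.1 q.2.1 q.2.2.1)).trans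
      (add_le_add (bv _ _ _ hq) (bv _ _ _ hq))
    have h4 := (abs_sub (pairProd f q.1 q.2.1 q.2.2.2 * X.first f q.1 q.2.1 q.2.2.2)
      (pairProd f q.1 q.2.1 q.2.2.1 * X.first f q.1 q.2.1 q.2.2.1)).trans
      (add_le_add (abs_mul_le_mul (bF q.1 q.2.1 q.2.2.2) (bu _ _ _ hq))
        (abs_mul_le_mul (bF q.1 q.2.1 q.2.2.1) (bu _ _ _ hq)))
    exact (abs_add_le _ _).trans ((add_le_add (abs_mul_le_mul h4 h2) (abs_mul_le_mul h1 h3)).trans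
      (le_of_eq (by ring)))
  · intro q s
    have dF := fun k : Sph d => X.hasDerivAt_pairProd hf q.1 q.2.1 k s
    have du := fun k : Sph d => X.hasDerivAt_first hf q.1 q.2.1 k s
    have := (((dF q.2.2.2).sub (dF q.2.2.1)).mul ((du q.2.2.2).sub (du q.2.2.1))).mul_const
      (b q.1 (inner ℝ (q.2.2.1 : Vel d) (q.2.2.2 : Vel d)))
    simp only [hinv]
    exact this

/-- The translations of the centre of mass in the direction `e`. -/
def translation (e : Vel d) : SymmetryFlow d where
  e := e
  gen := 0
  rot _ := LinearIsometryEquiv.refl ℝ (Vel d)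
  hasDerivAt_rot x s := by simpa using hasDerivAt_const s x
  continuous_rot := by simpa using continuous_snd

lemma hasDerivAt_exp_apply (A : Vel d →L[ℝ] Vel d) (x : Vel d) (s : ℝ) :
    HasDerivAt (fun s : ℝ => NormedSpace.exp (s • A) x) (A (NormedSpace.exp (s • A) x)) s := by
  have h := hasDerivAt_exp_smul_const' A s
  have h2 := ((ContinuousLinearMap.apply ℝ (Vel d) x).hasFDerivAt).comp_hasDerivAt s h
  exact h2

lemma norm_exp_apply {A : Vel d →L[ℝ] Vel d} (hA : ∀ x, inner ℝ (A x) x = 0) (s : ℝ) (x : Vel d) :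
    ‖NormedSpace.exp (s • A) x‖ = ‖x‖ := by
  have hd : ∀ s, HasDerivAt (fun s : ℝ => ‖NormedSpace.exp (s • A) x‖ ^ 2) 0 s := by
    intro s
    have := (hasDerivAt_exp_apply A x s).norm_sq
    rwa [real_inner_comm, hA, mul_zero] at this
  have hc : ‖NormedSpace.exp (s • A) x‖ ^ 2 = ‖NormedSpace.exp ((0 : ℝ) • A) x‖ ^ 2 :=
    is_const_of_deriv_eq_zero (fun s => (hd s).differentiableAt) (fun s => (hd s).deriv) s 0
  have h0 : (0 : ℝ) • A = 0 := by ext; simp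
  rw [h0, NormedSpace.exp_zero] at hc
  exact (sq_eq_sq₀ (norm_nonneg _) (norm_nonneg _)).mp hc

/-- The one-parameter group of rotations generated by a skew-symmetric map. -/
def rotation (A : Vel d →L[ℝ] Vel d) (hA : ∀ x, inner ℝ (A x) x = 0) : SymmetryFlow d where
  e := 0
  gen := A
  rot s := LinearIsometry.toLinearIsometryEquiv
    ⟨(NormedSpace.exp (s • A) : Vel d →L[ℝ] Vel d).toLinearMap, norm_exp_apply hA s⟩ rfl
  hasDerivAt_rot x s := hasDerivAt_exp_apply A x s
  continuous_rot := by
    have h1 : Continuous fun s : ℝ => (NormedSpace.exp (s • A) : Vel d →L[ℝ] Vel d) :=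
      continuous_iff_continuousAt.mpr fun s => (hasDerivAt_exp_smul_const A s).continuousAt
    exact (h1.comp continuous_fst).clm_apply continuous_snd

end SymmetryFlow

/-! ### Rotations in the coordinate planes -/

/-- The generator `x ↦ xᵢ eⱼ - xⱼ eᵢ` of the rotations in a coordinate plane. -/
def planeGen {d : ℕ} (i j : Fin d) : Vel d →L[ℝ] Vel d :=
  (EuclideanSpace.proj i : Vel d →L[ℝ] ℝ).smulRight (EuclideanSpace.single j (1 : ℝ))
    - (EuclideanSpace.proj j : Vel d →L[ℝ] ℝ).smulRight (EuclideanSpace.single i (1 : ℝ))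

section PlaneGen

variable {d : ℕ}

lemma planeGen_apply (i j : Fin d) (x : Vel d) :
    planeGen i j x = x i • EuclideanSpace.single j (1 : ℝ) - x j • EuclideanSpace.single i (1 : ℝ) :=
  rfl

lemma inner_planeGen (q x : Vel d) (i j : Fin d) :
    inner ℝ q (planeGen i j x) = x i * q j - x j * q i := by
  simp [planeGen_apply, inner_sub_right, inner_smul_right, EuclideanSpace.inner_single_right]

lemma inner_planeGen_self (i j : Fin d) (x : Vel d) : inner ℝ (planeGen i j x) x = 0 := by
  rw [real_inner_comm, inner_planeGen]; ring

lemma sum_single (x : Vel d) : ∑ i, x i • EuclideanSpace.single i (1 : ℝ) = x := by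
  have := (EuclideanSpace.basisFun (Fin d) ℝ).sum_repr x
  simpa using this

/-- The sum of a bilinear form over the generators of the rotation group. -/
lemma sum_bilin_planeGen (β : Vel d →ₗ[ℝ] Vel d →ₗ[ℝ] ℝ) (k k' : Vel d) :
    ∑ i, ∑ j, β (planeGen i j k) (planeGen i j k')
      = 2 * (inner ℝ k k' * ∑ i, β (EuclideanSpace.single i 1) (EuclideanSpace.single i 1)
        - β k' k) := by
  set E : Fin d → Vel d := fun i => EuclideanSpace.single i (1 : ℝ) with hE
  have hin : inner ℝ k k' = ∑ i, k i * k' i := by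
    simp [PiLp.inner_apply, mul_comm]
  have hβ : β k' k = ∑ i, ∑ j, k' i * (k j * β (E i) (E j)) := by
    conv_lhs => rw [← sum_single k', ← sum_single k]
    simp only [map_sum, map_smul, LinearMap.sum_apply, LinearMap.smul_apply, smul_eq_mul,
      Finset.mul_sum, hE]
    rw [Finset.sum_comm]
    refine Finset.sum_congr rfl fun i _ => Finset.sum_congr rfl fun j _ => ?_
    ring
  have hβ' : β k' k = ∑ i, ∑ j, k' j * (k i * β (E j) (E i)) := by
    rw [hβ, Finset.sum_comm]
  have h1 : ∀ i j, β (planeGen i j k) (planeGen i j k')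
      = k i * k' i * β (E j) (E j) + k j * k' j * β (E i) (E i)
        - k' j * (k i * β (E j) (E i)) - k' i * (k j * β (E i) (E j)) := by
    intro i j
    simp only [planeGen_apply, map_sub, map_smul, LinearMap.sub_apply, LinearMap.smul_apply,
      smul_eq_mul]
    ring
  simp only [h1, Finset.sum_sub_distrib, Finset.sum_add_distrib]
  rw [← hβ, ← hβ', hin]
  have h2 : ∑ i, ∑ j, k i * k' i * β (E j) (E j)
      = (∑ i, k i * k' i) * ∑ i, β (E i) (E i) := by rw [Finset.sum_mul_sum]
  have h3 : ∑ i, ∑ j, k j * k' j * β (E i) (E i)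
      = (∑ i, k i * k' i) * ∑ i, β (E i) (E i) := by rw [Finset.sum_comm, h2]
  rw [h2, h3]
  ring

lemma sum_inner_planeGen (q q' k k' : Vel d) :
    ∑ i, ∑ j, inner ℝ q (planeGen i j k) * inner ℝ q' (planeGen i j k')
      = 2 * (inner ℝ k k' * inner ℝ q q' - inner ℝ q k' * inner ℝ q' k) := by
  have h := sum_bilin_planeGen ((LinearMap.mul ℝ ℝ).compl₁₂ (innerₛₗ ℝ q) (innerₛₗ ℝ q')) k k'
  simp only [LinearMap.compl₁₂_apply, innerₛₗ_apply_apply, LinearMap.mul_apply'] at h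
  rw [h]
  congr 3
  simp [PiLp.inner_apply, mul_comm]

lemma sum_hess_planeGen (P : Vel d →L[ℝ] Vel d) (k : Vel d) :
    ∑ i, ∑ j, inner ℝ (P (planeGen i j k)) (planeGen i j k)
      = 2 * (‖k‖ ^ 2 * ∑ i, P (EuclideanSpace.single i 1) i - inner ℝ (P k) k) := by
  have h := sum_bilin_planeGen ((innerₛₗ ℝ).comp P.toLinearMap) k k
  simp only [LinearMap.comp_apply, innerₛₗ_apply_apply, ContinuousLinearMap.coe_coe] at h
  rw [h, real_inner_self_eq_norm_sq]
  simp [EuclideanSpace.inner_single_right]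

lemma sum_planeGen_planeGen (q k : Vel d) :
    ∑ i, ∑ j, inner ℝ q (planeGen i j (planeGen i j k)) = -2 * (d - 1) * inner ℝ q k := by
  have h1 : ∀ i j, inner ℝ q (planeGen i j (planeGen i j k))
      = -inner ℝ (planeGen i j q) (planeGen i j k) := by
    intro i j
    rw [inner_planeGen, inner_planeGen, planeGen_apply, planeGen_apply]
    have hs : EuclideanSpace.single i (1 : ℝ) j = EuclideanSpace.single j (1 : ℝ) i := by
      simp [eq_comm]
    simp only [PiLp.sub_apply, PiLp.smul_apply, smul_eq_mul, hs]
    ring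
  have h : ∑ i, ∑ j, inner ℝ (planeGen i j q) (planeGen i j k)
      = 2 * (inner ℝ q k * ∑ i : Fin d, inner ℝ (EuclideanSpace.single i (1 : ℝ))
        (EuclideanSpace.single i (1 : ℝ)) - inner ℝ k q) :=
    sum_bilin_planeGen (innerₛₗ ℝ) q k
  simp only [h1, Finset.sum_neg_distrib, h]
  simp [real_inner_comm]
  ring

end PlaneGen


/-! ### The first variation of Fisher's information -/

/-- The first variation of Fisher's information at `f`, `-(2 Δ log f + |∇ log f|²)`. -/
def fisherVariation {d : ℕ} (f : Vel d → ℝ) (v : Vel d) : ℝ :=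
  -(2 * ∑ i, fderiv ℝ (score f) v (EuclideanSpace.single i 1) i + ‖score f v‖ ^ 2)

/-- The symmetry flow of the rotations in a coordinate plane. -/
def planeRotation {d : ℕ} (i j : Fin d) : SymmetryFlow d :=
  SymmetryFlow.rotation (planeGen i j) (inner_planeGen_self i j)

/-- The symmetry flow of the translations along a coordinate axis. -/
def axisTranslation {d : ℕ} (i : Fin d) : SymmetryFlow d :=
  SymmetryFlow.translation (EuclideanSpace.single i 1)

/-- The radial derivative of `log (f ⊗ f)`. -/
def radialFirst {d : ℕ} (f : Vel d → ℝ) (r : ℝ) (c k : Vel d) : ℝ :=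
  logDeriv₁ f c ((r / 2) • k) 0 ((1 / 2 : ℝ) • k)

/-- The second radial derivative of `log (f ⊗ f)`. -/
def radialSecond {d : ℕ} (f : Vel d → ℝ) (r : ℝ) (c k : Vel d) : ℝ :=
  logDeriv₂ f c ((r / 2) • k) 0 ((1 / 2 : ℝ) • k) 0

/-- The radial part of the Laplacian of `log (f ⊗ f)`. -/
def radialLaplacian {d : ℕ} (f : Vel d → ℝ) (r : ℝ) (c k : Vel d) : ℝ :=
  radialSecond f r c k + (d - 1) / r * radialFirst f r c k

section Decomposition

variable {d : ℕ} (f : Vel d → ℝ) (r : ℝ) (c k : Vel d)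

lemma planeRotation_first (i j : Fin d) : (planeRotation i j).first f r c k
    = (r / 2) * inner ℝ (score f (c + (r / 2) • k) - score f (c - (r / 2) • k))
      (planeGen i j k) := by
  simp only [SymmetryFlow.first, planeRotation, SymmetryFlow.rotation, logDeriv₁, zero_add,
    zero_sub, inner_neg_right, inner_smul_right, inner_sub_left]
  ring

lemma planeRotation_second (i j : Fin d) : (planeRotation i j).second f r c k
    = r ^ 2 / 4 * (inner ℝ (fderiv ℝ (score f) (c + (r / 2) • k) (planeGen i j k)) (planeGen i j k)
      + inner ℝ (fderiv ℝ (score f) (c - (r / 2) • k) (planeGen i j k)) (planeGen i j k))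
      + (r / 2) * inner ℝ (score f (c + (r / 2) • k) - score f (c - (r / 2) • k))
      (planeGen i j (planeGen i j k)) := by
  simp only [SymmetryFlow.second, planeRotation, SymmetryFlow.rotation, logDeriv₂, zero_add,
    zero_sub, inner_neg_right, inner_smul_right, map_neg, map_smul, inner_neg_left,
    inner_smul_left, conj_trivial]
  ring

lemma sum_axisTranslation :
    ∑ i, (-2 * (axisTranslation i).second f r c k - (axisTranslation i).first f r c k ^ 2)
    = -2 * (∑ i, fderiv ℝ (score f) (c + (r / 2) • k) (EuclideanSpace.single i 1) i
        + ∑ i, fderiv ℝ (score f) (c - (r / 2) • k) (EuclideanSpace.single i 1) i)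
      - ‖score f (c + (r / 2) • k) + score f (c - (r / 2) • k)‖ ^ 2 := by
  rw [EuclideanSpace.norm_sq_eq, ← Finset.sum_add_distrib, Finset.mul_sum,
    ← Finset.sum_sub_distrib]
  refine Finset.sum_congr rfl fun i _ => ?_
  simp [SymmetryFlow.second, SymmetryFlow.first, axisTranslation, SymmetryFlow.translation,
    logDeriv₁, logDeriv₂, EuclideanSpace.inner_single_right]

lemma sum_planeRotation (hk : ‖k‖ = 1) :
    ∑ i, ∑ j, (-2 * (planeRotation i j).second f r c k - (planeRotation i j).first f r c k ^ 2)
    = -r ^ 2 * (∑ i, fderiv ℝ (score f) (c + (r / 2) • k) (EuclideanSpace.single i 1) i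
        - inner ℝ (fderiv ℝ (score f) (c + (r / 2) • k) k) k
        + (∑ i, fderiv ℝ (score f) (c - (r / 2) • k) (EuclideanSpace.single i 1) i
        - inner ℝ (fderiv ℝ (score f) (c - (r / 2) • k) k) k))
      + 2 * r * (d - 1) * inner ℝ (score f (c + (r / 2) • k) - score f (c - (r / 2) • k)) k
      - r ^ 2 / 2 * (‖score f (c + (r / 2) • k) - score f (c - (r / 2) • k)‖ ^ 2
        - inner ℝ (score f (c + (r / 2) • k) - score f (c - (r / 2) • k)) k ^ 2) := by
  set P := fderiv ℝ (score f) (c + (r / 2) • k)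
  set P' := fderiv ℝ (score f) (c - (r / 2) • k)
  set q := score f (c + (r / 2) • k) - score f (c - (r / 2) • k) with hq
  have h1 := sum_hess_planeGen P k
  have h2 := sum_hess_planeGen P' k
  have h3 := sum_planeGen_planeGen q k
  have h4 := sum_inner_planeGen q q k k
  rw [hk] at h1 h2
  rw [real_inner_self_eq_norm_sq, real_inner_self_eq_norm_sq, hk] at h4
  have h5 : ∀ i j, -2 * (planeRotation i j).second f r c k - (planeRotation i j).first f r c k ^ 2
      = -(r ^ 2 / 2) * inner ℝ (P (planeGen i j k)) (planeGen i j k)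
        + -(r ^ 2 / 2) * inner ℝ (P' (planeGen i j k)) (planeGen i j k)
        + -r * inner ℝ q (planeGen i j (planeGen i j k))
        + -(r ^ 2 / 4) * (inner ℝ q (planeGen i j k) * inner ℝ q (planeGen i j k)) := by
    intro i j
    rw [planeRotation_first, planeRotation_second]
    ring
  simp only [h5, Finset.sum_add_distrib, ← Finset.mul_sum, h1, h2, h3, h4]
  ring

/-- The first variation of Fisher's information of `f ⊗ f`, decomposed into the contributions of the
centre of mass, of the relative speed, and of the direction of the relative velocity. -/
theorem fisherVariation_add (hr : r ≠ 0) (hk : ‖k‖ = 1) :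
    fisherVariation f (c + (r / 2) • k) + fisherVariation f (c - (r / 2) • k)
    = (1 / 2) * ∑ i, (-2 * (axisTranslation i).second f r c k
        - (axisTranslation i).first f r c k ^ 2)
      + 2 * (-2 * radialLaplacian f r c k - radialFirst f r c k ^ 2)
      + ∑ i, ∑ j, (-2 * (planeRotation i j).second f r c k
        - (planeRotation i j).first f r c k ^ 2) * (r ^ 2)⁻¹ := by
  simp only [← Finset.sum_mul]
  rw [sum_axisTranslation, sum_planeRotation f r c k hk]
  have e1 : radialFirst f r c k
      = (1 / 2) * inner ℝ (score f (c + (r / 2) • k) - score f (c - (r / 2) • k)) k := by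
    simp only [radialFirst, logDeriv₁, zero_add, zero_sub, inner_neg_right, inner_smul_right,
      inner_sub_left]
    ring
  have e2 : radialSecond f r c k
      = (1 / 4) * (inner ℝ (fderiv ℝ (score f) (c + (r / 2) • k) k) k
        + inner ℝ (fderiv ℝ (score f) (c - (r / 2) • k) k) k) := by
    simp only [radialSecond, logDeriv₂, zero_add, zero_sub, inner_neg_right, inner_smul_right,
      map_neg, map_smul, inner_neg_left, inner_smul_left, conj_trivial, inner_zero_right]
    ring
  have hpar := parallelogram_law_with_norm ℝ (score f (c + (r / 2) • k))
    (score f (c - (r / 2) • k))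
  rw [radialLaplacian, e1, e2, fisherVariation, fisherVariation]
  have hp : ‖score f (c + (r / 2) • k)‖ ^ 2 + ‖score f (c - (r / 2) • k)‖ ^ 2
      = (1 / 2) * (‖score f (c + (r / 2) • k) + score f (c - (r / 2) • k)‖ ^ 2
        + ‖score f (c + (r / 2) • k) - score f (c - (r / 2) • k)‖ ^ 2) := by linarith
  field_simp
  linear_combination (-8 * r) * hp

end Decomposition

/-! ### The sections of `f ⊗ f` on the sphere -/

lemma hasFDerivAt_dir {d : ℕ} {k : Vel d} (hk : ‖k‖ = 1) :
    HasFDerivAt (dir : Vel d → Vel d)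
      (ContinuousLinearMap.id ℝ (Vel d) - (innerSL ℝ k).smulRight k) k := by
  have hk2 : ‖k‖ ^ 2 ≠ 0 := by rw [hk]; norm_num
  have h1 : HasFDerivAt (fun x : Vel d => ‖x‖ ^ 2) (2 • innerSL ℝ k) k :=
    (hasStrictFDerivAt_norm_sq k).hasFDerivAt
  have h2 := h1.sqrt hk2
  have h3 : HasFDerivAt (fun x : Vel d => ‖x‖) (innerSL ℝ k) k := by
    have : (fun x : Vel d => √(‖x‖ ^ 2)) = fun x => ‖x‖ := by
      funext x; exact Real.sqrt_sq (norm_nonneg x)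
    rw [this] at h2
    refine h2.congr_fderiv ?_
    ext x
    simp [hk]
  have h4 := (hasDerivAt_inv (norm_ne_zero_iff.mpr (by rintro rfl; simp at hk) : ‖k‖ ≠ 0)).comp_hasFDerivAt
    k h3
  have h5 := h4.smul (hasFDerivAt_id k)
  refine h5.congr_fderiv ?_
  ext1 x
  simp [hk, sub_eq_add_neg]

lemma contDiffAt_dir {d : ℕ} {x : Vel d} (hx : x ≠ 0) : ContDiffAt ℝ ∞ (dir : Vel d → Vel d) x :=
  ((contDiffAt_norm ℝ hx).inv (norm_ne_zero_iff.mpr hx)).smul contDiffAt_id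

section Sphere

variable {d m : ℕ} {C L : ℝ} {f : Vel d → ℝ}

lemma homExt_of_ne {F : Vel d → ℝ} {x : Vel d} (hx : x ≠ 0) :
    homExt (fun τ : Sph d => F τ) x = F (dir x) := by
  simp [homExt, hx]

lemma IsTame.isAdmissible_pairProd (hf : IsTame m C L f) (r : ℝ) (c : Vel d) :
    IsAdmissible fun τ : Sph d => pairProd f r c τ where
  pos σ := hf.tensorSq_pos c _
  even σ := pairProd_neg f r c σ
  smooth := by
    have h : ContDiffOn ℝ ∞ (fun x => pairProd f r c (dir x)) ({0}ᶜ : Set (Vel d)) := by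
      intro x hx
      have h1 := contDiffAt_dir (d := d) hx
      have h2 := hf.smooth
      have h3 := (h2.contDiffAt (x := c + (r / 2) • dir x)).comp x
        (contDiffAt_const.add (h1.const_smul (r / 2)))
      have h4 := (h2.contDiffAt (x := c - (r / 2) • dir x)).comp x
        (contDiffAt_const.sub (h1.const_smul (r / 2)))
      exact (h3.mul h4).contDiffWithinAt
    exact h.congr fun x hx => homExt_of_ne (F := pairProd f r c) hx

lemma IsTame.sphGrad_log_pairProd (hf : IsTame m C L f) (r : ℝ) (c : Vel d) (k : Sph d) :
    sphGrad (fun τ : Sph d => Real.log (pairProd f r c τ)) k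
      = (r / 2) • (score f (c + (r / 2) • (k : Vel d)) - score f (c - (r / 2) • (k : Vel d))
        - inner ℝ (score f (c + (r / 2) • (k : Vel d)) - score f (c - (r / 2) • (k : Vel d)))
          (k : Vel d) • (k : Vel d)) := by
  have hk : ‖(k : Vel d)‖ = 1 := norm_eq_of_mem_sphere k
  have hk0 : (k : Vel d) ≠ 0 := by intro h; rw [h] at hk; simp at hk
  have hdk : dir (k : Vel d) = k := by rw [dir, hk]; simp
  have h1 := hasFDerivAt_dir hk
  have hl := fun v => (hf.smooth_log.differentiable (by simp) v).hasGradientAt.hasFDerivAt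
  have hp : HasFDerivAt (fun x => c + (r / 2) • dir x) _ (k : Vel d) :=
    (h1.const_smul (r / 2)).const_add c
  have hm : HasFDerivAt (fun x => c - (r / 2) • dir x) _ (k : Vel d) :=
    (h1.const_smul (r / 2)).const_sub c
  have h2 := ((hl (c + (r / 2) • dir (k : Vel d))).comp (k : Vel d) hp).add
    ((hl (c - (r / 2) • dir (k : Vel d))).comp (k : Vel d) hm)
  have h3 : homExt (fun τ : Sph d => Real.log (pairProd f r c τ)) =ᶠ[nhds (k : Vel d)]
      fun x => Real.log (f (c + (r / 2) • dir x)) + Real.log (f (c - (r / 2) • dir x)) := by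
    filter_upwards [isOpen_ne.mem_nhds hk0] with x hx
    rw [homExt_of_ne (F := fun τ => Real.log (pairProd f r c τ)) hx, pairProd,
      Real.log_mul (hf.pos _).ne' (hf.pos _).ne']
  refine HasGradientAt.gradient ?_
  rw [hasGradientAt_iff_hasFDerivAt]
  refine (HasFDerivAt.congr_of_eventuallyEq h2 h3).congr_fderiv ?_
  ext1 x
  change inner ℝ (score f (c + (r / 2) • dir (k : Vel d)))
      ((r / 2) • (x - inner ℝ (k : Vel d) x • (k : Vel d)))
    + inner ℝ (score f (c - (r / 2) • dir (k : Vel d)))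
      (-((r / 2) • (x - inner ℝ (k : Vel d) x • (k : Vel d)))) = inner ℝ _ x
  rw [hdk]
  simp only [inner_smul_right, inner_sub_right, inner_neg_right, inner_smul_left, inner_sub_left,
    conj_trivial]
  ring

/-- The twisted difference of the spherical gradients is the sum over all infinitesimal rotations of
the squared differences of the corresponding derivatives. -/
lemma IsTame.twistedSq_eq (hf : IsTame m C L f) (r : ℝ) (c : Vel d) (k σ : Sph d) :
    twistedSq (k : Vel d) (σ : Vel d) (sphGrad (fun τ : Sph d => Real.log (pairProd f r c τ)) k)
      (sphGrad (fun τ : Sph d => Real.log (pairProd f r c τ)) σ)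
    = (1 / 2) * ∑ i, ∑ j, ((planeRotation i j).first f r c σ
        - (planeRotation i j).first f r c k) ^ 2 := by
  rw [hf.sphGrad_log_pairProd, hf.sphGrad_log_pairProd]
  have hk : inner ℝ (k : Vel d) (k : Vel d) = 1 := by
    rw [real_inner_self_eq_norm_sq, norm_eq_of_mem_sphere k]; norm_num
  have hσ : inner ℝ (σ : Vel d) (σ : Vel d) = 1 := by
    rw [real_inner_self_eq_norm_sq, norm_eq_of_mem_sphere σ]; norm_num
  have hfirst : ∀ (i j : Fin d) (τ : Sph d), (planeRotation i j).first f r c τ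
      = inner ℝ ((r / 2) • (score f (c + (r / 2) • (τ : Vel d)) - score f (c - (r / 2) • (τ : Vel d))
        - inner ℝ (score f (c + (r / 2) • (τ : Vel d)) - score f (c - (r / 2) • (τ : Vel d)))
          (τ : Vel d) • (τ : Vel d))) (planeGen i j (τ : Vel d)) := by
    intro i j τ
    rw [planeRotation_first, inner_smul_left, inner_sub_left _ (inner ℝ _ _ • _), inner_smul_left,
      real_inner_comm _ (τ : Vel d), inner_planeGen_self]
    simp
  simp only [hfirst]
  have horth : ∀ (τ : Sph d) (q : Vel d), inner ℝ (τ : Vel d) (τ : Vel d) = 1 →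
      inner ℝ ((r / 2) • (q - inner ℝ q (τ : Vel d) • (τ : Vel d))) (τ : Vel d) = 0 := by
    intro τ q hτ
    simp [inner_smul_left, inner_sub_left]
  have hxk := horth k (score f (c + (r / 2) • (k : Vel d)) - score f (c - (r / 2) • (k : Vel d))) hk
  have hyσ := horth σ (score f (c + (r / 2) • (σ : Vel d)) - score f (c - (r / 2) • (σ : Vel d))) hσ
  generalize (r / 2) • (score f (c + (r / 2) • (k : Vel d)) - score f (c - (r / 2) • (k : Vel d))
        - inner ℝ (score f (c + (r / 2) • (k : Vel d)) - score f (c - (r / 2) • (k : Vel d)))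
          (k : Vel d) • (k : Vel d)) = x at hxk ⊢
  generalize (r / 2) • (score f (c + (r / 2) • (σ : Vel d)) - score f (c - (r / 2) • (σ : Vel d))
        - inner ℝ (score f (c + (r / 2) • (σ : Vel d)) - score f (c - (r / 2) • (σ : Vel d)))
          (σ : Vel d) • (σ : Vel d)) = y at hyσ ⊢
  have h1 := sum_inner_planeGen y y (σ : Vel d) (σ : Vel d)
  have h2 := sum_inner_planeGen x x (k : Vel d) (k : Vel d)
  have h3 := sum_inner_planeGen y x (σ : Vel d) (k : Vel d)
  have h4 : ∀ i j, (inner ℝ y (planeGen i j (σ : Vel d)) - inner ℝ x (planeGen i j (k : Vel d))) ^ 2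
      = inner ℝ y (planeGen i j (σ : Vel d)) * inner ℝ y (planeGen i j (σ : Vel d))
        + inner ℝ x (planeGen i j (k : Vel d)) * inner ℝ x (planeGen i j (k : Vel d))
        + -2 * (inner ℝ y (planeGen i j (σ : Vel d)) * inner ℝ x (planeGen i j (k : Vel d))) := by
    intro i j; ring
  simp only [h4, Finset.sum_add_distrib, ← Finset.mul_sum, h1, h2, h3, hk, hσ, hxk, hyσ]
  rw [twistedSq, transport, real_inner_self_eq_norm_sq, real_inner_self_eq_norm_sq]
  simp only [inner_add_left, inner_sub_left, inner_smul_left, conj_trivial, hxk]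
  rw [real_inner_comm (k : Vel d) (σ : Vel d), real_inner_comm x y, real_inner_comm x (σ : Vel d),
    real_inner_comm y (k : Vel d)]
  ring

end Sphere


/-! ### Cutoff kernels -/

/-- A fixed smooth bump function on the line. -/
def bump : ContDiffBump (0 : ℝ) := ⟨1, 2, by norm_num, by norm_num⟩

/-- A cutoff in the relative speed, slowly varying on the logarithmic scale. -/
def speedCutoff (n : ℕ) (r : ℝ) : ℝ := bump (Real.log r / (n + 1))

/-- The range of cosines `-1 ≤ x < 1 - 1 / (n + 1)`, away from grazing collisions. -/
def cosRange (n : ℕ) : Set ℝ := Ico (-1) (1 - 1 / (n + 1))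

/-- The kernel `B`, cut off at small and large relative speeds and near grazing collisions. -/
def cutoffKernel (B : ℝ → ℝ → ℝ) (n : ℕ) (r x : ℝ) : ℝ :=
  (Ioi (0 : ℝ)).indicator (fun r => (cosRange n).indicator (fun x => speedCutoff n r * B r x) x) r

/-- The derivative of `cutoffKernel` in the relative speed. -/
def cutoffKernelDeriv (B : ℝ → ℝ → ℝ) (n : ℕ) (r x : ℝ) : ℝ :=
  (Ioi (0 : ℝ)).indicator (fun r => (cosRange n).indicator (fun x =>
    deriv (speedCutoff n) r * B r x + speedCutoff n r * deriv (fun s => B s x) r) x) r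

/-- The largest relative speed in the support of `speedCutoff`; the smallest one is its inverse. -/
def maxSpeed (n : ℕ) : ℝ := Real.exp (2 * (n + 1))

lemma speedCutoff_nonneg (n : ℕ) (r : ℝ) : 0 ≤ speedCutoff n r := bump.nonneg

lemma speedCutoff_le_one (n : ℕ) (r : ℝ) : speedCutoff n r ≤ 1 := bump.le_one

lemma maxSpeed_pos (n : ℕ) : 0 < maxSpeed n := Real.exp_pos _

lemma speedCutoff_eq_zero {n : ℕ} {r : ℝ} (hr : 0 < r) (h : r ∉ Icc (maxSpeed n)⁻¹ (maxSpeed n)) :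
    speedCutoff n r = 0 := by
  refine bump.zero_of_le_dist ?_
  have hn : (0 : ℝ) < n + 1 := by positivity
  rw [Real.dist_eq, sub_zero, abs_div, abs_of_pos hn, le_div_iff₀ hn]
  change 2 * ((n : ℝ) + 1) ≤ |Real.log r|
  rw [maxSpeed, ← Real.exp_neg, mem_Icc, not_and_or, not_le, not_le] at h
  rcases h with h | h
  · have := (Real.log_lt_iff_lt_exp hr).mpr h
    exact le_trans (by linarith) (neg_le_abs _)
  · have := (Real.lt_log_iff_exp_lt hr).mpr h
    exact this.le.trans (le_abs_self _)

lemma speedCutoff_hasDerivAt (n : ℕ) {r : ℝ} (hr : 0 < r) :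
    HasDerivAt (speedCutoff n) (deriv bump (Real.log r / (n + 1)) * (r⁻¹ / (n + 1))) r := by
  have h1 : HasDerivAt bump (deriv bump (Real.log r / (n + 1))) (Real.log r / (n + 1)) :=
    ((bump.contDiff (n := 1)).differentiable (by simp) _).hasDerivAt
  exact h1.comp r ((Real.hasDerivAt_log hr.ne').div_const _)

lemma exists_speedCutoff_deriv_bound :
    ∃ K : ℝ, 0 ≤ K ∧ ∀ (n : ℕ) (r : ℝ), 0 < r → |deriv (speedCutoff n) r| ≤ K / (n + 1) * r⁻¹ := by
  have hc : Continuous (deriv bump) := (bump.contDiff (n := 1)).continuous_deriv le_rfl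
  obtain ⟨K, hK⟩ := hc.bounded_above_of_compact_support (bump.hasCompactSupport.deriv)
  have hK0 : 0 ≤ K := (norm_nonneg _).trans (hK 0)
  refine ⟨K, hK0, fun n r hr => ?_⟩
  rw [(speedCutoff_hasDerivAt n hr).deriv, abs_mul, abs_of_nonneg (by positivity : 0 ≤ r⁻¹ / (n + 1 : ℝ))]
  calc _ ≤ K * (r⁻¹ / (n + 1)) := by gcongr; exact hK _
    _ = _ := by ring

lemma continuousOn_deriv_speedCutoff (n : ℕ) : ContinuousOn (deriv (speedCutoff n)) (Ioi 0) := by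
  have hc : Continuous (deriv bump) := (bump.contDiff (n := 1)).continuous_deriv le_rfl
  have h : ContinuousOn (fun r => deriv bump (Real.log r / (n + 1)) * (r⁻¹ / (n + 1)))
      (Ioi (0 : ℝ)) := by
    have hl : ContinuousOn (fun r : ℝ => Real.log r / (n + 1)) (Ioi 0) :=
      (Real.continuousOn_log.mono fun r hr => (ne_of_gt hr : r ≠ 0)).div_const _
    have hi : ContinuousOn (fun r : ℝ => r⁻¹ / ((n : ℝ) + 1)) (Ioi 0) :=
      ((continuousOn_inv₀ (G₀ := ℝ)).mono fun r hr => (ne_of_gt hr : r ≠ 0)).div_const _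
    exact (hc.comp_continuousOn hl).mul hi
  exact h.congr fun r hr => (speedCutoff_hasDerivAt n hr).deriv

lemma measurable_speedCutoff (n : ℕ) : Measurable (speedCutoff n) :=
  bump.continuous.measurable.comp (Real.measurable_log.div_const _)

lemma tendsto_speedCutoff (r : ℝ) :
    Filter.Tendsto (fun n => speedCutoff n r) Filter.atTop (nhds 1) := by
  have h : Filter.Tendsto (fun n : ℕ => Real.log r / ((n : ℝ) + 1)) Filter.atTop (nhds 0) := by
    simpa [div_eq_mul_inv] using
      (tendsto_one_div_add_atTop_nhds_zero_nat (𝕜 := ℝ)).const_mul (Real.log r)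
  have h1 := (bump.continuous.tendsto 0).comp h
  rwa [bump.one_of_mem_closedBall (by simp [bump])] at h1

lemma eventually_mem_cosRange {x : ℝ} (hx : x ∈ Ico (-1 : ℝ) 1) :
    ∀ᶠ n : ℕ in Filter.atTop, x ∈ cosRange n := by
  have h : Filter.Tendsto (fun n : ℕ => 1 - 1 / ((n : ℝ) + 1)) Filter.atTop (nhds (1 - 0)) :=
    tendsto_const_nhds.sub tendsto_one_div_add_atTop_nhds_zero_nat
  rw [sub_zero] at h
  filter_upwards [h.eventually (lt_mem_nhds hx.2)] with n hn
  exact ⟨hx.1, hn⟩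

lemma cosRange_subset (n : ℕ) : cosRange n ⊆ Ico (-1) 1 := fun x hx =>
  ⟨hx.1, hx.2.trans_le (by have : (0 : ℝ) ≤ 1 / (n + 1) := by positivity
                           linarith)⟩

lemma cutoffKernel_of_mem {B : ℝ → ℝ → ℝ} {n : ℕ} {r x : ℝ} (hr : 0 < r) (hx : x ∈ cosRange n) :
    cutoffKernel B n r x = speedCutoff n r * B r x := by
  rw [cutoffKernel, indicator_of_mem (mem_Ioi.mpr hr), indicator_of_mem hx]

lemma cutoffKernelDeriv_of_mem {B : ℝ → ℝ → ℝ} {n : ℕ} {r x : ℝ} (hr : 0 < r)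
    (hx : x ∈ cosRange n) : cutoffKernelDeriv B n r x
      = deriv (speedCutoff n) r * B r x + speedCutoff n r * deriv (fun s => B s x) r := by
  rw [cutoffKernelDeriv, indicator_of_mem (mem_Ioi.mpr hr), indicator_of_mem hx]

lemma cutoffKernel_of_notMem {B : ℝ → ℝ → ℝ} {n : ℕ} {r x : ℝ} (h : ¬(0 < r ∧ x ∈ cosRange n)) :
    cutoffKernel B n r x = 0 := by
  by_cases hr : 0 < r
  · rw [cutoffKernel, indicator_of_mem (mem_Ioi.mpr hr), indicator_of_notMem fun hx => h ⟨hr, hx⟩]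
  · rw [cutoffKernel, indicator_of_notMem (by simpa using hr)]

lemma cutoffKernelDeriv_of_notMem {B : ℝ → ℝ → ℝ} {n : ℕ} {r x : ℝ}
    (h : ¬(0 < r ∧ x ∈ cosRange n)) : cutoffKernelDeriv B n r x = 0 := by
  by_cases hr : 0 < r
  · rw [cutoffKernelDeriv, indicator_of_mem (mem_Ioi.mpr hr),
      indicator_of_notMem fun hx => h ⟨hr, hx⟩]
  · rw [cutoffKernelDeriv, indicator_of_notMem (by simpa using hr)]

section CutoffKernel

variable {d : ℕ} {B : ℝ → ℝ → ℝ}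

lemma cutoffKernel_nonneg (hB : IsCollisionKernel d B) (n : ℕ) (r x : ℝ) :
    0 ≤ cutoffKernel B n r x := by
  by_cases h : 0 < r ∧ x ∈ cosRange n
  · rw [cutoffKernel_of_mem h.1 h.2]
    exact mul_nonneg (speedCutoff_nonneg _ _) (hB.nonneg r h.1 x (cosRange_subset n h.2))
  · rw [cutoffKernel_of_notMem h]

lemma cutoffKernel_le (hB : IsCollisionKernel d B) (n : ℕ) {r x : ℝ} (hr : 0 < r)
    (hx : x ∈ Ico (-1 : ℝ) 1) : cutoffKernel B n r x ≤ B r x := by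
  by_cases h : x ∈ cosRange n
  · rw [cutoffKernel_of_mem hr h]
    exact mul_le_of_le_one_left (hB.nonneg r hr x hx) (speedCutoff_le_one _ _)
  · rw [cutoffKernel_of_notMem fun h' => h h'.2]
    exact hB.nonneg r hr x hx

lemma measurable_uncurry_indicator {g : ℝ → ℝ → ℝ} (hg : Measurable (Function.uncurry g)) (n : ℕ) :
    Measurable (Function.uncurry fun r x =>
      (Ioi (0 : ℝ)).indicator (fun r => (cosRange n).indicator (fun x => g r x) x) r) := by
  have : (Function.uncurry fun r x =>
      (Ioi (0 : ℝ)).indicator (fun r => (cosRange n).indicator (fun x => g r x) x) r)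
      = (Ioi (0 : ℝ) ×ˢ cosRange n).indicator (Function.uncurry g) := by
    ext p
    by_cases h1 : p.1 ∈ Ioi (0 : ℝ) <;> by_cases h2 : p.2 ∈ cosRange n <;>
      simp [Function.uncurry, indicator, h1, h2, mem_prod]
  rw [this]
  exact hg.indicator (measurableSet_Ioi.prod measurableSet_Ico)

lemma measurable_cutoffKernel (hB : IsCollisionKernel d B) (n : ℕ) :
    Measurable (Function.uncurry (cutoffKernel B n)) :=
  measurable_uncurry_indicator (g := fun r x => speedCutoff n r * B r x)
    (((measurable_speedCutoff n).comp measurable_fst).mul hB.measurable) n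

lemma hasDerivAt_kernel (hB : IsCollisionKernel d B) {r x : ℝ} (hr : 0 < r)
    (hx : x ∈ Ico (-1 : ℝ) 1) :
    HasDerivAt (fun s => B s x) (deriv (fun s => B s x) r) r :=
  (((hB.contDiffOn x hx).differentiableOn (by simp) r hr).differentiableAt
    (Ioi_mem_nhds hr)).hasDerivAt

lemma deriv_kernel_eq_zero (hB : IsCollisionKernel d B) {r x : ℝ} (hr : 0 < r)
    (hx : x ∈ Ico (-1 : ℝ) 1) (h0 : B r x = 0) : deriv (fun s => B s x) r = 0 := by
  refine IsLocalMin.deriv_eq_zero ?_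
  filter_upwards [Ioi_mem_nhds hr] with s hs
  rw [h0]
  exact hB.nonneg s hs x hx

/-- A jointly measurable version of `∂B/∂r`. -/
lemma exists_measurable_deriv (hB : IsCollisionKernel d B) :
    ∃ D : ℝ → ℝ → ℝ, Measurable (Function.uncurry D) ∧
      ∀ r, 0 < r → ∀ x ∈ Ico (-1 : ℝ) 1, D r x = deriv (fun s => B s x) r := by
  set S : Set (ℝ × ℝ) := Ioi (0 : ℝ) ×ˢ Ico (-1 : ℝ) 1
  have hS : MeasurableSet S := measurableSet_Ioi.prod measurableSet_Ico
  set g : ℕ → ℝ × ℝ → ℝ := fun n => S.indicator fun p =>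
    ((n : ℝ) + 1) * (B (p.1 + 1 / ((n : ℝ) + 1)) p.2 - B p.1 p.2)
  have hg : ∀ n, Measurable (g n) := fun n => by
    refine Measurable.indicator ?_ hS
    refine Measurable.const_mul (Measurable.sub ?_ hB.measurable) _
    exact hB.measurable.comp (f := fun p : ℝ × ℝ => (p.1 + 1 / ((n : ℝ) + 1), p.2)) (by fun_prop)
  have hlim : ∀ p, Filter.Tendsto (fun n => g n p) Filter.atTop
      (nhds (S.indicator (fun p => deriv (fun s => B s p.2) p.1) p)) := by
    intro p
    by_cases hp : p ∈ S
    · simp only [g, indicator_of_mem hp]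
      have hd := hasDerivAt_kernel hB (r := p.1) (x := p.2) hp.1 hp.2
      have hs := hd.tendsto_slope_zero_right
      have ht : Filter.Tendsto (fun n : ℕ => 1 / ((n : ℝ) + 1)) Filter.atTop
          (nhdsWithin 0 (Ioi 0)) :=
        tendsto_nhdsWithin_iff.mpr ⟨tendsto_one_div_add_atTop_nhds_zero_nat,
          Filter.Eventually.of_forall fun n => by simp only [mem_Ioi]; positivity⟩
      refine (hs.comp ht).congr fun n => ?_
      simp
    · simp only [g, indicator_of_notMem hp]
      exact tendsto_const_nhds
  refine ⟨fun r x => S.indicator (fun p => deriv (fun s => B s p.2) p.1) (r, x),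
    measurable_of_tendsto_metrizable hg (tendsto_pi_nhds.mpr hlim), fun r hr x hx => ?_⟩
  exact indicator_of_mem (show (r, x) ∈ S from ⟨hr, hx⟩) _

lemma measurable_cutoffKernelDeriv (hB : IsCollisionKernel d B) (n : ℕ) :
    Measurable (Function.uncurry (cutoffKernelDeriv B n)) := by
  obtain ⟨D, hD, hDeq⟩ := exists_measurable_deriv hB
  have h := measurable_uncurry_indicator (g := fun r x => deriv (speedCutoff n) r * B r x
    + speedCutoff n r * D r x) ((((measurable_deriv (speedCutoff n)).comp measurable_fst).mul
    hB.measurable).add (((measurable_speedCutoff n).comp measurable_fst).mul hD)) n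
  convert h using 1
  ext ⟨r, x⟩
  simp only [Function.uncurry, cutoffKernelDeriv]
  refine indicator_congr (f := fun r => _) (fun r hr => ?_) |> fun h => congrFun h r
  refine indicator_congr (f := fun x => _) (fun x hx => ?_) |> fun h => congrFun h x
  rw [hDeq r hr x (cosRange_subset n hx)]

lemma cutoffKernel_support {n : ℕ} {r x : ℝ} (h : cutoffKernel B n r x ≠ 0) :
    r ∈ Icc (maxSpeed n)⁻¹ (maxSpeed n) := by
  by_contra hr
  refine h ?_
  by_cases hm : 0 < r ∧ x ∈ cosRange n
  · rw [cutoffKernel_of_mem hm.1 hm.2, speedCutoff_eq_zero hm.1 hr, zero_mul]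
  · exact cutoffKernel_of_notMem hm

theorem isCutoffKernel (hB : IsCollisionKernel d B) {m : ℕ}
    (hm : Integrable (dominant B m) (paramMeasure d)) (n : ℕ) :
    IsCutoffKernel d m (maxSpeed n) (cutoffKernel B n) where
  measurable := measurable_cutoffKernel hB n
  nonneg := cutoffKernel_nonneg hB n
  pos := maxSpeed_pos n
  support r x h := cutoffKernel_support h
  integrable := by
    have hR := maxSpeed_pos n
    refine (hm.const_mul (maxSpeed n * (n + 1))).mono'
      ((measurable_pairDecay m).mul
        (measurable_kernel (measurable_cutoffKernel hB n))).aestronglyMeasurable ?_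
    filter_upwards [ae_param_pos d] with q hq
    have hP := pairDecay_pos m q.1 q.2.1
    have h0 := cutoffKernel_nonneg hB n q.1 (inner ℝ (q.2.2.1 : Vel d) (q.2.2.2 : Vel d))
    rw [Real.norm_of_nonneg (mul_nonneg hP.le h0)]
    rcases h0.eq_or_lt with h1 | h1
    · rw [← h1, mul_zero]
      exact mul_nonneg (by positivity) (dominant_nonneg hB m hq)
    · have hs := cutoffKernel_support h1.ne'
      have hx : inner ℝ (q.2.2.1 : Vel d) (q.2.2.2 : Vel d) ∈ cosRange n := by
        by_contra hx
        exact h1.ne' (cutoffKernel_of_notMem fun h => hx h.2)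
      have hle := cutoffKernel_le hB n hq (cosRange_subset n hx)
      have hB0 := hB.nonneg _ hq _ (cosRange_subset n hx)
      rw [dominant]
      set x := inner ℝ (q.2.2.1 : Vel d) (q.2.2.2 : Vel d)
      -- on the support of the cutoff, the factors `r (1 + r) (1 - k·σ)` of `dominant` are bounded below
      have e1 : 1 ≤ maxSpeed n * q.1 := by
        have := mul_le_mul_of_nonneg_left hs.1 hR.le
        rwa [mul_inv_cancel₀ hR.ne'] at this
      have e2 : 1 ≤ (n + 1) * (1 - x) := by
        have h2 : 1 / ((n : ℝ) + 1) ≤ 1 - x := by linarith [hx.2]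
        rw [div_le_iff₀ (by positivity)] at h2
        linarith
      have e3 : 1 ≤ (maxSpeed n * q.1) * ((n + 1) * (1 - x)) * (1 + q.1) := by
        have := one_le_mul_of_one_le_of_one_le e1 e2
        exact one_le_mul_of_one_le_of_one_le this (by linarith)
      calc pairDecay m q.1 q.2.1 * cutoffKernel B n q.1 x
          ≤ pairDecay m q.1 q.2.1 * B q.1 x := by gcongr
        _ ≤ ((maxSpeed n * q.1) * ((n + 1) * (1 - x)) * (1 + q.1))
            * (pairDecay m q.1 q.2.1 * B q.1 x) :=
          le_mul_of_one_le_left (by positivity) e3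
        _ = _ := by ring

end CutoffKernel

lemma IsCutoffKernel.inv_sq_mul {d m : ℕ} {R : ℝ} {b : ℝ → ℝ → ℝ} (hb : IsCutoffKernel d m R b) :
    IsCutoffKernel d m R fun r x => (r ^ 2)⁻¹ * b r x where
  measurable := (Measurable.inv (by fun_prop)).mul hb.measurable
  nonneg r x := mul_nonneg (by positivity) (hb.nonneg r x)
  pos := hb.pos
  support r x h := hb.support r x (right_ne_zero_of_mul h)
  integrable := by
    have hR := hb.pos
    refine (hb.integrable_mul (g := fun q => (q.1 ^ 2)⁻¹ * pairDecay m q.1 q.2.1)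
      (A := R ^ 2) ((Measurable.inv (by fun_prop)).mul (measurable_pairDecay m)) fun q hq => ?_).congr
      (ae_of_all _ fun q => by ring)
    have hP := pairDecay_pos m q.1 q.2.1
    have hq0 : 0 < q.1 := (inv_pos.mpr hR).trans_le hq.1
    rw [abs_of_nonneg (by positivity)]
    gcongr
    rw [← inv_pow]
    gcongr
    rw [inv_le_comm₀ hq0 hR]
    exact hq.1


/-! ### Pointwise bounds for the derivatives of `log (f ⊗ f)` -/

/-- The product of the increments of `f ⊗ f` and of its logarithmic radial derivative. -/
def radialCross {d : ℕ} (f : Vel d → ℝ) (r : ℝ) (c k σ : Vel d) : ℝ :=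
  (pairProd f r c σ - pairProd f r c k) * (radialFirst f r c σ - radialFirst f r c k)

/-- The radial derivative of `radialCross`. -/
def radialCrossDeriv {d : ℕ} (f : Vel d → ℝ) (r : ℝ) (c k σ : Vel d) : ℝ :=
  (pairProd f r c σ * radialFirst f r c σ - pairProd f r c k * radialFirst f r c k)
      * (radialFirst f r c σ - radialFirst f r c k)
    + (pairProd f r c σ - pairProd f r c k) * (radialSecond f r c σ - radialSecond f r c k)

/-- The dissipation density of the rotations. -/
def rotationDensity {d : ℕ} (f : Vel d → ℝ) (r : ℝ) (c k σ : Vel d) : ℝ :=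
  (r ^ 2)⁻¹ * (pairProd f r c k * ((1 / 2) * ∑ i, ∑ j, ((planeRotation i j).first f r c σ
    - (planeRotation i j).first f r c k) ^ 2))

section Bounds

variable {d m : ℕ} {C L : ℝ} {f : Vel d → ℝ}

lemma norm_sub_sq_of_norm_one {k σ : Vel d} (hk : ‖k‖ = 1) (hσ : ‖σ‖ = 1) :
    ‖σ - k‖ ^ 2 = 2 * (1 - inner ℝ k σ) := by
  rw [norm_sub_sq_real, hk, hσ, real_inner_comm]; ring

lemma abs_sub_le_add_mul_abs_log_sub {a b : ℝ} (ha : 0 < a) (hb : 0 < b) :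
    |a - b| ≤ (a + b) * |Real.log a - Real.log b| := by
  wlog hab : b ≤ a generalizing a b
  · rw [abs_sub_comm, abs_sub_comm (Real.log a), add_comm]
    exact this hb ha (le_of_not_ge hab)
  have hl : 0 ≤ Real.log a - Real.log b := sub_nonneg.mpr (Real.log_le_log hb hab)
  rw [abs_of_nonneg (sub_nonneg.mpr hab), abs_of_nonneg hl]
  have h := Real.one_sub_inv_le_log_of_pos (div_pos ha hb)
  rw [Real.log_div ha.ne' hb.ne', inv_div] at h
  have h2 := mul_le_mul_of_nonneg_left h ha.le
  have h3 : a * (1 - b / a) = a - b := by field_simp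
  nlinarith

lemma norm_add_smul_sub (r : ℝ) (hr : 0 ≤ r) (c k σ : Vel d) :
    ‖(c + (r / 2) • σ) - (c + (r / 2) • k)‖ = r / 2 * ‖σ - k‖ ∧
    ‖(c - (r / 2) • σ) - (c - (r / 2) • k)‖ = r / 2 * ‖σ - k‖ := by
  have h1 : (c + (r / 2) • σ) - (c + (r / 2) • k) = (r / 2) • (σ - k) := by module
  have h2 : (c - (r / 2) • σ) - (c - (r / 2) • k) = -((r / 2) • (σ - k)) := by module
  rw [h1, h2, norm_neg, norm_smul, Real.norm_of_nonneg (by positivity)]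
  exact ⟨rfl, rfl⟩

lemma IsTame.abs_pairProd_sub_le (hf : IsTame m C L f) {r : ℝ} (hr : 0 ≤ r) (c k σ : Vel d) :
    |pairProd f r c σ - pairProd f r c k|
      ≤ (pairProd f r c σ + pairProd f r c k) * (L * r * ‖σ - k‖) := by
  refine (abs_sub_le_add_mul_abs_log_sub (hf.tensorSq_pos c _) (hf.tensorSq_pos c _)).trans ?_
  have h0 : 0 ≤ pairProd f r c σ + pairProd f r c k :=
    add_nonneg (hf.tensorSq_pos c _).le (hf.tensorSq_pos c _).le
  refine mul_le_mul_of_nonneg_left ?_ h0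
  have hlip : ∀ v w : Vel d, |Real.log (f v) - Real.log (f w)| ≤ L * ‖v - w‖ := fun v w =>
    convex_univ.norm_image_sub_le_of_norm_fderiv_le
      (fun x _ => hf.smooth_log.differentiable (by simp) x)
      (fun x _ => by
        have := hf.bound_score x
        rwa [score, gradient, LinearIsometryEquiv.norm_map] at this)
      (mem_univ w) (mem_univ v)
  rw [tensorSq, tensorSq, Real.log_mul (hf.pos _).ne' (hf.pos _).ne',
    Real.log_mul (hf.pos _).ne' (hf.pos _).ne']
  have h1 := hlip (c + (r / 2) • σ) (c + (r / 2) • k)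
  have h2 := hlip (c - (r / 2) • σ) (c - (r / 2) • k)
  rw [(norm_add_smul_sub r hr c k σ).1] at h1
  rw [(norm_add_smul_sub r hr c k σ).2] at h2
  calc _ = |(Real.log (f (c + (r / 2) • σ)) - Real.log (f (c + (r / 2) • k)))
        + (Real.log (f (c - (r / 2) • σ)) - Real.log (f (c - (r / 2) • k)))| := by
          congr 1; ring
    _ ≤ L * (r / 2 * ‖σ - k‖) + L * (r / 2 * ‖σ - k‖) :=
        (abs_add_le _ _).trans (add_le_add h1 h2)
    _ = _ := by ring

/-- The increment between `k` and `σ` of a linear functional of the relative score. -/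
lemma IsTame.abs_inner_score_sub_le (hf : IsTame m C L f) {r : ℝ} (hr : 0 ≤ r) (c : Vel d)
    {k σ : Vel d} (hk : ‖k‖ = 1) (hσ : ‖σ‖ = 1) (A : Vel d →L[ℝ] Vel d) :
    |inner ℝ (score f (c + (r / 2) • σ) - score f (c - (r / 2) • σ)) (A σ)
      - inner ℝ (score f (c + (r / 2) • k) - score f (c - (r / 2) • k)) (A k)|
      ≤ 2 * L * r * ‖A‖ * ‖σ - k‖ := by
  have hL := hf.nonneg_L
  set qσ := score f (c + (r / 2) • σ) - score f (c - (r / 2) • σ)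
  set qk := score f (c + (r / 2) • k) - score f (c - (r / 2) • k)
  have h1 : ‖qσ - qk‖ ≤ L * r * ‖σ - k‖ := by
    have e : qσ - qk = (score f (c + (r / 2) • σ) - score f (c + (r / 2) • k))
        - (score f (c - (r / 2) • σ) - score f (c - (r / 2) • k)) := by
      simp only [qσ, qk]; abel
    have a1 := hf.lipschitz_score (c + (r / 2) • σ) (c + (r / 2) • k)
    have a2 := hf.lipschitz_score (c - (r / 2) • σ) (c - (r / 2) • k)
    rw [(norm_add_smul_sub r hr c k σ).1] at a1
    rw [(norm_add_smul_sub r hr c k σ).2] at a2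
    rw [e]
    refine (norm_sub_le _ _).trans ((add_le_add a1 a2).trans (le_of_eq (by ring)))
  have h2 : ‖qk‖ ≤ L * r := by
    have a := hf.lipschitz_score (c + (r / 2) • k) (c - (r / 2) • k)
    have e : (c + (r / 2) • k) - (c - (r / 2) • k) = r • k := by module
    rwa [e, norm_smul, hk, mul_one, Real.norm_of_nonneg hr] at a
  have e : inner ℝ qσ (A σ) - inner ℝ qk (A k) = inner ℝ (qσ - qk) (A σ) + inner ℝ qk (A (σ - k)) := by
    rw [inner_sub_left qσ qk, map_sub, inner_sub_right]; ring
  rw [e]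
  have b1 : ‖A σ‖ ≤ ‖A‖ := by simpa [hσ] using A.le_opNorm σ
  calc _ ≤ ‖qσ - qk‖ * ‖A σ‖ + ‖qk‖ * ‖A (σ - k)‖ :=
        (abs_add_le _ _).trans (add_le_add (abs_real_inner_le_norm _ _)
          (abs_real_inner_le_norm _ _))
    _ ≤ (L * r * ‖σ - k‖) * ‖A‖ + (L * r) * (‖A‖ * ‖σ - k‖) := by
        gcongr
        exact A.le_opNorm _
    _ = _ := by ring

lemma radialFirst_eq (f : Vel d → ℝ) (r : ℝ) (c k : Vel d) : radialFirst f r c k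
    = (1 / 2) * inner ℝ (score f (c + (r / 2) • k) - score f (c - (r / 2) • k)) k := by
  simp only [radialFirst, logDeriv₁, zero_add, zero_sub, inner_neg_right, inner_smul_right,
    inner_sub_left]
  ring

lemma IsTame.abs_radialFirst_sub_le (hf : IsTame m C L f) {r : ℝ} (hr : 0 ≤ r) (c : Vel d)
    {k σ : Vel d} (hk : ‖k‖ = 1) (hσ : ‖σ‖ = 1) :
    |radialFirst f r c σ - radialFirst f r c k| ≤ L * r * ‖σ - k‖ := by
  have hL := hf.nonneg_L
  have h := hf.abs_inner_score_sub_le hr c hk hσ (ContinuousLinearMap.id ℝ (Vel d))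
  have h1 : ‖ContinuousLinearMap.id ℝ (Vel d)‖ ≤ 1 := ContinuousLinearMap.norm_id_le
  simp only [ContinuousLinearMap.id_apply] at h
  rw [radialFirst_eq, radialFirst_eq, ← mul_sub, abs_mul, abs_of_pos (by norm_num : (0:ℝ) < 1 / 2)]
  calc _ ≤ 1 / 2 * (2 * L * r * ‖ContinuousLinearMap.id ℝ (Vel d)‖ * ‖σ - k‖) := by gcongr
    _ ≤ 1 / 2 * (2 * L * r * 1 * ‖σ - k‖) := by gcongr
    _ = _ := by ring

lemma IsTame.abs_planeRotation_first_sub_le (hf : IsTame m C L f) {r : ℝ} (hr : 0 ≤ r) (c : Vel d)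
    {k σ : Vel d} (hk : ‖k‖ = 1) (hσ : ‖σ‖ = 1) (i j : Fin d) :
    |(planeRotation i j).first f r c σ - (planeRotation i j).first f r c k|
      ≤ L * r ^ 2 * ‖planeGen i j‖ * ‖σ - k‖ := by
  have h := hf.abs_inner_score_sub_le hr c hk hσ (planeGen i j)
  rw [planeRotation_first, planeRotation_first, ← mul_sub, abs_mul,
    abs_of_nonneg (by positivity : 0 ≤ r / 2)]
  calc _ ≤ r / 2 * (2 * L * r * ‖planeGen i j‖ * ‖σ - k‖) := by gcongr
    _ = _ := by ring

lemma IsTame.pairProd_le (hf : IsTame m C L f) (r : ℝ) (c : Vel d) {k : Vel d} (hk : ‖k‖ = 1) :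
    pairProd f r c k ≤ 2 ^ m * C ^ 2 * pairDecay m r c :=
  (le_abs_self _).trans (abs_tensorSq_le hf.toHasDecay r c hk)

lemma IsTame.pairProd_pos (hf : IsTame m C L f) (r : ℝ) (c k : Vel d) : 0 < pairProd f r c k :=
  hf.tensorSq_pos _ _

lemma IsTame.abs_radialCross_le (hf : IsTame m C L f) {r : ℝ} (hr : 0 ≤ r) (c : Vel d)
    {k σ : Vel d} (hk : ‖k‖ = 1) (hσ : ‖σ‖ = 1) :
    |radialCross f r c k σ|
      ≤ 4 * 2 ^ m * C ^ 2 * L ^ 2 * (r ^ 2 * pairDecay m r c * (1 - inner ℝ k σ)) := by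
  have hL := hf.nonneg_L
  have h1 := hf.abs_pairProd_sub_le hr c k σ
  have h2 := hf.abs_radialFirst_sub_le hr c hk hσ
  have h3 := norm_sub_sq_of_norm_one hk hσ
  refine (abs_mul_le_mul h1 h2).trans ?_
  calc _ = (pairProd f r c σ + pairProd f r c k) * (L ^ 2 * r ^ 2 * ‖σ - k‖ ^ 2) := by ring
    _ ≤ (2 ^ m * C ^ 2 * pairDecay m r c + 2 ^ m * C ^ 2 * pairDecay m r c)
        * (L ^ 2 * r ^ 2 * ‖σ - k‖ ^ 2) := by
        gcongr
        · exact hf.pairProd_le r c hσ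
        · exact hf.pairProd_le r c hk
    _ = _ := by rw [h3]; ring

lemma IsTame.rotationDensity_nonneg (hf : IsTame m C L f) (r : ℝ) (c k σ : Vel d) :
    0 ≤ rotationDensity f r c k σ := by
  have := (hf.pairProd_pos r c k).le
  unfold rotationDensity
  positivity

lemma rotationDensity_self (f : Vel d → ℝ) (r : ℝ) (c k : Vel d) :
    rotationDensity f r c k k = 0 := by simp [rotationDensity]

lemma IsTame.rotationDensity_le (hf : IsTame m C L f) {r : ℝ} (hr : 0 < r) (c : Vel d)
    {k σ : Vel d} (hk : ‖k‖ = 1) (hσ : ‖σ‖ = 1) :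
    rotationDensity f r c k σ ≤ 2 ^ m * C ^ 2 * L ^ 2 * (∑ i : Fin d, ∑ j : Fin d, ‖planeGen i j‖ ^ 2)
      * (r ^ 2 * pairDecay m r c * (1 - inner ℝ k σ)) := by
  have hsum : ∑ i : Fin d, ∑ j : Fin d, ((planeRotation i j).first f r c σ
      - (planeRotation i j).first f r c k) ^ 2
      ≤ ∑ i : Fin d, ∑ j : Fin d, (L ^ 2 * r ^ 4 * ‖σ - k‖ ^ 2) * ‖planeGen i j‖ ^ 2 := by
    gcongr with i _ j _
    have h := hf.abs_planeRotation_first_sub_le hr.le c hk hσ i j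
    calc _ = |(planeRotation i j).first f r c σ - (planeRotation i j).first f r c k| ^ 2 :=
          (sq_abs _).symm
      _ ≤ (L * r ^ 2 * ‖planeGen i j‖ * ‖σ - k‖) ^ 2 := by gcongr
      _ = _ := by ring
  simp only [← Finset.mul_sum] at hsum
  have h3 := norm_sub_sq_of_norm_one hk hσ
  have hP := pairDecay_pos m r c
  unfold rotationDensity
  calc _ ≤ (r ^ 2)⁻¹ * ((2 ^ m * C ^ 2 * pairDecay m r c) * ((1 / 2) *
        ((L ^ 2 * r ^ 4 * ‖σ - k‖ ^ 2) * ∑ i : Fin d, ∑ j : Fin d, ‖planeGen i j‖ ^ 2))) := by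
        gcongr
        exact hf.pairProd_le r c hk
    _ = _ := by rw [h3]; field_simp

lemma IsTame.abs_radialFirst_le (hf : IsTame m C L f) (r : ℝ) (c : Vel d) {k : Vel d}
    (hk : ‖k‖ = 1) : |radialFirst f r c k| ≤ L := by
  refine (hf.abs_logDeriv₁_le _ _ _ _).trans (le_of_eq ?_)
  rw [norm_smul, hk]; norm_num; ring

lemma IsTame.abs_radialSecond_le (hf : IsTame m C L f) (r : ℝ) (c : Vel d) {k : Vel d}
    (hk : ‖k‖ = 1) : |radialSecond f r c k| ≤ L := by
  refine (hf.abs_logDeriv₂_le _ _ _ _ _).trans ?_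
  have := hf.nonneg_L
  rw [norm_smul, hk]; norm_num; linarith

lemma IsTame.continuous_radialFirst (hf : IsTame m C L f) :
    Continuous fun p : ℝ × (Vel d × Vel d) => radialFirst f p.1 p.2.1 p.2.2 := by
  have := hf.contDiff_score.continuous
  unfold radialFirst logDeriv₁
  fun_prop

lemma IsTame.continuous_radialSecond (hf : IsTame m C L f) :
    Continuous fun p : ℝ × (Vel d × Vel d) => radialSecond f p.1 p.2.1 p.2.2 := by
  have := hf.contDiff_score.continuous
  have := hf.continuous_fderiv_score
  unfold radialSecond logDeriv₂
  fun_prop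

lemma hasDerivAt_half_smul (k : Vel d) (r : ℝ) :
    HasDerivAt (fun r : ℝ => (r / 2) • k) ((1 / 2 : ℝ) • k) r :=
  ((hasDerivAt_id r).div_const 2).smul_const k

lemma IsTame.hasDerivAt_pairProd_radial (hf : IsTame m C L f) (r : ℝ) (c k : Vel d) :
    HasDerivAt (fun r => pairProd f r c k) (pairProd f r c k * radialFirst f r c k) r :=
  hf.hasDerivAt_tensorSq (hasDerivAt_const r c) (hasDerivAt_half_smul k r)

lemma IsTame.hasDerivAt_radialFirst (hf : IsTame m C L f) (r : ℝ) (c k : Vel d) :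
    HasDerivAt (fun r => radialFirst f r c k) (radialSecond f r c k) r :=
  hf.hasDerivAt_logDeriv₁ (hasDerivAt_const r c) (hasDerivAt_half_smul k r) (hasDerivAt_const r _)

lemma IsTame.hasDerivAt_radialCross (hf : IsTame m C L f) (r : ℝ) (c k σ : Vel d) :
    HasDerivAt (fun r => radialCross f r c k σ) (radialCrossDeriv f r c k σ) r :=
  ((hf.hasDerivAt_pairProd_radial r c σ).sub (hf.hasDerivAt_pairProd_radial r c k)).mul
    ((hf.hasDerivAt_radialFirst r c σ).sub (hf.hasDerivAt_radialFirst r c k))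

end Bounds

/-! ### The radial part of the dissipation -/

section RadialFTC

variable {d : ℕ}

lemma integral_radial (d : ℕ) (g : ℝ → ℝ) :
    ∫ r, g r ∂(radial d) = ∫ r in Ioi (0 : ℝ), r ^ (d - 1) * g r := by
  rw [radial, integral_withDensity_eq_integral_toReal_smul (by fun_prop)
    (ae_of_all _ fun r => ENNReal.ofReal_lt_top)]
  refine setIntegral_congr_fun measurableSet_Ioi fun r hr => ?_
  have : (0 : ℝ) ≤ r ^ (d - 1) := pow_nonneg (le_of_lt hr) _
  simp [ENNReal.toReal_ofReal this]

/-- The integral of a radial divergence of a function with compact support in `r > 0` vanishes. -/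
lemma integral_radial_deriv_eq_zero (hd : 2 ≤ d) {g g' : ℝ → ℝ} {R : ℝ} (hR : 0 < R)
    (hg : ∀ r, 0 < r → HasDerivAt g (g' r) r) (hg' : ContinuousOn g' (Ioi 0))
    (h0 : ∀ r, 0 < r → r ∉ Icc R⁻¹ R → g r = 0) :
    ∫ r, (g' r + (d - 1) / r * g r) ∂(radial d) = 0 := by
  have h0' : ∀ r, 0 < r → r ∉ Icc R⁻¹ R → g' r = 0 := by
    intro r hr h
    have h1 : g =ᶠ[nhds r] fun _ => 0 := by
      filter_upwards [isClosed_Icc.isOpen_compl.mem_nhds h, Ioi_mem_nhds hr] with s hs hs0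
      exact h0 s hs0 hs
    exact (hg r hr).unique ((hasDerivAt_const r 0).congr_of_eventuallyEq h1)
  have hRi : 0 < R⁻¹ := inv_pos.mpr hR
  set a := R⁻¹ / 2 with ha
  set b := max R R⁻¹ + 1 with hb
  have ha0 : 0 < a := by positivity
  have hab : a ≤ b := by
    have := le_max_right R R⁻¹
    linarith
  have haR : a ∉ Icc R⁻¹ R := fun h => by linarith [h.1]
  have hbR : b ∉ Icc R⁻¹ R := fun h => by linarith [h.2, le_max_left R R⁻¹]
  have hb0 : 0 < b := ha0.trans_le hab
  have hpow : ∀ r : ℝ, HasDerivAt (fun r : ℝ => r ^ (d - 1)) (((d : ℝ) - 1) * r ^ (d - 2)) r := by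
    intro r
    have := hasDerivAt_pow (d - 1) r
    rwa [Nat.cast_sub (by omega), Nat.cast_one, show d - 1 - 1 = d - 2 by omega] at this
  have hprod : ∀ r, 0 < r → HasDerivAt (fun r => r ^ (d - 1) * g r)
      (((d : ℝ) - 1) * r ^ (d - 2) * g r + r ^ (d - 1) * g' r) r :=
    fun r hr => (hpow r).mul (hg r hr)
  -- against `r ^ (d - 1)`, the integrand is the derivative of `r ^ (d - 1) * g r`
  have heq : ∀ r, 0 < r → r ^ (d - 1) * (g' r + (d - 1) / r * g r)
      = ((d : ℝ) - 1) * r ^ (d - 2) * g r + r ^ (d - 1) * g' r := by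
    intro r hr
    have : r ^ (d - 1) = r ^ (d - 2) * r := by
      rw [← pow_succ]; congr 1; omega
    rw [this]
    field_simp
    ring
  rw [integral_radial]
  have hgc : ContinuousOn g (Ioi 0) := fun r hr => (hg r hr).continuousAt.continuousWithinAt
  have hsub : uIcc a b ⊆ Ioi 0 := by
    rw [uIcc_of_le hab]; exact fun r hr => ha0.trans_le hr.1
  have hint : ∫ r in a..b, (((d : ℝ) - 1) * r ^ (d - 2) * g r + r ^ (d - 1) * g' r) = 0 := by
    rw [intervalIntegral.integral_eq_sub_of_hasDerivAt (fun r hr => hprod r (hsub hr))]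
    · rw [h0 a ha0 haR, h0 b hb0 hbR]; simp
    · refine ContinuousOn.intervalIntegrable (ContinuousOn.mono ?_ hsub)
      exact (ContinuousOn.mul (by fun_prop) hgc).add (ContinuousOn.mul (by fun_prop) hg')
  refine Eq.trans ?_ hint
  rw [intervalIntegral.integral_of_le hab]
  have hIoc : Ioc a b ⊆ Ioi 0 := fun r hr => ha0.trans hr.1
  rw [setIntegral_eq_of_subset_of_forall_sdiff_eq_zero measurableSet_Ioi hIoc]
  · exact setIntegral_congr_fun measurableSet_Ioc fun r hr => heq r (hIoc hr)
  · intro r hr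
    have hrR : r ∉ Icc R⁻¹ R := fun h => hr.2 ⟨by linarith [h.1], by
      linarith [h.2, le_max_left R R⁻¹]⟩
    rw [h0 r hr.1 hrR, h0' r hr.1 hrR]
    ring

variable {B : ℝ → ℝ → ℝ}

lemma hasDerivAt_cutoffKernel (hB : IsCollisionKernel d B) (n : ℕ) (x : ℝ) {r : ℝ} (hr : 0 < r) :
    HasDerivAt (fun s => cutoffKernel B n s x) (cutoffKernelDeriv B n r x) r := by
  by_cases hx : x ∈ cosRange n
  · have h := ((speedCutoff_hasDerivAt n hr).differentiableAt.hasDerivAt).mul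
      (hasDerivAt_kernel hB hr (cosRange_subset n hx))
    rw [cutoffKernelDeriv_of_mem hr hx]
    refine h.congr_of_eventuallyEq ?_
    filter_upwards [Ioi_mem_nhds hr] with s hs
    exact cutoffKernel_of_mem hs hx
  · rw [cutoffKernelDeriv_of_notMem fun h => hx h.2]
    refine (hasDerivAt_const r 0).congr_of_eventuallyEq ?_
    filter_upwards with s
    exact cutoffKernel_of_notMem fun h => hx h.2

lemma continuousOn_cutoffKernelDeriv (hB : IsCollisionKernel d B) (n : ℕ) (x : ℝ) :
    ContinuousOn (fun r => cutoffKernelDeriv B n r x) (Ioi 0) := by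
  by_cases hx : x ∈ cosRange n
  · have hx' := cosRange_subset n hx
    have h1 : ContinuousOn (fun r => deriv (fun s => B s x) r) (Ioi 0) :=
      (hB.contDiffOn x hx').continuousOn_deriv_of_isOpen isOpen_Ioi (by simp)
    have h2 : ContinuousOn (fun r => B r x) (Ioi 0) := (hB.contDiffOn x hx').continuousOn
    have h3 : ContinuousOn (speedCutoff n) (Ioi 0) := fun r hr =>
      (speedCutoff_hasDerivAt n hr).continuousAt.continuousWithinAt
    refine (((continuousOn_deriv_speedCutoff n).mul h2).add (h3.mul h1)).congr fun r hr => ?_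
    exact cutoffKernelDeriv_of_mem hr hx
  · exact continuousOn_const.congr fun r _ => cutoffKernelDeriv_of_notMem fun h => hx h.2

end RadialFTC

section Radial

variable {d m : ℕ} {C L : ℝ} {f : Vel d → ℝ} {B : ℝ → ℝ → ℝ}

/-- Integration by parts in the relative speed. -/
theorem integral_radialCross (hd : 2 ≤ d) (hB : IsCollisionKernel d B) (hf : IsTame m C L f)
    (n : ℕ)
    (h1 : Integrable (fun q : Param d => (radialCrossDeriv f q.1 q.2.1 q.2.2.1 q.2.2.2
        + (d - 1) / q.1 * radialCross f q.1 q.2.1 q.2.2.1 q.2.2.2)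
        * cutoffKernel B n q.1 (inner ℝ (q.2.2.1 : Vel d) (q.2.2.2 : Vel d))) (paramMeasure d))
    (h2 : Integrable (fun q : Param d => radialCross f q.1 q.2.1 q.2.2.1 q.2.2.2
        * cutoffKernelDeriv B n q.1 (inner ℝ (q.2.2.1 : Vel d) (q.2.2.2 : Vel d)))
        (paramMeasure d)) :
    ∫ q : Param d, (radialCrossDeriv f q.1 q.2.1 q.2.2.1 q.2.2.2
        + (d - 1) / q.1 * radialCross f q.1 q.2.1 q.2.2.1 q.2.2.2)
        * cutoffKernel B n q.1 (inner ℝ (q.2.2.1 : Vel d) (q.2.2.2 : Vel d)) ∂(paramMeasure d)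
      = - ∫ q : Param d, radialCross f q.1 q.2.1 q.2.2.1 q.2.2.2
        * cutoffKernelDeriv B n q.1 (inner ℝ (q.2.2.1 : Vel d) (q.2.2.2 : Vel d))
        ∂(paramMeasure d) := by
  rw [eq_neg_iff_add_eq_zero, ← integral_add h1 h2]
  have h3 := h1.add h2
  have e := integral_prod_symm _ (μ := radial d) (ν := volume.prod ((surf d).prod (surf d))) h3
  refine e.trans ?_
  refine integral_eq_zero_of_ae (ae_of_all _ fun y => ?_)
  set x := inner ℝ (y.2.1 : Vel d) (y.2.2 : Vel d)
  have hc : Continuous fun r => radialCrossDeriv f r y.1 y.2.1 y.2.2 := by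
    have c1 := continuous_pairProd hf.smooth.continuous
    have c2 := hf.continuous_radialFirst
    have c3 := hf.continuous_radialSecond
    have k1 : ∀ k : Vel d, Continuous fun r => pairProd f r y.1 k := fun k =>
      c1.comp (f := fun r : ℝ => (r, y.1, k)) (by fun_prop)
    have k2 : ∀ k : Vel d, Continuous fun r => radialFirst f r y.1 k := fun k =>
      c2.comp (f := fun r : ℝ => (r, y.1, k)) (by fun_prop)
    have k3 : ∀ k : Vel d, Continuous fun r => radialSecond f r y.1 k := fun k =>
      c3.comp (f := fun r : ℝ => (r, y.1, k)) (by fun_prop)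
    unfold radialCrossDeriv
    fun_prop
  have hcc : Continuous fun r => radialCross f r y.1 y.2.1 y.2.2 :=
    continuous_iff_continuousAt.mpr fun r => (hf.hasDerivAt_radialCross r _ _ _).continuousAt
  have hbc : ContinuousOn (fun r => cutoffKernel B n r x) (Ioi 0) := fun r hr =>
    (hasDerivAt_cutoffKernel hB n x hr).continuousAt.continuousWithinAt
  have := integral_radial_deriv_eq_zero hd (maxSpeed_pos n)
    (g := fun r => radialCross f r y.1 y.2.1 y.2.2 * cutoffKernel B n r x)
    (g' := fun r => radialCrossDeriv f r y.1 y.2.1 y.2.2 * cutoffKernel B n r x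
      + radialCross f r y.1 y.2.1 y.2.2 * cutoffKernelDeriv B n r x)
    (fun r hr => (hf.hasDerivAt_radialCross r _ _ _).mul (hasDerivAt_cutoffKernel hB n x hr))
    ((hc.continuousOn.mul hbc).add (hcc.continuousOn.mul (continuousOn_cutoffKernelDeriv hB n x)))
    (fun r hr h => by
      have : cutoffKernel B n r x = 0 := by
        by_contra h'
        exact h (cutoffKernel_support h')
      simp [this])
  refine Eq.trans (integral_congr_ae (ae_of_all _ fun r => ?_)) this
  simp only [Pi.add_apply, x]
  ring

end Radial

/-! ### The radial dissipation is controlled by the rotations -/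

/-- The density left over from the radial integration by parts, after completing the square; `D`
stands for `∂B/∂r`. -/
def radialDensity {d : ℕ} (B D : ℝ → ℝ → ℝ) (f : Vel d → ℝ) (r : ℝ) (c k σ : Vel d) : ℝ :=
  (1 / 2) * (r ^ 2)⁻¹ * ((r / B r (inner ℝ k σ) * |D r (inner ℝ k σ)|) ^ 2
    * ((pairProd f r c σ - pairProd f r c k) ^ 2 / (pairProd f r c k + pairProd f r c σ)
      * B r (inner ℝ k σ)))

section RadialControl

variable {d m : ℕ} {C L : ℝ} {f : Vel d → ℝ} {B D : ℝ → ℝ → ℝ}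

lemma measurable_param {g : ℝ × (Vel d × Vel d) → ℝ} (hg : Continuous g) :
    Measurable (fun q : Param d => g (q.1, (q.2.1, (q.2.2.1 : Vel d)))) ∧
      Measurable (fun q : Param d => g (q.1, (q.2.1, (q.2.2.2 : Vel d)))) :=
  ⟨(hg.comp (by fun_prop)).measurable, (hg.comp (by fun_prop)).measurable⟩

lemma IsTame.measurable_rotationDensity (hf : IsTame m C L f) :
    Measurable fun q : Param d => rotationDensity f q.1 q.2.1 q.2.2.1 q.2.2.2 := by
  obtain ⟨mF1, -⟩ := measurable_param (continuous_pairProd hf.smooth.continuous)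
  have hs := fun i j => measurable_param ((planeRotation (d := d) i j).continuous_first hf)
  have h1 := fun i j => (hs i j).1
  have h2 := fun i j => (hs i j).2
  unfold rotationDensity
  refine Measurable.mul (by fun_prop) (mF1.mul (Measurable.const_mul ?_ _))
  refine Finset.measurable_sum _ fun i _ => Finset.measurable_sum _ fun j _ => ?_
  exact ((h2 i j).sub (h1 i j)).pow_const 2

lemma IsTame.measurable_radialDensity (hf : IsTame m C L f)
    (hB : Measurable (Function.uncurry B)) (hD : Measurable (Function.uncurry D)) :
    Measurable fun q : Param d => radialDensity B D f q.1 q.2.1 q.2.2.1 q.2.2.2 := by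
  obtain ⟨mF1, mF2⟩ := measurable_param (continuous_pairProd hf.smooth.continuous)
  have mB := measurable_kernel (d := d) hB
  have mD := measurable_kernel (d := d) hD
  have mr : Measurable fun q : Param d => q.1 := measurable_fst
  unfold radialDensity
  refine Measurable.mul (by fun_prop) (Measurable.mul (((mr.div mB).mul mD.abs).pow_const 2) ?_)
  exact (((mF2.sub mF1).pow_const 2).div (mF1.add mF2)).mul mB

/-- The kernel is only controlled for `k·σ < 1`; the excluded case is the diagonal `k = σ`, where the
integrands vanish. -/
lemma inner_lt_one_or_eq (k σ : Sph d) :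
    inner ℝ (k : Vel d) (σ : Vel d) ∈ Ico (-1 : ℝ) 1 ∨ k = σ := by
  rcases lt_or_ge (inner ℝ (k : Vel d) (σ : Vel d)) 1 with h | h
  · exact Or.inl ⟨(inner_sph_mem_Icc k σ).1, h⟩
  · exact Or.inr (eq_of_one_le_inner h)

lemma IsTame.radialDensity_nonneg (hB : IsCollisionKernel d B) (hf : IsTame m C L f) {r : ℝ}
    (hr : 0 < r) (c : Vel d) (k σ : Sph d) : 0 ≤ radialDensity B D f r c k σ := by
  rcases inner_lt_one_or_eq k σ with h | rfl
  · have h0 := hB.nonneg r hr _ h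
    have h1 := hf.pairProd_pos r c k
    have h2 := hf.pairProd_pos r c σ
    unfold radialDensity
    positivity
  · simp [radialDensity]

lemma IsTame.rotationDensity_mul_nonneg (hB : IsCollisionKernel d B) (hf : IsTame m C L f) {r : ℝ}
    (hr : 0 < r) (c : Vel d) (k σ : Sph d) :
    0 ≤ rotationDensity f r c k σ * B r (inner ℝ (k : Vel d) (σ : Vel d)) := by
  rcases inner_lt_one_or_eq k σ with h | rfl
  · exact mul_nonneg (hf.rotationDensity_nonneg r c k σ) (hB.nonneg r hr _ h)
  · simp [rotationDensity_self]

lemma IsTame.integrable_rotationDensity (hB : IsCollisionKernel d B)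
    (hm : Integrable (dominant B m) (paramMeasure d)) (hf : IsTame m C L f) :
    Integrable (fun q : Param d => rotationDensity f q.1 q.2.1 q.2.2.1 q.2.2.2
      * B q.1 (inner ℝ (q.2.2.1 : Vel d) (q.2.2.2 : Vel d))) (paramMeasure d) := by
  set K := 2 ^ m * C ^ 2 * L ^ 2 * (∑ i : Fin d, ∑ j : Fin d, ‖planeGen i j‖ ^ 2)
  have hK : 0 ≤ K := by positivity
  refine (hm.const_mul K).mono' (hf.measurable_rotationDensity.mul
    (measurable_kernel hB.measurable)).aestronglyMeasurable ?_
  filter_upwards [ae_param_pos d] with q hq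
  rw [Real.norm_of_nonneg (hf.rotationDensity_mul_nonneg hB hq _ _ _)]
  rcases inner_lt_one_or_eq q.2.2.1 q.2.2.2 with h | h
  · have h0 := hB.nonneg q.1 hq _ h
    have hP := pairDecay_pos m q.1 q.2.1
    have h1 : 0 ≤ 1 - inner ℝ (q.2.2.1 : Vel d) (q.2.2.2 : Vel d) := by linarith [h.2]
    have h2 := hf.rotationDensity_le hq q.2.1 (norm_eq_of_mem_sphere q.2.2.1)
      (norm_eq_of_mem_sphere q.2.2.2)
    calc _ ≤ K * (q.1 ^ 2 * pairDecay m q.1 q.2.1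
            * (1 - inner ℝ (q.2.2.1 : Vel d) (q.2.2.2 : Vel d)))
          * B q.1 (inner ℝ (q.2.2.1 : Vel d) (q.2.2.2 : Vel d)) := by gcongr
      _ ≤ K * ((q.1 * (1 + q.1)) * pairDecay m q.1 q.2.1
            * (1 - inner ℝ (q.2.2.1 : Vel d) (q.2.2.2 : Vel d)))
          * B q.1 (inner ℝ (q.2.2.1 : Vel d) (q.2.2.2 : Vel d)) := by
          gcongr
          nlinarith
      _ = K * dominant B m q := by rw [dominant]; ring
  · rw [h, rotationDensity_self, zero_mul]
    exact mul_nonneg hK (dominant_nonneg hB m hq)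

/-- For fixed `r` and `c`, the rotational dissipation is the right side of the criterion for the
function `k ↦ F(r, c, k)`; the factor `r⁻²` also occurs in `radialDensity`. -/
lemma gradForm_pairProd (hf : IsTame m C L f) {β : ℝ → ℝ} {r : ℝ} (hr : 0 < r) (c : Vel d) :
    ∫⁻ k : Sph d, ∫⁻ σ : Sph d, ENNReal.ofReal (rotationDensity f r c k σ
      * β (inner ℝ (k : Vel d) (σ : Vel d))) ∂(surf d) ∂(surf d)
    = ENNReal.ofReal (r ^ 2)⁻¹ * gradForm β fun τ : Sph d => pairProd f r c τ := by
  rw [gradForm, ← lintegral_const_mul' _ _ ENNReal.ofReal_ne_top]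
  refine lintegral_congr fun k => ?_
  rw [← lintegral_const_mul' _ _ ENNReal.ofReal_ne_top]
  refine lintegral_congr fun σ => ?_
  rw [← ENNReal.ofReal_mul (by positivity), hf.twistedSq_eq, rotationDensity]
  congr 1
  ring

/-- Here the criterion enters, for the sections of `f ⊗ f` at fixed centre of mass and relative
speed. -/
theorem IsTame.lintegral_radialDensity_le (hB : IsCollisionKernel d B) (hc : Criterion1 d B)
    (hf : IsTame m C L f) (hD : Measurable (Function.uncurry D))
    (hDB : ∀ r, 0 < r → ∀ x ∈ Ico (-1 : ℝ) 1, D r x = deriv (fun s => B s x) r) :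
    ∫⁻ q : Param d, ENNReal.ofReal (radialDensity B D f q.1 q.2.1 q.2.2.1 q.2.2.2)
        ∂(paramMeasure d)
      ≤ ∫⁻ q : Param d, ENNReal.ofReal (rotationDensity f q.1 q.2.1 q.2.2.1 q.2.2.2
        * B q.1 (inner ℝ (q.2.2.1 : Vel d) (q.2.2.2 : Vel d))) ∂(paramMeasure d) := by
  have m1 := (hf.measurable_radialDensity hB.measurable hD).ennreal_ofReal
  have m2 : Measurable fun q : Param d =>
      ENNReal.ofReal (rotationDensity f q.1 q.2.1 q.2.2.1 q.2.2.2
        * B q.1 (inner ℝ (q.2.2.1 : Vel d) (q.2.2.2 : Vel d))) :=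
    (hf.measurable_rotationDensity.mul (measurable_kernel hB.measurable)).ennreal_ofReal
  rw [paramMeasure, lintegral_prod _ m1.aemeasurable, lintegral_prod _ m2.aemeasurable]
  refine lintegral_mono_ae ?_
  filter_upwards [ae_radial_pos d] with r hr
  have m1' : Measurable fun y : Vel d × (Sph d × Sph d) =>
      ENNReal.ofReal (radialDensity B D f r y.1 y.2.1 y.2.2) :=
    m1.comp (f := fun y : Vel d × (Sph d × Sph d) => ((r, y) : Param d)) (by fun_prop)
  have m2' : Measurable fun y : Vel d × (Sph d × Sph d) =>
      ENNReal.ofReal (rotationDensity f r y.1 y.2.1 y.2.2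
        * B r (inner ℝ (y.2.1 : Vel d) (y.2.2 : Vel d))) :=
    m2.comp (f := fun y : Vel d × (Sph d × Sph d) => ((r, y) : Param d)) (by fun_prop)
  rw [lintegral_prod _ m1'.aemeasurable, lintegral_prod _ m2'.aemeasurable]
  refine lintegral_mono fun c => ?_
  have m1'' : Measurable fun y : Sph d × Sph d =>
      ENNReal.ofReal (radialDensity B D f r c y.1 y.2) :=
    m1'.comp (f := fun y : Sph d × Sph d => (c, y)) (by fun_prop)
  have m2'' : Measurable fun y : Sph d × Sph d => ENNReal.ofReal (rotationDensity f r c y.1 y.2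
        * B r (inner ℝ (y.1 : Vel d) (y.2 : Vel d))) :=
    m2'.comp (f := fun y : Sph d × Sph d => (c, y)) (by fun_prop)
  rw [lintegral_prod _ m1''.aemeasurable, lintegral_prod _ m2''.aemeasurable]
  change _ ≤ ∫⁻ k : Sph d, ∫⁻ σ : Sph d, ENNReal.ofReal (rotationDensity f r c k σ
      * B r (inner ℝ (k : Vel d) (σ : Vel d))) ∂(surf d) ∂(surf d)
  rw [gradForm_pairProd hf hr c]
  set F : Sph d → ℝ := fun τ => pairProd f r c τ with hF
  set g : Sph d × Sph d → ℝ≥0∞ := fun y => ENNReal.ofReal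
    ((F y.2 - F y.1) ^ 2 / (F y.1 + F y.2) * B r (inner ℝ (y.1 : Vel d) (y.2 : Vel d))) with hg
  have mg : Measurable g := by
    have mF : Measurable F := ((continuous_pairProd hf.smooth.continuous).comp
      (f := fun τ : Sph d => (r, c, (τ : Vel d))) (by fun_prop)).measurable
    have mb : Measurable fun y : Sph d × Sph d => B r (inner ℝ (y.1 : Vel d) (y.2 : Vel d)) :=
      hB.measurable.comp (f := fun y : Sph d × Sph d => (r, inner ℝ (y.1 : Vel d) (y.2 : Vel d)))
        (by fun_prop)
    exact (Measurable.mul (by fun_prop) mb).ennreal_ofReal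
  set a : ℝ≥0∞ := ENNReal.ofReal ((1 / 2) * (r ^ 2)⁻¹) * gammaBarAt B r ^ 2 with ha
  calc ∫⁻ k, ∫⁻ σ, ENNReal.ofReal (radialDensity B D f r c (k : Vel d) (σ : Vel d)) ∂(surf d)
        ∂(surf d)
      ≤ ∫⁻ k, ∫⁻ σ, a * g (k, σ) ∂(surf d) ∂(surf d) := by
        refine lintegral_mono fun k => lintegral_mono fun σ => ?_
        rcases inner_lt_one_or_eq k σ with h | rfl
        · have h0 := hB.nonneg r hr _ h
          have hx : ENNReal.ofReal (r / B r (inner ℝ (k : Vel d) (σ : Vel d))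
              * |D r (inner ℝ (k : Vel d) (σ : Vel d))|) ≤ gammaBarAt B r := by
            rw [hDB r hr _ h]
            exact le_iSup₂ (f := fun x (_ : x ∈ Ico (-1 : ℝ) 1) =>
              ENNReal.ofReal (r / B r x * |deriv (fun s => B s x) r|)) _ h
          rw [radialDensity, ENNReal.ofReal_mul (p := 1 / 2 * (r ^ 2)⁻¹) (by positivity),
            ENNReal.ofReal_mul (p := _ ^ 2) (by positivity),
            ENNReal.ofReal_pow (by positivity), ha, mul_assoc]
          gcongr
        · simp [radialDensity]
    _ = a * ratioForm (B r) F := by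
        have e : ∀ k : Sph d, ∫⁻ σ, a * g (k, σ) ∂(surf d) = a * ∫⁻ σ, g (k, σ) ∂(surf d) :=
          fun k => lintegral_const_mul _ (mg.comp (by fun_prop))
        simp only [e]
        rw [lintegral_const_mul _ (Measurable.lintegral_prod_right' mg)]
        rfl
    _ = ENNReal.ofReal ((1 / 2) * (r ^ 2)⁻¹) * (gammaBarAt B r ^ 2 * ratioForm (B r) F) := by
        rw [ha, mul_assoc]
    _ ≤ ENNReal.ofReal ((1 / 2) * (r ^ 2)⁻¹) * (2 * gradForm (B r) F) :=
        mul_le_mul_right (hc F (hf.isAdmissible_pairProd r c) r hr) _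
    _ = ENNReal.ofReal (r ^ 2)⁻¹ * gradForm (B r) F := by
        have h2 : ENNReal.ofReal (1 / 2) * 2 = 1 := by
          rw [← ENNReal.ofReal_ofNat 2, ← ENNReal.ofReal_mul (by norm_num)]
          norm_num
        rw [mul_comm (1 / 2 : ℝ), ENNReal.ofReal_mul (by positivity), ← mul_assoc,
          mul_assoc (ENNReal.ofReal (r ^ 2)⁻¹), h2, mul_one]

end RadialControl

/-! ### The dissipation inequality for cutoff kernels -/

section Dissipation

variable {d m : ℕ} {C L : ℝ} {f : Vel d → ℝ} {B : ℝ → ℝ → ℝ}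

/-- Completing the square in the remainder of the radial integration by parts. -/
lemma neg_mul_sub_le {s δ a b D y : ℝ} (hs : 0 < s) (hb : 0 ≤ b) (hD : b = 0 → D = 0) (hy : 0 < y) :
    -(δ * a * D) - (1 / 2) * (s * a ^ 2 * b)
      ≤ (1 / 2) * (y ^ 2)⁻¹ * ((y / b * |D|) ^ 2 * (δ ^ 2 / s * b)) := by
  rcases hb.eq_or_lt with h | h
  · rw [hD h.symm, ← h]; simp
  · have e : (1 / 2) * (y ^ 2)⁻¹ * ((y / b * |D|) ^ 2 * (δ ^ 2 / s * b))
        - (-(δ * a * D) - (1 / 2) * (s * a ^ 2 * b)) = (1 / 2) * (δ * D + s * a * b) ^ 2 / (s * b) := by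
      rw [mul_pow, sq_abs]
      field_simp
      ring
    have : 0 ≤ (1 / 2) * (δ * D + s * a * b) ^ 2 / (s * b) := by positivity
    linarith

/-- The pointwise estimate of the remainder of the radial integration by parts. -/
lemma IsTame.neg_radialCross_mul_le (hB : IsCollisionKernel d B) (hf : IsTame m C L f)
    {D : ℝ → ℝ → ℝ} (hDB : ∀ r, 0 < r → ∀ x ∈ Ico (-1 : ℝ) 1, D r x = deriv (fun s => B s x) r)
    {K : ℝ} (hK0 : 0 ≤ K)
    (hK : ∀ (n : ℕ) (r : ℝ), 0 < r → |deriv (speedCutoff n) r| ≤ K / (n + 1) * r⁻¹)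
    (n : ℕ) {q : Param d} (hq : 0 < q.1) :
    -(radialCross f q.1 q.2.1 q.2.2.1 q.2.2.2
        * cutoffKernelDeriv B n q.1 (inner ℝ (q.2.2.1 : Vel d) (q.2.2.2 : Vel d)))
      - (1 / 2) * ((pairProd f q.1 q.2.1 q.2.2.1 + pairProd f q.1 q.2.1 q.2.2.2)
        * (radialFirst f q.1 q.2.1 q.2.2.2 - radialFirst f q.1 q.2.1 q.2.2.1) ^ 2
        * cutoffKernel B n q.1 (inner ℝ (q.2.2.1 : Vel d) (q.2.2.2 : Vel d)))
      ≤ K / (n + 1) * (4 * 2 ^ m * C ^ 2 * L ^ 2) * dominant B m q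
        + radialDensity B D f q.1 q.2.1 q.2.2.1 q.2.2.2 := by
  have hH := hf.radialDensity_nonneg (D := D) hB hq q.2.1 q.2.2.1 q.2.2.2
  have hdom := dominant_nonneg hB m hq
  by_cases hx : inner ℝ (q.2.2.1 : Vel d) (q.2.2.2 : Vel d) ∈ cosRange n
  swap
  · rw [cutoffKernelDeriv_of_notMem fun h => hx h.2, cutoffKernel_of_notMem fun h => hx h.2]
    have : 0 ≤ K / (n + 1) * (4 * 2 ^ m * C ^ 2 * L ^ 2) * dominant B m q := by positivity
    linarith
  have hx' := cosRange_subset n hx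
  have hB0 := hB.nonneg _ hq _ hx'
  rw [cutoffKernelDeriv_of_mem hq hx, cutoffKernel_of_mem hq hx, ← hDB _ hq _ hx']
  have hsq := neg_mul_sub_le (s := pairProd f q.1 q.2.1 q.2.2.1 + pairProd f q.1 q.2.1 q.2.2.2)
    (δ := pairProd f q.1 q.2.1 q.2.2.2 - pairProd f q.1 q.2.1 q.2.2.1)
    (a := radialFirst f q.1 q.2.1 q.2.2.2 - radialFirst f q.1 q.2.1 q.2.2.1)
    (D := D q.1 (inner ℝ (q.2.2.1 : Vel d) (q.2.2.2 : Vel d)))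
    (add_pos (hf.pairProd_pos _ _ _) (hf.pairProd_pos _ _ _)) hB0
    (fun h => (hDB _ hq _ hx').trans (deriv_kernel_eq_zero hB hq hx' h)) hq
  have hG := hf.abs_radialCross_le hq.le q.2.1 (norm_eq_of_mem_sphere q.2.2.1)
    (norm_eq_of_mem_sphere q.2.2.2)
  have hχ := hK n q.1 hq
  have hχ0 := speedCutoff_nonneg n q.1
  have hχ1 := speedCutoff_le_one n q.1
  have hP := pairDecay_pos m q.1 q.2.1
  have h1x : 0 ≤ 1 - inner ℝ (q.2.2.1 : Vel d) (q.2.2.2 : Vel d) := by linarith [hx'.2]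
  -- the error from the derivative of the cutoff
  have herr : -(radialCross f q.1 q.2.1 q.2.2.1 q.2.2.2 * (deriv (speedCutoff n) q.1
      * B q.1 (inner ℝ (q.2.2.1 : Vel d) (q.2.2.2 : Vel d))))
      ≤ K / (n + 1) * (4 * 2 ^ m * C ^ 2 * L ^ 2) * dominant B m q := by
    refine (neg_le_abs _).trans ?_
    have h2 : |deriv (speedCutoff n) q.1 * B q.1 (inner ℝ (q.2.2.1 : Vel d) (q.2.2.2 : Vel d))|
        ≤ K / (n + 1) * q.1⁻¹ * B q.1 (inner ℝ (q.2.2.1 : Vel d) (q.2.2.2 : Vel d)) :=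
      abs_mul_le_mul hχ (abs_of_nonneg hB0).le
    refine (abs_mul_le_mul hG h2).trans ?_
    calc _ = K / (n + 1) * (4 * 2 ^ m * C ^ 2 * L ^ 2) * (q.1 * pairDecay m q.1 q.2.1
          * ((1 - inner ℝ (q.2.2.1 : Vel d) (q.2.2.2 : Vel d))
          * B q.1 (inner ℝ (q.2.2.1 : Vel d) (q.2.2.2 : Vel d)))) := by field_simp
      _ ≤ K / (n + 1) * (4 * 2 ^ m * C ^ 2 * L ^ 2) * dominant B m q := by
          rw [dominant]
          gcongr
          nlinarith
  -- the completed square, multiplied by the cutoff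
  have hmain := mul_le_mul_of_nonneg_left hsq hχ0
  have hle : speedCutoff n q.1 * radialDensity B D f q.1 q.2.1 q.2.2.1 q.2.2.2
      ≤ radialDensity B D f q.1 q.2.1 q.2.2.1 q.2.2.2 := mul_le_of_le_one_left hH hχ1
  rw [radialDensity] at hle
  rw [radialCross] at herr ⊢
  rw [radialDensity]
  refine le_trans (le_of_eq ?_) (add_le_add herr (hmain.trans hle))
  ring

/-- The bound that makes the radial remainder integrable, without any bound on `∂B/∂r`. -/
lemma abs_mul_le_of_sq {s δ a b D y : ℝ} (hs : 0 < s) (hb : 0 ≤ b) (hD : b = 0 → D = 0)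
    (hy : 0 < y) : |δ * a * D| ≤ (1 / 2) * (s * a ^ 2 * b)
      + (1 / 2) * (y ^ 2)⁻¹ * ((y / b * |D|) ^ 2 * (δ ^ 2 / s * b)) := by
  have h1 := neg_mul_sub_le (δ := δ) (a := a) hs hb hD hy
  have h2 := neg_mul_sub_le (δ := -δ) (a := a) hs hb hD hy
  rw [neg_sq] at h2
  rw [abs_le]
  constructor <;> linarith

lemma IsTame.measurable_radial (hf : IsTame m C L f) :
    Measurable (fun q : Param d => radialCross f q.1 q.2.1 q.2.2.1 q.2.2.2) ∧
      Measurable (fun q : Param d => radialCrossDeriv f q.1 q.2.1 q.2.2.1 q.2.2.2) := by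
  obtain ⟨mF1, mF2⟩ := measurable_param (continuous_pairProd hf.smooth.continuous)
  obtain ⟨mu1, mu2⟩ := measurable_param hf.continuous_radialFirst
  obtain ⟨mv1, mv2⟩ := measurable_param hf.continuous_radialSecond
  unfold radialCross radialCrossDeriv
  exact ⟨by fun_prop, by fun_prop⟩

lemma IsTame.integrable_radialCross_deriv (hB : IsCollisionKernel d B)
    (hm : Integrable (dominant B m) (paramMeasure d)) (hf : IsTame m C L f)
    {D : ℝ → ℝ → ℝ} (hDB : ∀ r, 0 < r → ∀ x ∈ Ico (-1 : ℝ) 1, D r x = deriv (fun s => B s x) r)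
    (hH : Integrable (fun q : Param d => radialDensity B D f q.1 q.2.1 q.2.2.1 q.2.2.2)
      (paramMeasure d)) (n : ℕ) :
    Integrable (fun q : Param d => radialCross f q.1 q.2.1 q.2.2.1 q.2.2.2
        * cutoffKernelDeriv B n q.1 (inner ℝ (q.2.2.1 : Vel d) (q.2.2.2 : Vel d)))
      (paramMeasure d) := by
  obtain ⟨K, hK0, hK⟩ := exists_speedCutoff_deriv_bound
  set A := 4 * 2 ^ m * C ^ 2 * L ^ 2
  have hA : 0 ≤ A := by positivity
  refine ((hm.const_mul (K / (n + 1) * A + A)).add hH).mono'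
    (hf.measurable_radial.1.mul
      (measurable_kernel (measurable_cutoffKernelDeriv hB n))).aestronglyMeasurable ?_
  filter_upwards [ae_param_pos d] with q hq
  have hH0 := hf.radialDensity_nonneg (D := D) hB hq q.2.1 q.2.2.1 q.2.2.2
  have hdom := dominant_nonneg hB m hq
  by_cases hx : inner ℝ (q.2.2.1 : Vel d) (q.2.2.2 : Vel d) ∈ cosRange n
  swap
  · rw [cutoffKernelDeriv_of_notMem fun h => hx h.2, mul_zero, norm_zero]
    simp only [Pi.add_apply]
    positivity
  have hx' := cosRange_subset n hx
  have hB0 := hB.nonneg _ hq _ hx'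
  have hk := norm_eq_of_mem_sphere q.2.2.1
  have hσ := norm_eq_of_mem_sphere q.2.2.2
  have h1x : 0 ≤ 1 - inner ℝ (q.2.2.1 : Vel d) (q.2.2.2 : Vel d) := by linarith [hx'.2]
  have hP := pairDecay_pos m q.1 q.2.1
  rw [cutoffKernelDeriv_of_mem hq hx, ← hDB _ hq _ hx', mul_add]
  have hr2 : q.1 ≤ q.1 * (1 + q.1) := by nlinarith
  have hr3 : q.1 ^ 2 ≤ q.1 * (1 + q.1) := by nlinarith
  have h1 : |radialCross f q.1 q.2.1 q.2.2.1 q.2.2.2 * (deriv (speedCutoff n) q.1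
      * B q.1 (inner ℝ (q.2.2.1 : Vel d) (q.2.2.2 : Vel d)))| ≤ K / (n + 1) * A * dominant B m q := by
    have h2 : |deriv (speedCutoff n) q.1 * B q.1 (inner ℝ (q.2.2.1 : Vel d) (q.2.2.2 : Vel d))|
        ≤ K / (n + 1) * q.1⁻¹ * B q.1 (inner ℝ (q.2.2.1 : Vel d) (q.2.2.2 : Vel d)) :=
      abs_mul_le_mul (hK n q.1 hq) (abs_of_nonneg hB0).le
    refine (abs_mul_le_mul (hf.abs_radialCross_le hq.le q.2.1 hk hσ) h2).trans ?_
    calc _ = K / (n + 1) * A * (q.1 * pairDecay m q.1 q.2.1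
          * ((1 - inner ℝ (q.2.2.1 : Vel d) (q.2.2.2 : Vel d))
          * B q.1 (inner ℝ (q.2.2.1 : Vel d) (q.2.2.2 : Vel d)))) := by
          simp only [A]; field_simp
      _ ≤ K / (n + 1) * A * dominant B m q := by
          rw [dominant]
          gcongr
  have h2 : |radialCross f q.1 q.2.1 q.2.2.1 q.2.2.2
      * D q.1 (inner ℝ (q.2.2.1 : Vel d) (q.2.2.2 : Vel d))|
      ≤ A * dominant B m q + radialDensity B D f q.1 q.2.1 q.2.2.1 q.2.2.2 := by
    refine (abs_mul_le_of_sq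
      (add_pos (hf.pairProd_pos q.1 q.2.1 q.2.2.1) (hf.pairProd_pos q.1 q.2.1 q.2.2.2)) hB0
      (fun h => (hDB _ hq _ hx').trans (deriv_kernel_eq_zero hB hq hx' h)) hq).trans ?_
    rw [radialDensity]
    refine add_le_add ?_ le_rfl
    have hL := hf.nonneg_L
    have e1 := hf.abs_radialFirst_sub_le hq.le q.2.1 hk hσ
    have e2 : (radialFirst f q.1 q.2.1 q.2.2.2 - radialFirst f q.1 q.2.1 q.2.2.1) ^ 2
        ≤ (L * q.1 * ‖(q.2.2.2 : Vel d) - q.2.2.1‖) ^ 2 := by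
      rw [← sq_abs]
      gcongr
    rw [mul_pow, norm_sub_sq_of_norm_one hk hσ] at e2
    have e3 := hf.pairProd_le q.1 q.2.1 hk
    have e4 := hf.pairProd_le q.1 q.2.1 hσ
    calc _ ≤ 1 / 2 * ((2 ^ m * C ^ 2 * pairDecay m q.1 q.2.1 + 2 ^ m * C ^ 2 * pairDecay m q.1 q.2.1)
          * ((L * q.1) ^ 2 * (2 * (1 - inner ℝ (q.2.2.1 : Vel d) (q.2.2.2 : Vel d))))
          * B q.1 (inner ℝ (q.2.2.1 : Vel d) (q.2.2.2 : Vel d))) := by gcongr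
      _ = 1 / 2 * A * (q.1 ^ 2 * pairDecay m q.1 q.2.1
          * ((1 - inner ℝ (q.2.2.1 : Vel d) (q.2.2.2 : Vel d))
          * B q.1 (inner ℝ (q.2.2.1 : Vel d) (q.2.2.2 : Vel d)))) := by simp only [A]; ring
      _ ≤ 1 * A * dominant B m q := by
          rw [dominant]
          gcongr
          norm_num
      _ = _ := by ring
  have hχ0 := speedCutoff_nonneg n q.1
  have h3 : |radialCross f q.1 q.2.1 q.2.2.1 q.2.2.2 * (speedCutoff n q.1
      * D q.1 (inner ℝ (q.2.2.1 : Vel d) (q.2.2.2 : Vel d)))|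
      ≤ A * dominant B m q + radialDensity B D f q.1 q.2.1 q.2.2.1 q.2.2.2 := by
    rw [show ∀ a b c : ℝ, a * (b * c) = b * (a * c) by intros; ring, abs_mul, abs_of_nonneg hχ0]
    exact (mul_le_of_le_one_left (abs_nonneg _) (speedCutoff_le_one n q.1)).trans h2
  refine (abs_add_le _ _).trans ((add_le_add h1 h3).trans (le_of_eq ?_))
  simp only [Pi.add_apply]
  ring

end Dissipation

section DissipationInequality

variable {d m : ℕ} {C L : ℝ} {f : Vel d → ℝ} {B : ℝ → ℝ → ℝ}

/-- `∫ F(k) (u(σ) - u(k))² b`, with `u` the radial derivative of `log F`, is symmetrised in `k` and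
`σ`. -/
lemma integral_symm_sq (hf : IsTame m C L f) {R : ℝ} {b : ℝ → ℝ → ℝ} (hb : IsCutoffKernel d m R b) :
    Integrable (fun q : Param d => (1 / 2) * ((pairProd f q.1 q.2.1 q.2.2.1
        + pairProd f q.1 q.2.1 q.2.2.2)
        * (radialFirst f q.1 q.2.1 q.2.2.2 - radialFirst f q.1 q.2.1 q.2.2.1) ^ 2
        * b q.1 (inner ℝ (q.2.2.1 : Vel d) (q.2.2.2 : Vel d)))) (paramMeasure d) ∧
    ∫ q : Param d, (pairProd f q.1 q.2.1 q.2.2.1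
          * (radialFirst f q.1 q.2.1 q.2.2.2 - radialFirst f q.1 q.2.1 q.2.2.1) ^ 2)
          * b q.1 (inner ℝ (q.2.2.1 : Vel d) (q.2.2.2 : Vel d)) ∂(paramMeasure d)
      = ∫ q : Param d, (1 / 2) * ((pairProd f q.1 q.2.1 q.2.2.1 + pairProd f q.1 q.2.1 q.2.2.2)
        * (radialFirst f q.1 q.2.1 q.2.2.2 - radialFirst f q.1 q.2.1 q.2.2.1) ^ 2
        * b q.1 (inner ℝ (q.2.2.1 : Vel d) (q.2.2.2 : Vel d))) ∂(paramMeasure d) := by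
  obtain ⟨mF1, mF2⟩ := measurable_param (continuous_pairProd hf.smooth.continuous)
  obtain ⟨mu1, mu2⟩ := measurable_param hf.continuous_radialFirst
  have hF := fun (q : Param d) (k : Sph d) =>
    abs_tensorSq_le hf.toHasDecay q.1 q.2.1 (norm_eq_of_mem_sphere k)
  have hu := fun (q : Param d) (k : Sph d) =>
    hf.abs_radialFirst_le q.1 q.2.1 (norm_eq_of_mem_sphere k)
  have hu2 : ∀ q : Param d, |(radialFirst f q.1 q.2.1 q.2.2.2
      - radialFirst f q.1 q.2.1 q.2.2.1) ^ 2| ≤ (L + L) ^ 2 := fun q => by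
    rw [abs_pow]
    exact pow_le_pow_left₀ (abs_nonneg _) ((abs_sub _ _).trans (add_le_add (hu q _) (hu q _))) 2
  have I1 := hb.integrable_mul (mF1.mul ((mu2.sub mu1).pow_const 2))
    (A := 2 ^ m * C ^ 2 * (L + L) ^ 2) fun q _ =>
      (abs_mul_le_mul (hF q q.2.2.1) (hu2 q)).trans (le_of_eq (by ring))
  have I2 := hb.integrable_mul (mF2.mul ((mu2.sub mu1).pow_const 2))
    (A := 2 ^ m * C ^ 2 * (L + L) ^ 2) fun q _ =>
      (abs_mul_le_mul (hF q q.2.2.2) (hu2 q)).trans (le_of_eq (by ring))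
  have hs := integral_kernel_swap hb.measurable (mF1.mul ((mu2.sub mu1).pow_const 2))
  have hs' : ∫ q : Param d, (pairProd f q.1 q.2.1 q.2.2.2
          * (radialFirst f q.1 q.2.1 q.2.2.2 - radialFirst f q.1 q.2.1 q.2.2.1) ^ 2)
          * b q.1 (inner ℝ (q.2.2.1 : Vel d) (q.2.2.2 : Vel d)) ∂(paramMeasure d)
      = ∫ q : Param d, (pairProd f q.1 q.2.1 q.2.2.1
          * (radialFirst f q.1 q.2.1 q.2.2.2 - radialFirst f q.1 q.2.1 q.2.2.1) ^ 2)
          * b q.1 (inner ℝ (q.2.2.1 : Vel d) (q.2.2.2 : Vel d)) ∂(paramMeasure d) := by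
    refine Eq.trans (integral_congr_ae (ae_of_all _ fun q => ?_)) hs
    simp only [Pi.mul_apply, Pi.sub_apply]
    ring
  refine ⟨((I1.add I2).const_mul (1 / 2)).congr (ae_of_all _ fun q => ?_), ?_⟩
  · simp only [Pi.add_apply, Pi.mul_apply, Pi.sub_apply]; ring
  have hadd := integral_add I1 I2
  simp only [Pi.mul_apply, Pi.sub_apply] at hadd
  rw [hs'] at hadd
  rw [integral_const_mul]
  have e : ∫ q : Param d, ((pairProd f q.1 q.2.1 q.2.2.1 + pairProd f q.1 q.2.1 q.2.2.2)
        * (radialFirst f q.1 q.2.1 q.2.2.2 - radialFirst f q.1 q.2.1 q.2.2.1) ^ 2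
        * b q.1 (inner ℝ (q.2.2.1 : Vel d) (q.2.2.2 : Vel d))) ∂(paramMeasure d) = _ :=
    Eq.trans (integral_congr_ae (ae_of_all _ fun q => by ring)) hadd
  rw [e]
  ring

lemma abs_sub_le_two_mul {a b M : ℝ} (ha : |a| ≤ M) (hb : |b| ≤ M) : |a - b| ≤ 2 * M :=
  (abs_sub a b).trans ((add_le_add ha hb).trans (le_of_eq (by ring)))

lemma abs_div_le_of_mem {R r : ℝ} (hR : 0 < R) (hr : r ∈ Icc R⁻¹ R) (a : ℝ) :
    |a / r| ≤ |a| * R := by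
  have hr0 : 0 < r := (inv_pos.mpr hR).trans_le hr.1
  rw [abs_div, abs_of_pos hr0, div_eq_mul_inv]
  gcongr
  rw [inv_le_comm₀ hr0 hR]
  exact hr.1

lemma IsTame.integrable_radialCrossDeriv (hf : IsTame m C L f) {R : ℝ} {b : ℝ → ℝ → ℝ}
    (hb : IsCutoffKernel d m R b) :
    Integrable (fun q : Param d => (radialCrossDeriv f q.1 q.2.1 q.2.2.1 q.2.2.2
        + (d - 1) / q.1 * radialCross f q.1 q.2.1 q.2.2.1 q.2.2.2)
        * b q.1 (inner ℝ (q.2.2.1 : Vel d) (q.2.2.2 : Vel d))) (paramMeasure d) := by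
  obtain ⟨m1, m2⟩ := hf.measurable_radial
  set A₀ : ℝ := 2 ^ m * C ^ 2
  have hF := fun (q : Param d) (k : Sph d) =>
    abs_tensorSq_le hf.toHasDecay q.1 q.2.1 (norm_eq_of_mem_sphere k)
  have hu := fun (q : Param d) (k : Sph d) =>
    hf.abs_radialFirst_le q.1 q.2.1 (norm_eq_of_mem_sphere k)
  have hv := fun (q : Param d) (k : Sph d) =>
    hf.abs_radialSecond_le q.1 q.2.1 (norm_eq_of_mem_sphere k)
  refine hb.integrable_mul (A := 2 * (A₀ * L) * (2 * L) + (2 * A₀) * (2 * L)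
    + (|(d : ℝ) - 1| * R) * ((2 * A₀) * (2 * L))) (by fun_prop) fun q hq => ?_
  have h1 := abs_sub_le_two_mul (hF q q.2.2.2) (hF q q.2.2.1)
  have h2 := abs_sub_le_two_mul (hu q q.2.2.2) (hu q q.2.2.1)
  have h3 := abs_sub_le_two_mul (hv q q.2.2.2) (hv q q.2.2.1)
  have h4 := abs_sub_le_two_mul (abs_mul_le_mul (hF q q.2.2.2) (hu q q.2.2.2))
    (abs_mul_le_mul (hF q q.2.2.1) (hu q q.2.2.1))
  have h5 := abs_div_le_of_mem hb.pos hq ((d : ℝ) - 1)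
  exact (abs_add_le _ _).trans ((add_le_add ((abs_add_le _ _).trans (add_le_add
    (abs_mul_le_mul h4 h2) (abs_mul_le_mul h1 h3)))
    (abs_mul_le_mul h5 (abs_mul_le_mul h1 h2))).trans (le_of_eq (by ring)))

/-- The radial dissipation, before integration by parts. -/
lemma IsTame.radial_symmetrisation (hf : IsTame m C L f) {R : ℝ} {b : ℝ → ℝ → ℝ}
    (hb : IsCutoffKernel d m R b) :
    ∫ q : Param d, ((pairProd f q.1 q.2.1 q.2.2.2 - pairProd f q.1 q.2.1 q.2.2.1)
        * (-2 * radialLaplacian f q.1 q.2.1 q.2.2.1 - radialFirst f q.1 q.2.1 q.2.2.1 ^ 2))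
        * b q.1 (inner ℝ (q.2.2.1 : Vel d) (q.2.2.2 : Vel d)) ∂(paramMeasure d)
      = ∫ q : Param d, (radialCrossDeriv f q.1 q.2.1 q.2.2.1 q.2.2.2
        + (d - 1) / q.1 * radialCross f q.1 q.2.1 q.2.2.1 q.2.2.2)
        * b q.1 (inner ℝ (q.2.2.1 : Vel d) (q.2.2.2 : Vel d)) ∂(paramMeasure d)
        - ∫ q : Param d, (pairProd f q.1 q.2.1 q.2.2.1
          * (radialFirst f q.1 q.2.1 q.2.2.2 - radialFirst f q.1 q.2.1 q.2.2.1) ^ 2)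
          * b q.1 (inner ℝ (q.2.2.1 : Vel d) (q.2.2.2 : Vel d)) ∂(paramMeasure d) := by
  have hL := hf.nonneg_L
  have hR := hb.pos
  have mk (g : ℝ × (Vel d × Vel d) → ℝ) (hg : Continuous g) :
      Measurable fun p : ℝ × (Vel d × Sph d) => g (p.1, (p.2.1, (p.2.2 : Vel d))) :=
    (hg.comp (by fun_prop)).measurable
  have mF := mk _ (continuous_pairProd hf.smooth.continuous)
  have mu := mk _ hf.continuous_radialFirst
  have mv := mk _ hf.continuous_radialSecond
  have mw : Measurable fun p : ℝ × (Vel d × Sph d) => radialLaplacian f p.1 p.2.1 (p.2.2 : Vel d) := by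
    unfold radialLaplacian
    fun_prop
  set A₀ : ℝ := 2 ^ m * C ^ 2
  have hA₀ : 0 ≤ A₀ := by positivity
  have hd1 := abs_nonneg ((d : ℝ) - 1)
  set A := A₀ + L + |(d : ℝ) - 1| * R * L with hA
  have hdR : 0 ≤ |(d : ℝ) - 1| * R * L := by positivity
  have h := dissipation_symmetrisation hb mF mu mw (A := A)
    (fun p _ => by
      refine (abs_tensorSq_le hf.toHasDecay p.1 p.2.1 (norm_eq_of_mem_sphere p.2.2)).trans ?_
      have := pairDecay_pos m p.1 p.2.1
      gcongr
      linarith)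
    (fun p _ => (hf.abs_radialFirst_le p.1 p.2.1 (norm_eq_of_mem_sphere p.2.2)).trans (by linarith))
    (fun p hp => by
      have h1 := hf.abs_radialFirst_le p.1 p.2.1 (norm_eq_of_mem_sphere p.2.2)
      have h2 := hf.abs_radialSecond_le p.1 p.2.1 (norm_eq_of_mem_sphere p.2.2)
      have h3 := abs_div_le_of_mem hR hp ((d : ℝ) - 1)
      exact (abs_add_le _ _).trans ((add_le_add h2 (abs_mul_le_mul h3 h1)).trans (by linarith)))
  rw [h]
  congr 1
  refine integral_congr_ae (ae_of_all _ fun q => ?_)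
  simp only [radialCrossDeriv, radialCross, radialLaplacian]
  ring

/-- The radial part of the dissipation is at most the rotational dissipation, up to the error from
the derivative of the cutoff. -/
theorem IsTame.radial_dissipation_le (hd : 2 ≤ d) (hB : IsCollisionKernel d B)
    (hc : Criterion1 d B) (hm : Integrable (dominant B m) (paramMeasure d)) (hf : IsTame m C L f) :
    ∃ K : ℝ, ∀ n : ℕ, ∫ q : Param d,
        ((pairProd f q.1 q.2.1 q.2.2.2 - pairProd f q.1 q.2.1 q.2.2.1)
        * (-2 * radialLaplacian f q.1 q.2.1 q.2.2.1 - radialFirst f q.1 q.2.1 q.2.2.1 ^ 2))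
        * cutoffKernel B n q.1 (inner ℝ (q.2.2.1 : Vel d) (q.2.2.2 : Vel d)) ∂(paramMeasure d)
      ≤ K * (1 / ((n : ℝ) + 1)) + ∫ q : Param d, rotationDensity f q.1 q.2.1 q.2.2.1 q.2.2.2
        * B q.1 (inner ℝ (q.2.2.1 : Vel d) (q.2.2.2 : Vel d)) ∂(paramMeasure d) := by
  obtain ⟨D, hD, hDB⟩ := exists_measurable_deriv hB
  obtain ⟨K, hK0, hK⟩ := exists_speedCutoff_deriv_bound
  have hT := hf.integrable_rotationDensity hB hm
  have hT0 : 0 ≤ᵐ[paramMeasure d] fun q : Param d => rotationDensity f q.1 q.2.1 q.2.2.1 q.2.2.2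
      * B q.1 (inner ℝ (q.2.2.1 : Vel d) (q.2.2.2 : Vel d)) := by
    filter_upwards [ae_param_pos d] with q hq
    exact hf.rotationDensity_mul_nonneg hB hq _ _ _
  have hH0 : 0 ≤ᵐ[paramMeasure d] fun q : Param d =>
      radialDensity B D f q.1 q.2.1 q.2.2.1 q.2.2.2 := by
    filter_upwards [ae_param_pos d] with q hq
    exact hf.radialDensity_nonneg hB hq _ _ _
  have hle := hf.lintegral_radialDensity_le hB hc hD hDB
  have hHm := (hf.measurable_radialDensity hB.measurable hD)
  have hH : Integrable (fun q : Param d => radialDensity B D f q.1 q.2.1 q.2.2.1 q.2.2.2)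
      (paramMeasure d) := by
    refine ⟨hHm.aestronglyMeasurable, ?_⟩
    rw [hasFiniteIntegral_iff_ofReal hH0]
    exact hle.trans_lt ((hasFiniteIntegral_iff_ofReal hT0).mp hT.2)
  have hHT : ∫ q : Param d, radialDensity B D f q.1 q.2.1 q.2.2.1 q.2.2.2 ∂(paramMeasure d)
      ≤ ∫ q : Param d, rotationDensity f q.1 q.2.1 q.2.2.1 q.2.2.2
        * B q.1 (inner ℝ (q.2.2.1 : Vel d) (q.2.2.2 : Vel d)) ∂(paramMeasure d) := by
    rw [← ofReal_integral_eq_lintegral_ofReal hH hH0, ← ofReal_integral_eq_lintegral_ofReal hT hT0]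
      at hle
    exact (ENNReal.ofReal_le_ofReal_iff (integral_nonneg_of_ae hT0)).mp hle
  set A := 4 * 2 ^ m * C ^ 2 * L ^ 2
  refine ⟨K * A * ∫ q, dominant B m q ∂(paramMeasure d), fun n => ?_⟩
  have hb := isCutoffKernel hB hm n
  have i1 := hf.integrable_radialCrossDeriv hb
  have i2 := hf.integrable_radialCross_deriv hB hm hDB hH n
  have i2' : Integrable (fun q : Param d => -(radialCross f q.1 q.2.1 q.2.2.1 q.2.2.2
        * cutoffKernelDeriv B n q.1 (inner ℝ (q.2.2.1 : Vel d) (q.2.2.2 : Vel d))))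
      (paramMeasure d) := i2.neg
  obtain ⟨i3, e3⟩ := integral_symm_sq hf hb
  rw [hf.radial_symmetrisation hb, integral_radialCross hd hB hf n i1 i2, e3, ← integral_neg,
    ← integral_sub i2' i3]
  have i4 : Integrable (fun q => K / (n + 1) * A * dominant B m q
      + radialDensity B D f q.1 q.2.1 q.2.2.1 q.2.2.2) (paramMeasure d) := (hm.const_mul _).add hH
  calc _ ≤ ∫ q, (K / (n + 1) * A * dominant B m q
      + radialDensity B D f q.1 q.2.1 q.2.2.1 q.2.2.2) ∂(paramMeasure d) := by
        refine integral_mono_ae (i2'.sub i3) i4 ?_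
        filter_upwards [ae_param_pos d] with q hq
        exact hf.neg_radialCross_mul_le hB hDB hK0 hK n hq
    _ = K / (n + 1) * A * (∫ q, dominant B m q ∂(paramMeasure d))
        + ∫ q : Param d, radialDensity B D f q.1 q.2.1 q.2.2.1 q.2.2.2 ∂(paramMeasure d) := by
        rw [integral_add (hm.const_mul _) hH, integral_const_mul]
    _ ≤ _ := by
        refine add_le_add (le_of_eq ?_) hHT
        ring

lemma SymmetryFlow.integrable_dissipation (X : SymmetryFlow d) {R : ℝ} {b : ℝ → ℝ → ℝ}
    (hb : IsCutoffKernel d m R b) (hf : IsTame m C L f) :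
    Integrable (fun q : Param d => ((pairProd f q.1 q.2.1 q.2.2.2 - pairProd f q.1 q.2.1 q.2.2.1)
        * (-2 * X.second f q.1 q.2.1 q.2.2.1 - X.first f q.1 q.2.1 q.2.2.1 ^ 2))
        * b q.1 (inner ℝ (q.2.2.1 : Vel d) (q.2.2.2 : Vel d))) (paramMeasure d) ∧
    Integrable (fun q : Param d => (pairProd f q.1 q.2.1 q.2.2.1
          * (X.first f q.1 q.2.1 q.2.2.2 - X.first f q.1 q.2.1 q.2.2.1) ^ 2)
          * b q.1 (inner ℝ (q.2.2.1 : Vel d) (q.2.2.2 : Vel d))) (paramMeasure d) := by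
  have hR := hb.pos
  obtain ⟨mF1, mF2⟩ := measurable_param (continuous_pairProd hf.smooth.continuous)
  obtain ⟨mu1, mu2⟩ := measurable_param (X.continuous_first hf)
  obtain ⟨mv1, mv2⟩ := measurable_param (X.continuous_second hf)
  set A₀ : ℝ := 2 ^ m * C ^ 2
  set A₁ : ℝ := 2 * L * (‖X.e‖ + R * ‖X.gen‖)
  set A₂ : ℝ := 2 * L * ((‖X.e‖ + R * ‖X.gen‖) ^ 2 + R * ‖X.gen‖ ^ 2)
  have hF := fun (q : Param d) (k : Sph d) =>
    abs_tensorSq_le hf.toHasDecay q.1 q.2.1 (norm_eq_of_mem_sphere k)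
  have hu : ∀ (q : Param d) (k : Sph d), q.1 ∈ Icc R⁻¹ R → |X.first f q.1 q.2.1 k| ≤ A₁ :=
    fun q k hq => X.abs_first_le hf ((inv_pos.mpr hR).le.trans hq.1) hq.2 _
      (norm_eq_of_mem_sphere k)
  have hv : ∀ (q : Param d) (k : Sph d), q.1 ∈ Icc R⁻¹ R → |X.second f q.1 q.2.1 k| ≤ A₂ :=
    fun q k hq => X.abs_second_le hf ((inv_pos.mpr hR).le.trans hq.1) hq.2 _
      (norm_eq_of_mem_sphere k)
  constructor
  · refine hb.integrable_mul (A := (2 * A₀) * (2 * A₂ + A₁ ^ 2)) (by fun_prop) fun q hq => ?_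
    have h1 := abs_sub_le_two_mul (hF q q.2.2.2) (hF q q.2.2.1)
    have h2 : |-2 * X.second f q.1 q.2.1 q.2.2.1 - X.first f q.1 q.2.1 q.2.2.1 ^ 2|
        ≤ 2 * A₂ + A₁ ^ 2 := by
      refine (abs_sub _ _).trans (add_le_add ?_ ?_)
      · rw [abs_mul, abs_neg, abs_two]
        exact mul_le_mul_of_nonneg_left (hv q _ hq) (by norm_num)
      · rw [abs_pow]
        exact pow_le_pow_left₀ (abs_nonneg _) (hu q _ hq) 2
    exact (abs_mul_le_mul h1 h2).trans (le_of_eq (by ring))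
  · refine hb.integrable_mul (A := A₀ * (2 * A₁) ^ 2) (by fun_prop) fun q hq => ?_
    have h2 : |(X.first f q.1 q.2.1 q.2.2.2 - X.first f q.1 q.2.1 q.2.2.1) ^ 2|
        ≤ (2 * A₁) ^ 2 := by
      rw [abs_pow]
      exact pow_le_pow_left₀ (abs_nonneg _) (abs_sub_le_two_mul (hu q _ hq) (hu q _ hq)) 2
    exact (abs_mul_le_mul (hF q q.2.2.1) h2).trans (le_of_eq (by ring))

lemma IsTame.integrable_radial_dissipation (hf : IsTame m C L f) {R : ℝ} {b : ℝ → ℝ → ℝ}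
    (hb : IsCutoffKernel d m R b) :
    Integrable (fun q : Param d => ((pairProd f q.1 q.2.1 q.2.2.2 - pairProd f q.1 q.2.1 q.2.2.1)
        * (-2 * radialLaplacian f q.1 q.2.1 q.2.2.1 - radialFirst f q.1 q.2.1 q.2.2.1 ^ 2))
        * b q.1 (inner ℝ (q.2.2.1 : Vel d) (q.2.2.2 : Vel d))) (paramMeasure d) := by
  have hR := hb.pos
  obtain ⟨mF1, mF2⟩ := measurable_param (continuous_pairProd hf.smooth.continuous)
  obtain ⟨mu1, mu2⟩ := measurable_param hf.continuous_radialFirst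
  obtain ⟨mv1, mv2⟩ := measurable_param hf.continuous_radialSecond
  have mw : Measurable fun q : Param d => radialLaplacian f q.1 q.2.1 (q.2.2.1 : Vel d) := by
    unfold radialLaplacian
    fun_prop
  set A₀ : ℝ := 2 ^ m * C ^ 2
  have hF := fun (q : Param d) (k : Sph d) =>
    abs_tensorSq_le hf.toHasDecay q.1 q.2.1 (norm_eq_of_mem_sphere k)
  refine hb.integrable_mul (A := (2 * A₀) * (2 * (L + |(d : ℝ) - 1| * R * L) + L ^ 2))
    (by fun_prop) fun q hq => ?_
  have h1 := abs_sub_le_two_mul (hF q q.2.2.2) (hF q q.2.2.1)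
  have h3 := hf.abs_radialFirst_le q.1 q.2.1 (norm_eq_of_mem_sphere q.2.2.1)
  have h4 := hf.abs_radialSecond_le q.1 q.2.1 (norm_eq_of_mem_sphere q.2.2.1)
  have h5 := abs_div_le_of_mem hR hq ((d : ℝ) - 1)
  have h2 : |-2 * radialLaplacian f q.1 q.2.1 q.2.2.1 - radialFirst f q.1 q.2.1 q.2.2.1 ^ 2|
        ≤ 2 * (L + |(d : ℝ) - 1| * R * L) + L ^ 2 := by
    refine (abs_sub _ _).trans (add_le_add ?_ ?_)
    · rw [abs_mul, abs_neg, abs_two]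
      refine mul_le_mul_of_nonneg_left ?_ (by norm_num)
      exact (abs_add_le _ _).trans (add_le_add h4 (abs_mul_le_mul h5 h3))
    · rw [abs_pow]
      exact pow_le_pow_left₀ (abs_nonneg _) h3 2
  exact (abs_mul_le_mul h1 h2).trans (le_of_eq (by ring))

end DissipationInequality

section TotalDissipation

variable {d m : ℕ} {C L : ℝ} {f : Vel d → ℝ} {B : ℝ → ℝ → ℝ}

/-- The dissipation of Fisher's information for a cutoff kernel: translations and rotations
contribute nonpositive terms. -/
lemma IsTame.total_dissipation_le (hf : IsTame m C L f) {R : ℝ} {b : ℝ → ℝ → ℝ}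
    (hb : IsCutoffKernel d m R b) :
    ∫ q : Param d, (pairProd f q.1 q.2.1 q.2.2.2 - pairProd f q.1 q.2.1 q.2.2.1)
        * (fisherVariation f (q.2.1 + (q.1 / 2) • (q.2.2.1 : Vel d))
          + fisherVariation f (q.2.1 - (q.1 / 2) • (q.2.2.1 : Vel d)))
        * b q.1 (inner ℝ (q.2.2.1 : Vel d) (q.2.2.2 : Vel d)) ∂(paramMeasure d)
      ≤ 2 * ∫ q : Param d, ((pairProd f q.1 q.2.1 q.2.2.2 - pairProd f q.1 q.2.1 q.2.2.1)
        * (-2 * radialLaplacian f q.1 q.2.1 q.2.2.1 - radialFirst f q.1 q.2.1 q.2.2.1 ^ 2))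
        * b q.1 (inner ℝ (q.2.2.1 : Vel d) (q.2.2.2 : Vel d)) ∂(paramMeasure d)
      - 2 * ∫ q : Param d, rotationDensity f q.1 q.2.1 q.2.2.1 q.2.2.2
        * b q.1 (inner ℝ (q.2.2.1 : Vel d) (q.2.2.2 : Vel d)) ∂(paramMeasure d) := by
  have hb' := hb.inv_sq_mul
  set tr : Fin d → Param d → ℝ := fun i q =>
    ((pairProd f q.1 q.2.1 q.2.2.2 - pairProd f q.1 q.2.1 q.2.2.1)
      * (-2 * (axisTranslation i).second f q.1 q.2.1 q.2.2.1
        - (axisTranslation i).first f q.1 q.2.1 q.2.2.1 ^ 2))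
      * b q.1 (inner ℝ (q.2.2.1 : Vel d) (q.2.2.2 : Vel d)) with htr
  set ro : Fin d → Fin d → Param d → ℝ := fun i j q =>
    ((pairProd f q.1 q.2.1 q.2.2.2 - pairProd f q.1 q.2.1 q.2.2.1)
      * (-2 * (planeRotation i j).second f q.1 q.2.1 q.2.2.1
        - (planeRotation i j).first f q.1 q.2.1 q.2.2.1 ^ 2))
      * ((q.1 ^ 2)⁻¹ * b q.1 (inner ℝ (q.2.2.1 : Vel d) (q.2.2.2 : Vel d))) with hro
  set ra : Param d → ℝ := fun q =>
    ((pairProd f q.1 q.2.1 q.2.2.2 - pairProd f q.1 q.2.1 q.2.2.1)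
        * (-2 * radialLaplacian f q.1 q.2.1 q.2.2.1 - radialFirst f q.1 q.2.1 q.2.2.1 ^ 2))
        * b q.1 (inner ℝ (q.2.2.1 : Vel d) (q.2.2.2 : Vel d)) with hra
  set sq : Fin d → Fin d → Param d → ℝ := fun i j q =>
    (pairProd f q.1 q.2.1 q.2.2.1 * ((planeRotation i j).first f q.1 q.2.1 q.2.2.2
      - (planeRotation i j).first f q.1 q.2.1 q.2.2.1) ^ 2)
      * ((q.1 ^ 2)⁻¹ * b q.1 (inner ℝ (q.2.2.1 : Vel d) (q.2.2.2 : Vel d))) with hsq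
  have itr : ∀ i, Integrable (tr i) (paramMeasure d) := fun i =>
    ((axisTranslation i).integrable_dissipation hb hf).1
  have iro : ∀ i j, Integrable (ro i j) (paramMeasure d) := fun i j =>
    ((planeRotation i j).integrable_dissipation hb' hf).1
  have isq : ∀ i j, Integrable (sq i j) (paramMeasure d) := fun i j =>
    ((planeRotation i j).integrable_dissipation hb' hf).2
  have ira : Integrable ra (paramMeasure d) := hf.integrable_radial_dissipation hb
  have i1 : Integrable (fun q => (1 / 2) * ∑ i, tr i q) (paramMeasure d) :=
    (integrable_finsetSum _ fun i _ => itr i).const_mul _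
  have i2 : Integrable (fun q => 2 * ra q) (paramMeasure d) := ira.const_mul _
  have i12 : Integrable (fun q => (1 / 2) * ∑ i, tr i q + 2 * ra q) (paramMeasure d) := i1.add i2
  have i3' : ∀ i, Integrable (fun q => ∑ j, ro i j q) (paramMeasure d) := fun i =>
    integrable_finsetSum _ fun j _ => iro i j
  have i3 : Integrable (fun q => ∑ i, ∑ j, ro i j q) (paramMeasure d) :=
    integrable_finsetSum _ fun i _ => i3' i
  have i4' : ∀ i, Integrable (fun q => ∑ j, sq i j q) (paramMeasure d) := fun i =>
    integrable_finsetSum _ fun j _ => isq i j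
  have hpt : ∀ᵐ q ∂(paramMeasure d),
      (pairProd f q.1 q.2.1 q.2.2.2 - pairProd f q.1 q.2.1 q.2.2.1)
        * (fisherVariation f (q.2.1 + (q.1 / 2) • (q.2.2.1 : Vel d))
          + fisherVariation f (q.2.1 - (q.1 / 2) • (q.2.2.1 : Vel d)))
        * b q.1 (inner ℝ (q.2.2.1 : Vel d) (q.2.2.2 : Vel d))
      = (1 / 2) * ∑ i, tr i q + 2 * ra q + ∑ i, ∑ j, ro i j q := by
    filter_upwards [ae_param_pos d] with q hq
    rw [fisherVariation_add f q.1 q.2.1 q.2.2.1 hq.ne' (norm_eq_of_mem_sphere q.2.2.1)]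
    simp only [htr, hro, hra, mul_add, add_mul, Finset.mul_sum, Finset.sum_mul]
    congr 1
    · congr 1
      · exact Finset.sum_congr rfl fun i _ => by ring
      · ring
    · exact Finset.sum_congr rfl fun i _ => Finset.sum_congr rfl fun j _ => by ring
  have htr0 : ∀ i, ∫ q, tr i q ∂(paramMeasure d) ≤ 0 := by
    intro i
    rw [htr, (axisTranslation i).dissipation hb hf, neg_nonpos]
    refine integral_nonneg fun q => mul_nonneg (mul_nonneg ?_ (sq_nonneg _)) (hb.nonneg _ _)
    exact (hf.pairProd_pos _ _ _).le
  have hro0 : ∀ i j, ∫ q, ro i j q ∂(paramMeasure d) = -∫ q, sq i j q ∂(paramMeasure d) :=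
    fun i j => (planeRotation i j).dissipation hb' hf
  have hrd : ∫ q : Param d, rotationDensity f q.1 q.2.1 q.2.2.1 q.2.2.2
        * b q.1 (inner ℝ (q.2.2.1 : Vel d) (q.2.2.2 : Vel d)) ∂(paramMeasure d)
      = (1 / 2) * ∑ i, ∑ j, ∫ q, sq i j q ∂(paramMeasure d) := by
    have e : ∀ q : Param d, rotationDensity f q.1 q.2.1 q.2.2.1 q.2.2.2
        * b q.1 (inner ℝ (q.2.2.1 : Vel d) (q.2.2.2 : Vel d))
        = (1 / 2) * ∑ i, ∑ j, sq i j q := by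
      intro q
      simp only [hsq, rotationDensity, Finset.mul_sum, Finset.sum_mul]
      exact Finset.sum_congr rfl fun i _ => Finset.sum_congr rfl fun j _ => by ring
    simp only [e]
    rw [integral_const_mul, integral_finsetSum _ fun i _ => i4' i]
    congr 1
    exact Finset.sum_congr rfl fun i _ => integral_finsetSum _ fun j _ => isq i j
  rw [integral_congr_ae hpt, integral_add i12 i3, integral_add i1 i2, integral_const_mul,
    integral_const_mul, integral_finsetSum _ fun i _ => itr i,
    integral_finsetSum _ fun i _ => i3' i, hrd]
  have e3 : ∑ i, ∫ q, ∑ j, ro i j q ∂(paramMeasure d)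
      = -∑ i, ∑ j, ∫ q, sq i j q ∂(paramMeasure d) := by
    rw [← Finset.sum_neg_distrib]
    refine Finset.sum_congr rfl fun i _ => ?_
    rw [integral_finsetSum _ fun j _ => iro i j, ← Finset.sum_neg_distrib]
    exact Finset.sum_congr rfl fun j _ => hro0 i j
  rw [e3]
  have := Finset.sum_nonpos fun i (_ : i ∈ Finset.univ) => htr0 i
  linarith

/-- For cutoff kernels the dissipation of Fisher's information is nonpositive up to an error that
vanishes as the cutoff is removed. -/
theorem IsTame.exists_dissipation_bound (hd : 2 ≤ d) (hB : IsCollisionKernel d B)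
    (hc : Criterion1 d B) (hm : Integrable (dominant B m) (paramMeasure d)) (hf : IsTame m C L f) :
    ∃ e : ℕ → ℝ, Filter.Tendsto e Filter.atTop (nhds 0) ∧ ∀ n,
      ∫ q : Param d, (pairProd f q.1 q.2.1 q.2.2.2 - pairProd f q.1 q.2.1 q.2.2.1)
        * (fisherVariation f (q.2.1 + (q.1 / 2) • (q.2.2.1 : Vel d))
          + fisherVariation f (q.2.1 - (q.1 / 2) • (q.2.2.1 : Vel d)))
        * cutoffKernel B n q.1 (inner ℝ (q.2.2.1 : Vel d) (q.2.2.2 : Vel d)) ∂(paramMeasure d)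
      ≤ e n := by
  obtain ⟨K, hK⟩ := hf.radial_dissipation_le hd hB hc hm
  have hT := hf.integrable_rotationDensity hB hm
  set T := ∫ q : Param d, rotationDensity f q.1 q.2.1 q.2.2.1 q.2.2.2
        * B q.1 (inner ℝ (q.2.2.1 : Vel d) (q.2.2.2 : Vel d)) ∂(paramMeasure d)
  have hlim : Filter.Tendsto (fun n => ∫ q : Param d, rotationDensity f q.1 q.2.1 q.2.2.1 q.2.2.2
        * cutoffKernel B n q.1 (inner ℝ (q.2.2.1 : Vel d) (q.2.2.2 : Vel d)) ∂(paramMeasure d))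
        Filter.atTop (nhds T) := by
    refine tendsto_integral_of_dominated_convergence _ (fun n =>
      (hf.measurable_rotationDensity.mul
        (measurable_kernel (measurable_cutoffKernel hB n))).aestronglyMeasurable) hT
      (fun n => ?_) ?_
    · filter_upwards [ae_param_pos d] with q hq
      have h0 := hf.rotationDensity_nonneg q.1 q.2.1 q.2.2.1 q.2.2.2
      have h1 := cutoffKernel_nonneg hB n q.1 (inner ℝ (q.2.2.1 : Vel d) (q.2.2.2 : Vel d))
      rw [Real.norm_of_nonneg (mul_nonneg h0 h1)]
      rcases inner_lt_one_or_eq q.2.2.1 q.2.2.2 with h | h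
      · exact mul_le_mul_of_nonneg_left (cutoffKernel_le hB n hq h) h0
      · simp [h, rotationDensity_self]
    · filter_upwards [ae_param_pos d] with q hq
      rcases inner_lt_one_or_eq q.2.2.1 q.2.2.2 with h | h
      · refine Filter.Tendsto.const_mul _ ?_
        have h1 := (tendsto_speedCutoff q.1).mul_const
          (B q.1 (inner ℝ (q.2.2.1 : Vel d) (q.2.2.2 : Vel d)))
        rw [one_mul] at h1
        refine h1.congr' ?_
        filter_upwards [eventually_mem_cosRange h] with n hn
        exact (cutoffKernel_of_mem hq hn).symm
      · simp [h, rotationDensity_self]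
  refine ⟨fun n => 2 * (K * (1 / ((n : ℝ) + 1)) + T) - 2 * ∫ q : Param d,
      rotationDensity f q.1 q.2.1 q.2.2.1 q.2.2.2
        * cutoffKernel B n q.1 (inner ℝ (q.2.2.1 : Vel d) (q.2.2.2 : Vel d)) ∂(paramMeasure d),
      ?_, fun n => ?_⟩
  · have h1 := ((((tendsto_one_div_add_atTop_nhds_zero_nat (𝕜 := ℝ)).const_mul K).add_const
      T).const_mul 2).sub (hlim.const_mul 2)
    simpa using h1
  · refine (hf.total_dissipation_le (isCutoffKernel hB hm n)).trans ?_
    have := hK n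
    linarith

end TotalDissipation

/-! ### Dissipation of Fisher's information along the collision operator -/

section CollisionDissipation

variable {d m : ℕ} {C L : ℝ} {f : Vel d → ℝ} {B : ℝ → ℝ → ℝ}

lemma integral_comp_of_measurePreserving {α β : Type*} [MeasurableSpace α] [MeasurableSpace β]
    {μ : Measure α} {ν : Measure β} {T : α → β} (hT : MeasurePreserving T μ ν) {g : β → ℝ}
    (hg : Measurable g) : ∫ x, g (T x) ∂μ = ∫ y, g y ∂ν := by
  rw [← hT.map_eq, integral_map hT.aemeasurable hg.aestronglyMeasurable]

/-- The reflection of `σ` about the axis `ℝ k`, as a transformation of the collision parameters. -/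
lemma measurePreserving_param_reflection (d : ℕ) :
    MeasurePreserving (fun q : Param d =>
      ((q.1, (q.2.1, (q.2.2.1, sphMap (axialIsometry (q.2.2.1 : Vel d)) q.2.2.2))) : Param d))
      (paramMeasure d) (paramMeasure d) := by
  have hm : Measurable fun p : Sph d × Sph d => sphMap (axialIsometry (p.1 : Vel d)) p.2 := by
    refine Measurable.subtype_mk ?_
    have : (fun p : Sph d × Sph d => axialIsometry (p.1 : Vel d) (p.2 : Vel d))
        = fun p => axialReflection (p.1 : Vel d) (p.2 : Vel d) := by
      funext p
      exact axialIsometry_apply (norm_eq_of_mem_sphere p.1) _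
    rw [this]
    unfold axialReflection
    fun_prop
  have h := (MeasurePreserving.id (surf d)).skew_product (μc := surf d) (μd := surf d)
    (g := fun k σ => sphMap (axialIsometry (k : Vel d)) σ) hm
    (ae_of_all _ fun k => (measurePreserving_sphMap (axialIsometry (k : Vel d))).map_eq)
  exact measurePreserving_param_prod (S := id) h (MeasurePreserving.id volume)

lemma measurePreserving_param_neg (d : ℕ) :
    MeasurePreserving (fun q : Param d => ((q.1, (q.2.1, (-q.2.2.1, -q.2.2.2))) : Param d))
      (paramMeasure d) (paramMeasure d) := by
  have h := measurePreserving_sphMap (LinearIsometryEquiv.neg ℝ (E := Vel d))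
  have e : sphMap (LinearIsometryEquiv.neg ℝ (E := Vel d)) = fun σ : Sph d => -σ := by
    funext σ
    exact Subtype.ext rfl
  rw [e] at h
  exact measurePreserving_param_prod (S := id) (h.prod h) (MeasurePreserving.id volume)

lemma IsTame.continuous_fisherVariation (hf : IsTame m C L f) : Continuous (fisherVariation f) := by
  have h1 := hf.continuous_fderiv_score
  have h2 := hf.contDiff_score.continuous
  unfold fisherVariation
  fun_prop

lemma IsTame.abs_fisherVariation_le (hf : IsTame m C L f) (v : Vel d) :
    |fisherVariation f v| ≤ 2 * (d * L) + L ^ 2 := by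
  have hL := hf.nonneg_L
  rw [fisherVariation, abs_neg]
  refine (abs_add_le _ _).trans (add_le_add ?_ ?_)
  · rw [abs_mul, abs_two]
    gcongr
    refine (Finset.abs_sum_le_sum_abs _ _).trans ?_
    have h1 : ∀ i : Fin d, |fderiv ℝ (score f) v (EuclideanSpace.single i 1) i| ≤ L := by
      intro i
      have e1 : ‖(EuclideanSpace.single i (1 : ℝ) : Vel d)‖ = 1 := by simp
      have e2 := (fderiv ℝ (score f) v).le_opNorm (EuclideanSpace.single i 1)
      rw [e1, mul_one] at e2
      exact (PiLp.norm_apply_le _ i).trans (e2.trans (hf.bound_hess_log v))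
    exact (Finset.sum_le_sum fun i _ => h1 i).trans (by simp)
  · rw [abs_of_nonneg (by positivity)]
    exact pow_le_pow_left₀ (norm_nonneg _) (hf.bound_score v) 2

lemma pair_sub {r : ℝ} (c k : Vel d) : (c + (r / 2) • k) - (c - (r / 2) • k) = r • k := by module

lemma pair_add {r : ℝ} (c k : Vel d) :
    (1 / 2 : ℝ) • ((c + (r / 2) • k) + (c - (r / 2) • k)) = c := by module

lemma velDominant_param (B : ℝ → ℝ → ℝ) (m : ℕ) {r : ℝ} (hr : 0 < r) (c : Vel d) (k σ : Sph d) :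
    velDominant B m (c + (r / 2) • (k : Vel d)) (c - (r / 2) • (k : Vel d)) σ
      = dominant B m (r, (c, (k, σ))) := by
  rw [velDominant, pair_sub, pair_add, norm_smul_sph hr, dir_smul_sph hr, dominant]

lemma collisionIntegrand_param (b : ℝ → ℝ → ℝ) (f : Vel d → ℝ) {r : ℝ} (hr : 0 < r) (c : Vel d)
    (k σ : Sph d) :
    collisionIntegrand b f (c + (r / 2) • (k : Vel d)) (c - (r / 2) • (k : Vel d)) σ
      = ((pairProd f r c σ + pairProd f r c (sphMap (axialIsometry (k : Vel d)) σ)) / 2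
        - pairProd f r c k) * b r (inner ℝ (k : Vel d) (σ : Vel d)) := by
  have h : ((sphMap (axialIsometry (k : Vel d)) σ : Sph d) : Vel d)
      = axialReflection (k : Vel d) (σ : Vel d) :=
    axialIsometry_apply (norm_eq_of_mem_sphere k) _
  rw [collisionIntegrand, postProd_eq_pairProd, postProd_eq_pairProd, pair_sub, pair_add,
    norm_smul_sph hr, dir_smul_sph hr, h]
  rfl

lemma integrable_velDominant (hd : 2 ≤ d) (hB : IsCollisionKernel d B)
    (hm : Integrable (dominant B m) (paramMeasure d)) :
    Integrable (fun p : (Vel d × Vel d) × Sph d => velDominant B m p.1.1 p.1.2 (p.2 : Vel d))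
      ((volume.prod volume).prod (surf d)) := by
  refine ((measurePreserving_param hd).integrable_comp
    (measurable_velDominant hB.measurable m).aestronglyMeasurable).mp (hm.congr ?_)
  filter_upwards [ae_param_pos d] with q hq
  exact (velDominant_param B m hq q.2.1 q.2.2.1 q.2.2.2).symm

lemma integral_boltzmannQ_mul (B : ℝ → ℝ → ℝ) (f φ : Vel d → ℝ)
    (h : Integrable (fun p : (Vel d × Vel d) × Sph d =>
      collisionIntegrand B f p.1.1 p.1.2 (p.2 : Vel d) * φ p.1.1)
      ((volume.prod volume).prod (surf d))) :
    ∫ v, boltzmannQ B f v * φ v = ∫ p : (Vel d × Vel d) × Sph d,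
      collisionIntegrand B f p.1.1 p.1.2 (p.2 : Vel d) * φ p.1.1
        ∂((volume.prod volume).prod (surf d)) := by
  rw [integral_prod _ h, integral_prod _ h.integral_prod_left]
  refine integral_congr_ae (ae_of_all _ fun v => ?_)
  simp only [integral_mul_const]
  rfl

/-- The weak form of the collision operator with a cutoff kernel. -/
lemma integral_collisionIntegrand_mul (hd : 2 ≤ d) (hf : IsTame m C L f) {R : ℝ}
    {b : ℝ → ℝ → ℝ} (hb : IsCutoffKernel d m R b) {φ : Vel d → ℝ} (hφ : Continuous φ) {M : ℝ}
    (hM : ∀ v, |φ v| ≤ M) :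
    ∫ p : (Vel d × Vel d) × Sph d, collisionIntegrand b f p.1.1 p.1.2 (p.2 : Vel d) * φ p.1.1
        ∂((volume.prod volume).prod (surf d))
    = (1 / 2) * ∫ q : Param d, (pairProd f q.1 q.2.1 q.2.2.2 - pairProd f q.1 q.2.1 q.2.2.1)
        * (φ (q.2.1 + (q.1 / 2) • (q.2.2.1 : Vel d))
          + φ (q.2.1 - (q.1 / 2) • (q.2.2.1 : Vel d)))
        * b q.1 (inner ℝ (q.2.2.1 : Vel d) (q.2.2.2 : Vel d)) ∂(paramMeasure d) := by
  obtain ⟨mF1, mF2⟩ := measurable_param (continuous_pairProd hf.smooth.continuous)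
  have mφ₁ : Measurable fun q : Param d => φ (q.2.1 + (q.1 / 2) • (q.2.2.1 : Vel d)) :=
    (hφ.comp (by fun_prop)).measurable
  have mφ₂ : Measurable fun q : Param d => φ (q.2.1 - (q.1 / 2) • (q.2.2.1 : Vel d)) :=
    (hφ.comp (by fun_prop)).measurable
  have mb := measurable_kernel (d := d) hb.measurable
  set A₀ : ℝ := 2 ^ m * C ^ 2
  have hF := fun (q : Param d) (k : Sph d) =>
    abs_tensorSq_le hf.toHasDecay q.1 q.2.1 (norm_eq_of_mem_sphere k)
  have hrefl := measurePreserving_param_reflection d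
  have mF3 : Measurable fun q : Param d =>
      pairProd f q.1 q.2.1 (sphMap (axialIsometry (q.2.2.1 : Vel d)) q.2.2.2) :=
    mF2.comp hrefl.measurable
  set gσ : Param d → ℝ := fun q => pairProd f q.1 q.2.1 q.2.2.2
    * φ (q.2.1 + (q.1 / 2) • (q.2.2.1 : Vel d))
    * b q.1 (inner ℝ (q.2.2.1 : Vel d) (q.2.2.2 : Vel d)) with hgσ
  set gk : Param d → ℝ := fun q => pairProd f q.1 q.2.1 q.2.2.1
    * φ (q.2.1 + (q.1 / 2) • (q.2.2.1 : Vel d))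
    * b q.1 (inner ℝ (q.2.2.1 : Vel d) (q.2.2.2 : Vel d)) with hgk
  set gτ : Param d → ℝ := fun q =>
    pairProd f q.1 q.2.1 (sphMap (axialIsometry (q.2.2.1 : Vel d)) q.2.2.2)
    * φ (q.2.1 + (q.1 / 2) • (q.2.2.1 : Vel d))
    * b q.1 (inner ℝ (q.2.2.1 : Vel d) (q.2.2.2 : Vel d)) with hgτ
  have int (g ψ : Param d → ℝ) (hg : Measurable g) (hψ : Measurable ψ)
      (h1 : ∀ q, |g q| ≤ A₀ * pairDecay m q.1 q.2.1) (h2 : ∀ q, |ψ q| ≤ M) :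
      Integrable (fun q : Param d => g q * ψ q
        * b q.1 (inner ℝ (q.2.2.1 : Vel d) (q.2.2.2 : Vel d))) (paramMeasure d) :=
    hb.integrable_mul (hg.mul hψ) (A := A₀ * M) fun q _ =>
      (abs_mul_le_mul (h1 q) (h2 q)).trans (le_of_eq (by ring))
  have iσ : Integrable gσ (paramMeasure d) := int _ _ mF2 mφ₁ (fun q => hF q _) fun q => hM _
  have ik : Integrable gk (paramMeasure d) := int _ _ mF1 mφ₁ (fun q => hF q _) fun q => hM _
  have iτ : Integrable gτ (paramMeasure d) := int _ _ mF3 mφ₁ (fun q => hF q _) fun q => hM _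
  have hτσ : ∫ q, gτ q ∂(paramMeasure d) = ∫ q, gσ q ∂(paramMeasure d) := by
    have mσ : Measurable gσ := (mF2.mul mφ₁).mul mb
    rw [← integral_comp_of_measurePreserving hrefl mσ]
    refine integral_congr_ae (ae_of_all _ fun q => ?_)
    have hk : axialIsometry (q.2.2.1 : Vel d) (q.2.2.1 : Vel d) = q.2.2.1 := by
      rw [axialIsometry_apply (norm_eq_of_mem_sphere _), axialReflection,
        real_inner_self_eq_norm_sq, norm_eq_of_mem_sphere]
      module
    have hi : inner ℝ (q.2.2.1 : Vel d) (axialIsometry (q.2.2.1 : Vel d) (q.2.2.2 : Vel d))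
        = inner ℝ (q.2.2.1 : Vel d) (q.2.2.2 : Vel d) := by
      have := (axialIsometry (q.2.2.1 : Vel d)).inner_map_map (q.2.2.1 : Vel d) (q.2.2.2 : Vel d)
      rwa [hk] at this
    change _ = _ * b q.1 (inner ℝ (q.2.2.1 : Vel d)
      (axialIsometry (q.2.2.1 : Vel d) (q.2.2.2 : Vel d)))
    rw [hi]
  have e1 : ∫ p : (Vel d × Vel d) × Sph d,
      collisionIntegrand b f p.1.1 p.1.2 (p.2 : Vel d) * φ p.1.1
        ∂((volume.prod volume).prod (surf d))
      = ∫ q, (1 / 2 * (gσ q + gτ q) - gk q) ∂(paramMeasure d) := by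
    have mc : Measurable fun p : (Vel d × Vel d) × Sph d =>
        collisionIntegrand b f p.1.1 p.1.2 (p.2 : Vel d) * φ p.1.1 :=
      (measurable_collisionIntegrand hb.measurable hf.smooth.continuous).mul
        (hφ.measurable.comp (measurable_fst.comp measurable_fst))
    rw [← integral_comp_of_measurePreserving (measurePreserving_param hd) mc]
    refine integral_congr_ae ?_
    filter_upwards [ae_param_pos d] with q hq
    rw [collisionIntegrand_param b f hq]
    simp only [hgσ, hgτ, hgk]
    ring
  have hστ : Integrable (fun q => gσ q + gτ q) (paramMeasure d) := iσ.add iτ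
  rw [e1, integral_sub (hστ.const_mul _) ik, integral_const_mul, integral_add iσ iτ, hτσ]
  -- symmetrisation in `(k, σ) ↦ (-k, -σ)`
  set G₁ : Param d → ℝ := fun q =>
    (pairProd f q.1 q.2.1 q.2.2.2 - pairProd f q.1 q.2.1 q.2.2.1)
    * φ (q.2.1 + (q.1 / 2) • (q.2.2.1 : Vel d))
    * b q.1 (inner ℝ (q.2.2.1 : Vel d) (q.2.2.2 : Vel d)) with hG₁
  set G₂ : Param d → ℝ := fun q =>
    (pairProd f q.1 q.2.1 q.2.2.2 - pairProd f q.1 q.2.1 q.2.2.1)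
    * φ (q.2.1 - (q.1 / 2) • (q.2.2.1 : Vel d))
    * b q.1 (inner ℝ (q.2.2.1 : Vel d) (q.2.2.2 : Vel d)) with hG₂
  have iG₁ : Integrable G₁ (paramMeasure d) :=
    (iσ.sub ik).congr (ae_of_all _ fun q => by simp only [hG₁, hgσ, hgk, Pi.sub_apply]; ring)
  have hneg := measurePreserving_param_neg d
  have eneg : ∀ q : Param d, G₁ (q.1, (q.2.1, (-q.2.2.1, -q.2.2.2))) = G₂ q := by
    intro q
    simp only [hG₁, hG₂]
    have h1 : ∀ k : Sph d, pairProd f q.1 q.2.1 ((-k : Sph d) : Vel d) = pairProd f q.1 q.2.1 k :=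
      fun k => pairProd_neg f q.1 q.2.1 k
    have h2 : q.2.1 + (q.1 / 2) • ((-q.2.2.1 : Sph d) : Vel d)
        = q.2.1 - (q.1 / 2) • (q.2.2.1 : Vel d) := by
      change q.2.1 + (q.1 / 2) • (-(q.2.2.1 : Vel d)) = _
      module
    have h3 : inner ℝ ((-q.2.2.1 : Sph d) : Vel d) ((-q.2.2.2 : Sph d) : Vel d)
        = inner ℝ (q.2.2.1 : Vel d) (q.2.2.2 : Vel d) := inner_neg_neg _ _
    rw [h1, h1, h2, h3]
  have mG₁ : Measurable G₁ := ((mF2.sub mF1).mul mφ₁).mul mb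
  have hG : ∫ q, G₂ q ∂(paramMeasure d) = ∫ q, G₁ q ∂(paramMeasure d) := by
    rw [← integral_comp_of_measurePreserving hneg mG₁]
    exact integral_congr_ae (ae_of_all _ fun q => (eneg q).symm)
  have iG₂ : Integrable G₂ (paramMeasure d) :=
    (hneg.integrable_comp_of_integrable iG₁).congr (ae_of_all _ eneg)
  have e2 : ∫ q, G₁ q ∂(paramMeasure d) = ∫ q, gσ q ∂(paramMeasure d)
      - ∫ q, gk q ∂(paramMeasure d) := by
    rw [← integral_sub iσ ik]
    exact integral_congr_ae (ae_of_all _ fun q => by simp only [hG₁, hgσ, hgk]; ring)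
  have e3 : ∫ q : Param d, (pairProd f q.1 q.2.1 q.2.2.2 - pairProd f q.1 q.2.1 q.2.2.1)
        * (φ (q.2.1 + (q.1 / 2) • (q.2.2.1 : Vel d))
          + φ (q.2.1 - (q.1 / 2) • (q.2.2.1 : Vel d)))
        * b q.1 (inner ℝ (q.2.2.1 : Vel d) (q.2.2.2 : Vel d)) ∂(paramMeasure d)
      = ∫ q, G₁ q ∂(paramMeasure d) + ∫ q, G₂ q ∂(paramMeasure d) := by
    rw [← integral_add iG₁ iG₂]
    exact integral_congr_ae (ae_of_all _ fun q => by simp only [hG₁, hG₂]; ring)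
  rw [e3, hG, e2]
  ring

/-- The derivative of Fisher's information along the collision operator is nonpositive. -/
theorem IsTame.integral_boltzmannQ_mul_fisherVariation_nonpos (hd : 2 ≤ d)
    (hB : IsCollisionKernel d B) (hc : Criterion1 d B)
    (hm : Integrable (dominant B m) (paramMeasure d)) (hf : IsTame m C L f) :
    ∫ v, boltzmannQ B f v * fisherVariation f v ≤ 0 := by
  set M := 2 * (d * L) + L ^ 2
  have hM := hf.abs_fisherVariation_le
  have hφ := hf.continuous_fisherVariation
  have hdom := (integrable_velDominant hd hB hm).const_mul (5 * 2 ^ m * C ^ 2 * M)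
  have mφ : Measurable fun p : (Vel d × Vel d) × Sph d => fisherVariation f p.1.1 :=
    hφ.measurable.comp (measurable_fst.comp measurable_fst)
  have hbound : ∀ b : ℝ → ℝ → ℝ, (∀ r, 0 < r → ∀ x ∈ Ico (-1 : ℝ) 1, |b r x| ≤ B r x) →
      ∀ p : (Vel d × Vel d) × Sph d,
        ‖collisionIntegrand b f p.1.1 p.1.2 (p.2 : Vel d) * fisherVariation f p.1.1‖
        ≤ 5 * 2 ^ m * C ^ 2 * M * velDominant B m p.1.1 p.1.2 (p.2 : Vel d) := by
    intro b hb p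
    exact (abs_mul_le_mul (abs_collisionIntegrand_le hb hf.toHasDecay p.1.1 p.1.2 p.2)
      (hM p.1.1)).trans (le_of_eq (by ring))
  have hBB : ∀ r, 0 < r → ∀ x ∈ Ico (-1 : ℝ) 1, |B r x| ≤ B r x := fun r hr x hx =>
    (abs_of_nonneg (hB.nonneg r hr x hx)).le
  have hbn : ∀ n, ∀ r, 0 < r → ∀ x ∈ Ico (-1 : ℝ) 1, |cutoffKernel B n r x| ≤ B r x :=
    fun n r hr x hx => by
      rw [abs_of_nonneg (cutoffKernel_nonneg hB n r x)]
      exact cutoffKernel_le hB n hr hx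
  have hI : Integrable (fun p : (Vel d × Vel d) × Sph d =>
      collisionIntegrand B f p.1.1 p.1.2 (p.2 : Vel d) * fisherVariation f p.1.1)
      ((volume.prod volume).prod (surf d)) :=
    hdom.mono' ((measurable_collisionIntegrand hB.measurable hf.smooth.continuous).mul
      mφ).aestronglyMeasurable (ae_of_all _ (hbound B hBB))
  rw [integral_boltzmannQ_mul B f _ hI]
  obtain ⟨e, he, hle⟩ := hf.exists_dissipation_bound hd hB hc hm
  have hlim : Filter.Tendsto (fun n => ∫ p : (Vel d × Vel d) × Sph d,
      collisionIntegrand (cutoffKernel B n) f p.1.1 p.1.2 (p.2 : Vel d) * fisherVariation f p.1.1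
        ∂((volume.prod volume).prod (surf d))) Filter.atTop
      (nhds (∫ p : (Vel d × Vel d) × Sph d,
        collisionIntegrand B f p.1.1 p.1.2 (p.2 : Vel d) * fisherVariation f p.1.1
        ∂((volume.prod volume).prod (surf d)))) := by
    refine tendsto_integral_of_dominated_convergence _ (fun n =>
      ((measurable_collisionIntegrand (measurable_cutoffKernel hB n)
        hf.smooth.continuous).mul mφ).aestronglyMeasurable) hdom
      (fun n => ae_of_all _ (hbound _ (hbn n))) (ae_of_all _ fun p => ?_)
    rcases eq_or_ne (velDominant B m p.1.1 p.1.2 (p.2 : Vel d)) 0 with h0 | h0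
    · have hz : ∀ b : ℝ → ℝ → ℝ, (∀ r, 0 < r → ∀ x ∈ Ico (-1 : ℝ) 1, |b r x| ≤ B r x) →
          collisionIntegrand b f p.1.1 p.1.2 (p.2 : Vel d) * fisherVariation f p.1.1 = 0 := by
        intro b hb
        have := hbound b hb p
        rw [h0, mul_zero] at this
        exact norm_le_zero_iff.mp this
      simp only [hz _ (hbn _), hz B hBB]
      exact tendsto_const_nhds
    · refine Filter.Tendsto.mul_const _ (Filter.Tendsto.const_mul _ ?_)
      have hz : p.1.1 - p.1.2 ≠ 0 := by
        intro h
        exact h0 (by simp [velDominant, h])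
      have hr := norm_pos_iff.mpr hz
      have hx : inner ℝ (dir (p.1.1 - p.1.2)) (p.2 : Vel d) ∈ Ico (-1 : ℝ) 1 := by
        have := dir_inner_mem hz p.2
        refine ⟨this.1, lt_of_le_of_ne this.2 fun h => h0 ?_⟩
        rw [velDominant, h]
        ring
      have h1 := (tendsto_speedCutoff ‖p.1.1 - p.1.2‖).mul_const
        (B ‖p.1.1 - p.1.2‖ (inner ℝ (dir (p.1.1 - p.1.2)) (p.2 : Vel d)))
      rw [one_mul] at h1
      refine h1.congr' ?_
      filter_upwards [eventually_mem_cosRange hx] with n hn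
      exact (cutoffKernel_of_mem hr hn).symm
  have he2 := he.const_mul (1 / 2)
  rw [mul_zero] at he2
  refine le_of_tendsto_of_tendsto' hlim he2 fun n => ?_
  rw [integral_collisionIntegrand_mul hd hf (isCutoffKernel hB hm n) hφ hM]
  exact mul_le_mul_of_nonneg_left (hle n) (by norm_num)

end CollisionDissipation

/-! ### Regularised functions -/

section Regularisation

variable {d m : ℕ} {C D : ℝ} {f g : Vel d → ℝ}

lemma decay_succ_mul (m : ℕ) (v : Vel d) : decay (m + 1) v * (1 + ‖v‖ ^ 2) = decay m v := by
  have : (1 + ‖v‖ ^ 2) ≠ 0 := by positivity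
  unfold decay
  rw [pow_succ, mul_inv, mul_assoc, inv_mul_cancel₀ this, mul_one]

lemma hasFDerivAt_decay (m : ℕ) (v : Vel d) :
    HasFDerivAt (decay m : Vel d → ℝ) (innerSL ℝ ((-(2 * m * decay (m + 1) v)) • v)) v := by
  have h1 : HasFDerivAt (fun x : Vel d => 1 + ‖x‖ ^ 2) (2 • innerSL ℝ v) v :=
    (hasStrictFDerivAt_norm_sq v).hasFDerivAt.const_add 1
  have hp : (1 + ‖v‖ ^ 2) ≠ 0 := by positivity
  have h2 : HasDerivAt (fun x : ℝ => (x ^ m)⁻¹) (-(m * ((1 + ‖v‖ ^ 2) ^ (m + 1))⁻¹))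
      (1 + ‖v‖ ^ 2) := by
    refine (HasDerivAt.fun_inv (c := fun x : ℝ => x ^ m) (hasDerivAt_pow m _)
      (pow_ne_zero m hp)).congr_deriv ?_
    cases m with
    | zero => simp
    | succ n =>
      rw [Nat.add_sub_cancel]
      field_simp
      ring
  refine (h2.comp_hasFDerivAt v h1).congr_fderiv ?_
  ext x
  simp [decay]
  ring

lemma gradient_decay (m : ℕ) (v : Vel d) :
    gradient (decay m : Vel d → ℝ) v = (-(2 * m * decay (m + 1) v)) • v := by
  refine HasGradientAt.gradient ?_
  rw [hasGradientAt_iff_hasFDerivAt]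
  exact hasFDerivAt_decay m v

lemma contDiff_decay (m : ℕ) : ContDiff ℝ ∞ (decay m : Vel d → ℝ) := by
  have h : ContDiff ℝ ∞ fun v : Vel d => (1 + ‖v‖ ^ 2) ^ m :=
    (contDiff_const.add (contDiff_norm_sq ℝ)).pow m
  exact h.inv fun v => by positivity

theorem hasDecay_decay (d m : ℕ) :
    HasDecay m (1 + 2 * m + 4 * m * (m + 1)) (decay m : Vel d → ℝ) := by
  have h1 : ∀ (n : ℕ) (v : Vel d), decay (n + 1) v ≤ decay n v := fun n v => by
    rw [← decay_succ_mul n v]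
    exact le_mul_of_one_le_right (decay_pos _ _).le (by nlinarith [sq_nonneg ‖v‖])
  have h2 : ∀ (n : ℕ) (v : Vel d), decay (n + 1) v * ‖v‖ ≤ decay n v := fun n v => by
    have := decay_pos (n + 1) v
    rw [← decay_succ_mul n]
    gcongr
    nlinarith [sq_nonneg (‖v‖ - 1)]
  have h3 : ∀ (n : ℕ) (v : Vel d), decay (n + 1) v * ‖v‖ ^ 2 ≤ decay n v := fun n v => by
    have := decay_pos (n + 1) v
    rw [← decay_succ_mul n]
    gcongr
    linarith
  have hg : gradient (decay m : Vel d → ℝ) = fun v => (-(2 * m * decay (m + 1) v)) • v :=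
    funext (gradient_decay m)
  refine ⟨contDiff_decay m, fun v => ?_, fun v => ?_, fun v => ?_⟩
  · have := decay_pos m v
    rw [abs_of_pos this]
    exact le_mul_of_one_le_left this.le (by nlinarith [Nat.cast_nonneg (α := ℝ) m])
  · have := decay_pos (m + 1) v
    have := decay_pos m v
    rw [gradient_decay, norm_smul, norm_neg, Real.norm_of_nonneg (by positivity)]
    calc _ = 2 * m * (decay (m + 1) v * ‖v‖) := by ring
      _ ≤ 2 * m * decay m v := by gcongr; exact h2 m v
      _ ≤ _ := by gcongr; nlinarith [Nat.cast_nonneg (α := ℝ) m]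
  · have hd : HasFDerivAt (fun v : Vel d => (-(2 * m * decay (m + 1) v)) • v)
        ((-(2 * (m : ℝ) * decay (m + 1) v)) • ContinuousLinearMap.id ℝ (Vel d)
          + (-((2 * (m : ℝ)) • innerSL ℝ ((-(2 * ((m + 1 : ℕ) : ℝ)
            * decay (m + 1 + 1) v)) • v))).smulRight v) v :=
      (((hasFDerivAt_decay (m + 1) v).const_mul (2 * (m : ℝ))).neg).smul (hasFDerivAt_id v)
    have p0 := decay_pos m v
    have p1 := decay_pos (m + 1) v
    have p2 := decay_pos (m + 2) v
    rw [hg, HasFDerivAt.fderiv hd]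
    refine (norm_add_le _ _).trans ?_
    have e1 : ‖(-(2 * (m : ℝ) * decay (m + 1) v)) • ContinuousLinearMap.id ℝ (Vel d)‖
        ≤ 2 * m * decay m v := by
      rw [norm_smul, norm_neg, Real.norm_of_nonneg (by positivity)]
      calc _ ≤ 2 * m * decay (m + 1) v * 1 := by
            gcongr; exact ContinuousLinearMap.norm_id_le
        _ ≤ _ := by rw [mul_one]; gcongr; exact h1 m v
    have e2 : ‖(-((2 * (m : ℝ)) • innerSL ℝ ((-(2 * ((m + 1 : ℕ) : ℝ)
        * decay (m + 1 + 1) v)) • v))).smulRight v‖ ≤ 4 * m * (m + 1) * decay m v := by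
      rw [ContinuousLinearMap.norm_smulRight_apply, norm_neg, norm_smul, innerSL_apply_norm,
        norm_smul, norm_neg, Real.norm_of_nonneg (by positivity),
        Real.norm_of_nonneg (by positivity)]
      calc _ = 4 * m * (m + 1) * (decay (m + 1 + 1) v * ‖v‖ ^ 2) := by push_cast; ring
        _ ≤ _ := by gcongr; exact (h3 (m + 1) v).trans (h1 m v)
    calc _ ≤ 2 * m * decay m v + 4 * m * (m + 1) * decay m v := add_le_add e1 e2
      _ ≤ _ := by nlinarith

lemma HasDecay.nonneg (hf : HasDecay m C f) : 0 ≤ C :=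
  nonneg_of_mul_nonneg_left ((abs_nonneg _).trans (hf.bound 0)) (decay_pos m 0)

lemma HasDecay.hasGradientAt (hf : HasDecay m C f) (v : Vel d) :
    HasGradientAt f (gradient f v) v :=
  (hf.smooth.differentiable (by simp) v).hasGradientAt

lemma HasDecay.hasFDerivAt_gradient (hf : HasDecay m C f) (v : Vel d) :
    HasFDerivAt (gradient f) (fderiv ℝ (gradient f) v) v :=
  ((contDiff_gradient hf.smooth).differentiable (by simp) v).hasFDerivAt

lemma HasDecay.gradient_add_smul (hf : HasDecay m C f) (hg : HasDecay m D g) (ε : ℝ) (v : Vel d) :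
    gradient (fun v => f v + ε * g v) v = gradient f v + ε • gradient g v := by
  refine HasGradientAt.gradient ?_
  rw [hasGradientAt_iff_hasFDerivAt, map_add, map_smul]
  exact (hf.hasGradientAt v).hasFDerivAt.add ((hg.hasGradientAt v).hasFDerivAt.const_mul ε)

lemma HasDecay.fderiv_gradient_add_smul (hf : HasDecay m C f) (hg : HasDecay m D g) (ε : ℝ)
    (v : Vel d) : fderiv ℝ (gradient fun v => f v + ε * g v) v
      = fderiv ℝ (gradient f) v + ε • fderiv ℝ (gradient g) v := by
  rw [funext (hf.gradient_add_smul hg ε)]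
  exact ((hf.hasFDerivAt_gradient v).add ((hg.hasFDerivAt_gradient v).const_smul ε)).fderiv

theorem HasDecay.add_smul (hf : HasDecay m C f) (hg : HasDecay m D g) {ε : ℝ} (h0 : 0 ≤ ε)
    (h1 : ε ≤ 1) : HasDecay m (C + D) fun v => f v + ε * g v := by
  have key : ∀ (v : Vel d) (x : ℝ), 0 ≤ x → x ≤ D * decay m v → ε * x ≤ D * decay m v :=
    fun v x hx0 hx => (mul_le_of_le_one_left hx0 h1).trans hx
  refine ⟨hf.smooth.add (contDiff_const.mul hg.smooth), fun v => ?_, fun v => ?_, fun v => ?_⟩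
  · refine (abs_add_le _ _).trans ?_
    rw [add_mul, abs_mul, abs_of_nonneg h0]
    exact add_le_add (hf.bound v) (key v _ (abs_nonneg _) (hg.bound v))
  · rw [hf.gradient_add_smul hg]
    refine (norm_add_le _ _).trans ?_
    rw [add_mul, norm_smul, Real.norm_of_nonneg h0]
    exact add_le_add (hf.bound_grad v) (key v _ (norm_nonneg _) (hg.bound_grad v))
  · rw [hf.fderiv_gradient_add_smul hg]
    refine (norm_add_le _ _).trans ?_
    rw [add_mul, norm_smul, Real.norm_of_nonneg h0]
    exact add_le_add (hf.bound_hess v) (key v _ (norm_nonneg _) (hg.bound_hess v))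

lemma decay_le_of_norm_sub_le {v w : Vel d} (h : ‖w - v‖ ≤ 1) :
    decay m w ≤ 3 ^ m * decay m v := by
  have h1 : ‖v‖ ≤ ‖w‖ + 1 := by
    have := norm_sub_norm_le v w
    rw [norm_sub_rev] at this
    linarith
  have h2 : 1 + ‖v‖ ^ 2 ≤ 3 * (1 + ‖w‖ ^ 2) := by
    nlinarith [sq_nonneg (‖w‖ - 1), norm_nonneg v, norm_nonneg w]
  unfold decay
  rw [← div_eq_mul_inv, inv_le_comm₀ (by positivity) (by positivity), inv_div,
    div_le_iff₀ (by positivity), ← mul_pow]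
  exact pow_le_pow_left₀ (by positivity) (by linarith) m

/-- A nonnegative function with bounded second derivatives controls the square of its gradient. -/
theorem HasDecay.norm_gradient_sq_le (hf : HasDecay m C f) (h0 : ∀ v, 0 ≤ f v) (v : Vel d) :
    ‖gradient f v‖ ^ 2 ≤ 4 * (3 ^ m * C * decay m v) * f v := by
  have hC := hf.nonneg
  have hdec := decay_pos m v
  set S := 3 ^ m * C * decay m v with hS
  have hS0 : 0 ≤ S := by positivity
  have hgS : ‖gradient f v‖ ≤ S := by
    refine (hf.bound_grad v).trans ?_
    rw [hS, mul_assoc]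
    exact le_mul_of_one_le_left (by positivity) (one_le_pow₀ (by norm_num))
  rcases hS0.eq_or_lt with hS1 | hS1
  · rw [← hS1] at hgS ⊢
    have := norm_nonneg (gradient f v)
    nlinarith
  -- the Taylor estimate at the point reached by a step of length `|∇f| / (2 S)` against the gradient
  set p := gradient f v with hp
  set y := v - (2 * S)⁻¹ • p with hy
  have hyv : y - v = -((2 * S)⁻¹ • p) := by rw [hy]; abel
  have hnorm : ‖y - v‖ = (2 * S)⁻¹ * ‖p‖ := by
    rw [hyv, norm_neg, norm_smul, Real.norm_of_nonneg (by positivity)]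
  have hle1 : ‖y - v‖ ≤ 1 := by
    rw [hnorm]
    calc _ ≤ (2 * S)⁻¹ * S := by gcongr
      _ ≤ 1 := by rw [mul_inv, mul_assoc, inv_mul_cancel₀ hS1.ne']; norm_num
  have hgrad : ∀ w ∈ Metric.closedBall v ‖y - v‖, ‖fderiv ℝ f w - innerSL ℝ p‖ ≤ S * ‖y - v‖ := by
    intro w hw
    have hwv : ‖w - v‖ ≤ ‖y - v‖ := by rwa [← dist_eq_norm]
    have e : fderiv ℝ f w = innerSL ℝ (gradient f w) := by
      ext x; exact (hf.hasGradientAt w).fderiv_apply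
    rw [e, ← map_sub, innerSL_apply_norm]
    have hconv : Convex ℝ (Metric.closedBall v ‖y - v‖) := convex_closedBall _ _
    refine (hconv.norm_image_sub_le_of_norm_fderiv_le (C := S)
      (fun x _ => (hf.hasFDerivAt_gradient x).differentiableAt) (fun x hx => ?_)
      (Metric.mem_closedBall_self (norm_nonneg _)) hw).trans (by gcongr)
    have hxv : ‖x - v‖ ≤ 1 := by
      rw [← dist_eq_norm]; exact (Metric.mem_closedBall.mp hx).trans hle1
    calc _ ≤ C * decay m x := hf.bound_hess x
      _ ≤ C * (3 ^ m * decay m v) := by gcongr; exact decay_le_of_norm_sub_le hxv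
      _ = S := by rw [hS]; ring
  have ht := (convex_closedBall v ‖y - v‖).norm_image_sub_le_of_norm_fderiv_le'
    (fun x _ => hf.smooth.differentiable (by simp) x) hgrad
    (Metric.mem_closedBall_self (norm_nonneg _)) (y := y)
    (by rw [Metric.mem_closedBall, dist_eq_norm])
  have hin : innerSL ℝ p (y - v) = -((2 * S)⁻¹ * ‖p‖ ^ 2) := by
    rw [innerSL_apply_apply, hyv, inner_neg_right, inner_smul_right, real_inner_self_eq_norm_sq]
  rw [hin, hnorm, Real.norm_eq_abs] at ht
  have h1 := (abs_le.mp ht).2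
  have h2 := h0 y
  have h3 : (2 * S)⁻¹ * ‖p‖ ^ 2 - S * ((2 * S)⁻¹ * ‖p‖) * ((2 * S)⁻¹ * ‖p‖) ≤ f v := by linarith
  have h4 : (2 * S)⁻¹ * ‖p‖ ^ 2 - S * ((2 * S)⁻¹ * ‖p‖) * ((2 * S)⁻¹ * ‖p‖)
      = ‖p‖ ^ 2 / (4 * S) := by field_simp; ring
  rw [h4, div_le_iff₀ (by positivity)] at h3
  linarith

lemma score_eq (hf : ContDiff ℝ ∞ f) (hpos : ∀ v, 0 < f v) (v : Vel d) :
    score f v = (f v)⁻¹ • gradient f v := by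
  refine HasGradientAt.gradient ?_
  rw [hasGradientAt_iff_hasFDerivAt, map_smul]
  exact ((hf.differentiable (by simp) v).hasGradientAt.hasFDerivAt).log (hpos v).ne'

lemma hasFDerivAt_score (hf : HasDecay m C f) (hpos : ∀ v, 0 < f v) (v : Vel d) :
    HasFDerivAt (score f) ((f v)⁻¹ • fderiv ℝ (gradient f) v
      - (((f v)⁻¹) ^ 2 • innerSL ℝ (gradient f v)).smulRight (gradient f v)) v := by
  rw [funext (score_eq hf.smooth hpos)]
  have h1 : HasFDerivAt (fun v => (f v)⁻¹) (-(((f v)⁻¹) ^ 2 • innerSL ℝ (gradient f v))) v := by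
    refine ((hasDerivAt_inv (hpos v).ne').comp_hasFDerivAt v
      (hf.hasGradientAt v).hasFDerivAt).congr_fderiv ?_
    ext x
    simp
  refine (h1.smul (hf.hasFDerivAt_gradient v)).congr_fderiv ?_
  ext1 x
  simp [sub_eq_add_neg]

/-- The first variation of Fisher's information in terms of `f`. -/
lemma fisherVariation_eq (hf : HasDecay m C f) (hpos : ∀ v, 0 < f v) (v : Vel d) :
    fisherVariation f v = -(2 * ((f v)⁻¹
        * ∑ i, fderiv ℝ (gradient f) v (EuclideanSpace.single i 1) i))
      + ((f v)⁻¹) ^ 2 * ‖gradient f v‖ ^ 2 := by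
  have h1 : ∀ i : Fin d, fderiv ℝ (score f) v (EuclideanSpace.single i 1) i
      = (f v)⁻¹ * fderiv ℝ (gradient f) v (EuclideanSpace.single i 1) i
        - ((f v)⁻¹) ^ 2 * (gradient f v i * gradient f v i) := by
    intro i
    rw [(hasFDerivAt_score hf hpos v).fderiv]
    generalize gradient f v = p
    simp [EuclideanSpace.inner_single_right, mul_assoc]
  have h2 : ∑ i, gradient f v i * gradient f v i = ‖gradient f v‖ ^ 2 := by
    rw [EuclideanSpace.norm_sq_eq]
    exact Finset.sum_congr rfl fun i _ => by rw [Real.norm_eq_abs, sq_abs, sq]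
  rw [fisherVariation]
  simp only [h1, Finset.sum_sub_distrib, ← Finset.mul_sum]
  rw [h2, score_eq hf.smooth hpos, norm_smul, mul_pow, Real.norm_eq_abs, sq_abs]
  ring

theorem HasDecay.isTame (hf : HasDecay m C f) {ε : ℝ} (hε : 0 < ε)
    (h : ∀ v, ε * decay m v ≤ f v) : IsTame m C (C / ε + (C / ε) ^ 2) f := by
  have hC := hf.nonneg
  have hpos : ∀ v, 0 < f v := fun v => (mul_pos hε (decay_pos m v)).trans_le (h v)
  have hinv : ∀ v x, x ≤ C * decay m v → (f v)⁻¹ * x ≤ C / ε := by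
    intro v x hx
    rw [inv_mul_le_iff₀ (hpos v)]
    calc x ≤ C * decay m v := hx
      _ = (ε * decay m v) * (C / ε) := by field_simp
      _ ≤ _ := by gcongr; exact h v
  have hs : ∀ v, ‖(f v)⁻¹ • gradient f v‖ ≤ C / ε := fun v => by
    rw [norm_smul, Real.norm_of_nonneg (inv_nonneg.mpr (hpos v).le)]
    exact hinv v _ (hf.bound_grad v)
  have hCε : 0 ≤ C / ε := by positivity
  refine ⟨hf, hpos, fun v => ?_, fun v => ?_⟩
  · rw [score_eq hf.smooth hpos]
    nlinarith [hs v, sq_nonneg (C / ε)]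
  · rw [(hasFDerivAt_score hf hpos v).fderiv]
    refine (norm_sub_le _ _).trans (add_le_add ?_ ?_)
    · rw [norm_smul, Real.norm_of_nonneg (inv_nonneg.mpr (hpos v).le)]
      exact hinv v _ (hf.bound_hess v)
    · rw [ContinuousLinearMap.norm_smulRight_apply, norm_smul, innerSL_apply_norm, norm_pow]
      calc _ = (‖(f v)⁻¹‖ * ‖gradient f v‖) ^ 2 := by ring
        _ ≤ _ := by
          rw [← norm_smul]
          exact pow_le_pow_left₀ (norm_nonneg _) (hs v) 2

end Regularisation

/-! ### Convexity of Fisher's information -/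

section Convexity

variable {d m : ℕ} {C C' L L' A : ℝ} {p q u : Vel d → ℝ}

/-- Fisher's information as a real integral. -/
def fisherIntegral {d : ℕ} (f : Vel d → ℝ) : ℝ := ∫ v, ‖gradient f v‖ ^ 2 / f v

lemma integrable_of_abs_le_decay (hm : d < 2 * m) {φ : Vel d → ℝ} (hφ : Measurable φ)
    (h : ∀ v, |φ v| ≤ A * decay m v) : Integrable φ :=
  ((integrable_decay hm).const_mul A).mono' hφ.aestronglyMeasurable (ae_of_all _ h)

/-- Integration by parts against the score; there is no boundary term since `u` decays. -/
lemma IsTame.integral_inner_score_gradient (hm : d < 2 * m) (hp : IsTame m C L p)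
    (hu : ContDiff ℝ ∞ u) (h0 : ∀ v, |u v| ≤ A * decay m v)
    (h1 : ∀ v, ‖gradient u v‖ ≤ A * decay m v) :
    Integrable (fun v => inner ℝ (score p v) (gradient u v)) ∧
    Integrable (fun v => (∑ i, fderiv ℝ (score p) v (EuclideanSpace.single i 1) i) * u v) ∧
    ∫ v, inner ℝ (score p v) (gradient u v)
      = -∫ v, (∑ i, fderiv ℝ (score p) v (EuclideanSpace.single i 1) i) * u v := by
  have hL := hp.nonneg_L
  have hs := hp.contDiff_score
  have hcs := hs.continuous
  have hcs' := hp.continuous_fderiv_score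
  have hcu := hu.continuous
  have hcu' := (contDiff_gradient hu).continuous
  have e1 : ∀ i v, fderiv ℝ (fun v => score p v i) v (EuclideanSpace.single i 1)
      = fderiv ℝ (score p) v (EuclideanSpace.single i 1) i := by
    intro i v
    have h := ((EuclideanSpace.proj i : Vel d →L[ℝ] ℝ).hasFDerivAt).comp v
      (hs.differentiable (by simp) v).hasFDerivAt
    have h' : HasFDerivAt (fun v => score p v i) _ v := h
    rw [h'.fderiv]
    rfl
  have e2 : ∀ i v, fderiv ℝ u v (EuclideanSpace.single i 1) = gradient u v i := by
    intro i v
    rw [(hu.differentiable (by simp) v).hasGradientAt.fderiv_apply]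
    generalize gradient u v = w
    simp [EuclideanSpace.inner_single_right]
  have b1 : ∀ i v, |score p v i| ≤ L := fun i v =>
    (PiLp.norm_apply_le (score p v) i).trans (hp.bound_score v)
  have b2 : ∀ i v, |gradient u v i| ≤ A * decay m v := fun i v =>
    (PiLp.norm_apply_le (gradient u v) i).trans (h1 v)
  have b3 : ∀ i v, |fderiv ℝ (score p) v (EuclideanSpace.single i 1) i| ≤ L := fun i v => by
    refine (PiLp.norm_apply_le (fderiv ℝ (score p) v (EuclideanSpace.single i 1)) i).trans ?_
    refine (ContinuousLinearMap.le_opNorm _ _).trans ?_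
    simpa using hp.bound_hess_log v
  have i1 : ∀ i, Integrable fun v => score p v i * gradient u v i := fun i =>
    integrable_of_abs_le_decay (A := L * A) hm (by fun_prop) fun v => by
      rw [mul_assoc]; exact abs_mul_le_mul (b1 i v) (b2 i v)
  have i2 : ∀ i, Integrable fun v =>
      fderiv ℝ (score p) v (EuclideanSpace.single i 1) i * u v := fun i =>
    integrable_of_abs_le_decay (A := L * A) hm (by fun_prop) fun v => by
      rw [mul_assoc]; exact abs_mul_le_mul (b3 i v) (h0 v)
  have i3 : ∀ i, Integrable fun v => score p v i * u v := fun i =>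
    integrable_of_abs_le_decay (A := L * A) hm (by fun_prop) fun v => by
      rw [mul_assoc]; exact abs_mul_le_mul (b1 i v) (h0 v)
  have hin : ∀ v, inner ℝ (score p v) (gradient u v) = ∑ i, score p v i * gradient u v i := by
    intro v
    rw [PiLp.inner_apply]
    exact Finset.sum_congr rfl fun i _ => by simp [mul_comm]
  simp only [hin, Finset.sum_mul]
  refine ⟨integrable_finsetSum _ fun i _ => i1 i, integrable_finsetSum _ fun i _ => i2 i, ?_⟩
  rw [integral_finsetSum _ fun i _ => i1 i, integral_finsetSum _ fun i _ => i2 i,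
    ← Finset.sum_neg_distrib]
  refine Finset.sum_congr rfl fun i _ => ?_
  have h := integral_mul_fderiv_eq_neg_fderiv_mul_of_integrable (μ := volume)
    (f := fun v => score p v i) (g := u) (v := EuclideanSpace.single i (1 : ℝ))
    (by simpa only [e1] using i2 i) (by simpa only [e2] using i1 i) (i3 i)
    (fun v _ => (EuclideanSpace.proj i : Vel d →L[ℝ] ℝ).differentiableAt.comp v
      (hs.differentiable (by simp) v)) (fun v _ => hu.differentiable (by simp) v)
  simpa only [e1, e2] using h

lemma IsTame.gradient_sq_div (hp : IsTame m C L p) (v : Vel d) :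
    ‖gradient p v‖ ^ 2 / p v = p v * ‖score p v‖ ^ 2 := by
  have := (hp.pos v).ne'
  rw [hp.gradient_eq, norm_smul, mul_pow, Real.norm_eq_abs, sq_abs]
  field_simp

lemma IsTame.integrable_gradient_sq_div (hm : d < 2 * m) (hp : IsTame m C L p) :
    Integrable fun v => ‖gradient p v‖ ^ 2 / p v := by
  simp only [hp.gradient_sq_div]
  have hL := hp.nonneg_L
  have h1 := hp.contDiff_score.continuous
  have h2 := hp.smooth.continuous
  refine integrable_of_abs_le_decay (A := L ^ 2 * C) hm (by fun_prop) fun v => ?_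
  rw [mul_comm, mul_assoc]
  refine abs_mul_le_mul ?_ (hp.bound v)
  rw [abs_of_nonneg (by positivity)]
  exact pow_le_pow_left₀ (norm_nonneg _) (hp.bound_score v) 2

/-- Fisher's information is convex: it lies above its tangent at `p`. -/
theorem IsTame.fisherIntegral_sub_le (hm : d < 2 * m) (hp : IsTame m C L p)
    (hq : IsTame m C' L' q) :
    fisherIntegral p - fisherIntegral q ≤ ∫ v, (p v - q v) * fisherVariation p v := by
  have hL := hp.nonneg_L
  set u : Vel d → ℝ := fun v => p v - q v with hu
  have hus : ContDiff ℝ ∞ u := hp.smooth.sub hq.smooth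
  have hgu : ∀ v, gradient u v = gradient p v - gradient q v := fun v => by
    refine HasGradientAt.gradient ?_
    rw [hasGradientAt_iff_hasFDerivAt, map_sub]
    exact (hp.hasGradientAt v).hasFDerivAt.sub (hq.hasGradientAt v).hasFDerivAt
  have h0 : ∀ v, |u v| ≤ (C + C') * decay m v := fun v => by
    rw [add_mul]
    exact (abs_sub _ _).trans (add_le_add (hp.bound v) (hq.bound v))
  have h1 : ∀ v, ‖gradient u v‖ ≤ (C + C') * decay m v := fun v => by
    rw [add_mul, hgu]
    exact (norm_sub_le _ _).trans (add_le_add (hp.bound_grad v) (hq.bound_grad v))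
  obtain ⟨i1, i2, e⟩ := hp.integral_inner_score_gradient hm hus h0 h1
  have i3 : Integrable fun v => ‖score p v‖ ^ 2 * u v := by
    have c1 := hp.contDiff_score.continuous
    have c2 := hus.continuous
    refine integrable_of_abs_le_decay (A := L ^ 2 * (C + C')) hm (by fun_prop) fun v => ?_
    rw [mul_assoc]
    refine abs_mul_le_mul ?_ (h0 v)
    rw [abs_of_nonneg (by positivity)]
    exact pow_le_pow_left₀ (norm_nonneg _) (hp.bound_score v) 2
  have i1' : Integrable fun v => 2 * inner ℝ (score p v) (gradient u v) := i1.const_mul 2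
  have i2' : Integrable fun v =>
      -2 * ((∑ i, fderiv ℝ (score p) v (EuclideanSpace.single i 1) i) * u v) := i2.const_mul (-2)
  have hvar : ∀ v, (p v - q v) * fisherVariation p v
      = -2 * ((∑ i, fderiv ℝ (score p) v (EuclideanSpace.single i 1) i) * u v)
        - ‖score p v‖ ^ 2 * u v := fun v => by
    rw [fisherVariation]; ring
  have hint : ∫ v, (p v - q v) * fisherVariation p v
      = ∫ v, (2 * inner ℝ (score p v) (gradient u v) - ‖score p v‖ ^ 2 * u v) := by
    rw [integral_sub i1' i3, integral_const_mul, e]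
    simp only [hvar]
    rw [integral_sub i2' i3, integral_const_mul]
    ring
  rw [hint, fisherIntegral, fisherIntegral,
    ← integral_sub (hp.integrable_gradient_sq_div hm) (hq.integrable_gradient_sq_div hm)]
  refine integral_mono ((hp.integrable_gradient_sq_div hm).sub (hq.integrable_gradient_sq_div hm))
    (i1'.sub i3) fun v => ?_
  -- the difference of the two sides is `|∇q - q ∇ log p|² / q`
  have hqv := hq.pos v
  have key : 0 ≤ ‖gradient q v - q v • score p v‖ ^ 2 / q v := by positivity
  rw [norm_sub_sq_real, inner_smul_right, norm_smul, Real.norm_of_nonneg hqv.le] at key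
  have e3 : (‖gradient q v‖ ^ 2 - 2 * (q v * inner ℝ (gradient q v) (score p v))
      + (q v * ‖score p v‖) ^ 2) / q v = ‖gradient q v‖ ^ 2 / q v
      - 2 * inner ℝ (gradient q v) (score p v) + q v * ‖score p v‖ ^ 2 := by
    field_simp
  rw [e3] at key
  simp only [hp.gradient_sq_div, hgu]
  rw [hp.gradient_eq, inner_sub_right, inner_smul_right, real_inner_self_eq_norm_sq,
    real_inner_comm, hu]
  linarith

end Convexity

/-! ### Removing the regularisation -/

section Limit

variable {d m : ℕ} {C : ℝ} {f : Vel d → ℝ}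

/-- `f + ε (1 + |v|²)⁻ᵐ`, which is tame when `f ≥ 0` and its derivatives decay. -/
def regularise {d : ℕ} (m : ℕ) (ε : ℝ) (f : Vel d → ℝ) (v : Vel d) : ℝ := f v + ε * decay m v

/-- The constant in the bounds for `regularise m ε f`, uniformly in `ε ≤ 1`. -/
def regConst (m : ℕ) (C : ℝ) : ℝ := C + (1 + 2 * m + 4 * m * (m + 1))

lemma HasDecay.regularise (hf : HasDecay m C f) {ε : ℝ} (h0 : 0 ≤ ε) (h1 : ε ≤ 1) :
    HasDecay m (regConst m C) (regularise m ε f) :=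
  hf.add_smul (hasDecay_decay d m) h0 h1

lemma le_regularise (h0 : ∀ v, 0 ≤ f v) (ε : ℝ) (v : Vel d) :
    ε * decay m v ≤ regularise m ε f v :=
  le_add_of_nonneg_left (h0 v)

lemma regularise_pos (h0 : ∀ v, 0 ≤ f v) {ε : ℝ} (hε : 0 < ε) (v : Vel d) :
    0 < regularise m ε f v :=
  (mul_pos hε (decay_pos m v)).trans_le (le_regularise h0 ε v)

lemma HasDecay.isTame_regularise (hf : HasDecay m C f) (h0 : ∀ v, 0 ≤ f v) {ε : ℝ} (hε : 0 < ε)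
    (h1 : ε ≤ 1) : IsTame m (regConst m C)
      (regConst m C / ε + (regConst m C / ε) ^ 2) (BoltzmannFisher.regularise m ε f) :=
  (hf.regularise hε.le h1).isTame hε (le_regularise h0 ε)

lemma HasDecay.gradient_eq_zero (hf : HasDecay m C f) (h0 : ∀ v, 0 ≤ f v) {v : Vel d}
    (hv : f v = 0) : gradient f v = 0 := by
  have h := hf.norm_gradient_sq_le h0 v
  rw [hv, mul_zero] at h
  exact norm_eq_zero.mp (pow_eq_zero_iff two_ne_zero |>.mp (le_antisymm h (sq_nonneg _)))

/-- The Hessian vanishes at the density points of the zero set, where the gradient is `0`. -/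
lemma HasDecay.ae_hess_eq_zero (hf : HasDecay m C f) (h0 : ∀ v, 0 ≤ f v) :
    ∀ᵐ v, f v = 0 → fderiv ℝ (gradient f) v = 0 := by
  have hs : MeasurableSet {v | f v = 0} :=
    hf.smooth.continuous.measurable (measurableSet_singleton 0)
  have hap : ApproximatesLinearOn (gradient f) (0 : Vel d →L[ℝ] Vel d) {v | f v = 0} 0 := by
    intro x hx y hy
    rw [hf.gradient_eq_zero h0 hx, hf.gradient_eq_zero h0 hy]
    simp
  have h := hap.norm_fderiv_sub_le volume hs (fderiv ℝ (gradient f))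
    fun x _ => (hf.hasFDerivAt_gradient x).hasFDerivWithinAt
  rw [ae_restrict_iff' hs] at h
  filter_upwards [h] with v hv hv0
  simpa using hv hv0

lemma abs_sum_apply_single_le (T : Vel d →L[ℝ] Vel d) :
    |∑ i, T (EuclideanSpace.single i 1) i| ≤ d * ‖T‖ := by
  refine (Finset.abs_sum_le_sum_abs _ _).trans ?_
  have h1 : ∀ i : Fin d, |T (EuclideanSpace.single i 1) i| ≤ ‖T‖ := by
    intro i
    refine (PiLp.norm_apply_le (T (EuclideanSpace.single i 1)) i).trans ?_
    simpa using T.le_opNorm (EuclideanSpace.single i 1)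
  exact (Finset.sum_le_sum fun i _ => h1 i).trans (by simp)

lemma HasDecay.abs_mul_fisherVariation_le (hf : HasDecay m C f) (h0 : ∀ v, 0 ≤ f v) {ε : ℝ}
    (hε : 0 < ε) (h1 : ε ≤ 1) (v : Vel d) :
    |ε * fisherVariation (BoltzmannFisher.regularise m ε f) v|
      ≤ 2 * d * regConst m C + 4 * 3 ^ m * regConst m C := by
  set F := BoltzmannFisher.regularise m ε f with hF
  set D := regConst m C
  have hFd := hf.regularise hε.le h1
  have hpos : ∀ v, 0 < F v := regularise_pos h0 hε
  have hlow := le_regularise (m := m) h0 ε v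
  have hD := hFd.nonneg
  have hg := hFd.norm_gradient_sq_le (fun v => (hpos v).le) v
  have ht := (abs_sum_apply_single_le (fderiv ℝ (gradient F) v)).trans
    (mul_le_mul_of_nonneg_left (hFd.bound_hess v) (Nat.cast_nonneg d))
  have hFv := hpos v
  have hdec := decay_pos m v
  have hq : ε * decay m v * (F v)⁻¹ ≤ 1 := by
    rw [← div_eq_mul_inv, div_le_one hFv]
    exact hlow
  rw [fisherVariation_eq hFd hpos v, mul_add]
  refine (abs_add_le _ _).trans (add_le_add ?_ ?_)
  · rw [abs_mul, abs_neg, abs_mul, abs_mul, abs_of_pos hε, abs_two, abs_inv, abs_of_pos hFv]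
    calc _ ≤ ε * (2 * ((F v)⁻¹ * (d * (D * decay m v)))) := by gcongr
      _ = 2 * d * D * (ε * decay m v * (F v)⁻¹) := by ring
      _ ≤ 2 * d * D * 1 := by gcongr
      _ = _ := mul_one _
  · rw [abs_of_nonneg (by positivity)]
    calc _ ≤ ε * (((F v)⁻¹) ^ 2 * (4 * (3 ^ m * D * decay m v) * F v)) := by gcongr
      _ = 4 * 3 ^ m * D * (ε * decay m v * (F v)⁻¹) := by field_simp
      _ ≤ 4 * 3 ^ m * D * 1 := by gcongr
      _ = _ := mul_one _

lemma eventually_mem_Ioc : ∀ᶠ ε : ℝ in nhdsWithin 0 (Ioi 0), 0 < ε ∧ ε ≤ 1 :=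
  Ioc_mem_nhdsGT zero_lt_one

/-- Where `f > 0` the variation stays bounded as `ε → 0`; where `f`, `∇f` and the Hessian vanish it
does not depend on `ε`. -/
lemma HasDecay.tendsto_mul_fisherVariation (hf : HasDecay m C f) (h0 : ∀ v, 0 ≤ f v) :
    ∀ᵐ v, Filter.Tendsto (fun ε => ε * fisherVariation (BoltzmannFisher.regularise m ε f) v)
      (nhdsWithin 0 (Ioi 0)) (nhds 0) := by
  filter_upwards [hf.ae_hess_eq_zero h0] with v hv
  have hg := hasDecay_decay d m
  set H := fderiv ℝ (gradient f) v with hH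
  set G := fderiv ℝ (gradient (decay m : Vel d → ℝ)) v
  set p := gradient f v with hp
  set q := gradient (decay m : Vel d → ℝ) v
  have hdec := decay_pos m v
  have e : ∀ᶠ ε : ℝ in nhdsWithin 0 (Ioi 0),
      ε * fisherVariation (BoltzmannFisher.regularise m ε f) v
      = ε * (-(2 * ((f v + ε * decay m v)⁻¹
        * ∑ i, (H (EuclideanSpace.single i 1) i + ε * G (EuclideanSpace.single i 1) i)))
      + ((f v + ε * decay m v)⁻¹) ^ 2 * ‖p + ε • q‖ ^ 2) := by
    filter_upwards [eventually_mem_Ioc] with ε hε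
    rw [fisherVariation_eq (hf.regularise hε.1.le hε.2) (regularise_pos h0 hε.1)]
    have e1 : gradient (BoltzmannFisher.regularise m ε f) v = p + ε • q :=
      hf.gradient_add_smul hg ε v
    have e2 : fderiv ℝ (gradient (BoltzmannFisher.regularise m ε f)) v = H + ε • G :=
      hf.fderiv_gradient_add_smul hg ε v
    rw [e1, e2]
    rfl
  refine Filter.Tendsto.congr' (e.mono fun _ h => h.symm) ?_
  rcases (h0 v).eq_or_lt with hfv | hfv
  · have hH0 := hv hfv.symm
    have hp0 : p = 0 := hf.gradient_eq_zero h0 hfv.symm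
    have hc : Filter.Tendsto (fun ε : ℝ => ε * (-(2 * ((decay m v)⁻¹
        * ∑ i, G (EuclideanSpace.single i 1) i)) + ((decay m v)⁻¹) ^ 2 * ‖q‖ ^ 2))
        (nhdsWithin 0 (Ioi 0)) (nhds 0) := by
      refine Filter.Tendsto.mono_left ?_ nhdsWithin_le_nhds
      refine (Continuous.tendsto (by fun_prop) 0).trans_eq ?_
      simp
    refine hc.congr' ?_
    filter_upwards [self_mem_nhdsWithin] with ε hε
    have hε' : (ε : ℝ) ≠ 0 := (mem_Ioi.mp hε).ne'
    rw [hH0, hp0, ← hfv]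
    simp only [zero_add, zero_apply, PiLp.zero_apply, norm_smul,
      ← Finset.mul_sum, mul_pow, Real.norm_eq_abs, sq_abs]
    field_simp
  · refine Filter.Tendsto.mono_left ?_ nhdsWithin_le_nhds
    have hc : ContinuousAt (fun ε : ℝ => (f v + ε * decay m v)⁻¹) 0 :=
      ContinuousAt.inv₀ (by fun_prop) (by simpa using hfv.ne')
    refine (ContinuousAt.tendsto (x := (0 : ℝ)) (by fun_prop)).trans_eq ?_
    simp

lemma HasDecay.gradient_sq_div_le (hf : HasDecay m C f) (h0 : ∀ v, 0 ≤ f v) (v : Vel d) :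
    ‖gradient f v‖ ^ 2 / f v ≤ 4 * 3 ^ m * C * decay m v := by
  have hC := hf.nonneg
  have hdec := decay_pos m v
  rcases (h0 v).eq_or_lt with hv | hv
  · rw [← hv, div_zero]
    positivity
  · rw [div_le_iff₀ hv]
    exact (hf.norm_gradient_sq_le h0 v).trans_eq (by ring)

lemma HasDecay.measurable_gradient_sq_div (hf : HasDecay m C f) :
    Measurable fun v => ‖gradient f v‖ ^ 2 / f v := by
  have h1 := (contDiff_gradient hf.smooth).continuous.measurable
  have h2 := hf.smooth.continuous.measurable
  fun_prop

lemma HasDecay.fisherInformation_eq (hm : d < 2 * m) (hf : HasDecay m C f) (h0 : ∀ v, 0 ≤ f v) :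
    fisherInformation f = ENNReal.ofReal (fisherIntegral f) := by
  refine (ofReal_integral_eq_lintegral_ofReal ?_ (ae_of_all _ fun v => ?_)).symm
  · refine integrable_of_abs_le_decay (A := 4 * 3 ^ m * C) hm hf.measurable_gradient_sq_div
      fun v => ?_
    rw [abs_of_nonneg (div_nonneg (sq_nonneg _) (h0 v))]
    exact hf.gradient_sq_div_le h0 v
  · exact div_nonneg (sq_nonneg _) (h0 v)

theorem HasDecay.tendsto_fisherIntegral_regularise (hm : d < 2 * m) (hf : HasDecay m C f)
    (h0 : ∀ v, 0 ≤ f v) :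
    Filter.Tendsto (fun ε => fisherIntegral (BoltzmannFisher.regularise m ε f))
      (nhdsWithin 0 (Ioi 0)) (nhds (fisherIntegral f)) := by
  refine tendsto_integral_filter_of_dominated_convergence
    (fun v => 4 * 3 ^ m * regConst m C * decay m v) ?_ ?_ ((integrable_decay hm).const_mul _) ?_
  · filter_upwards [eventually_mem_Ioc] with ε hε
    exact (hf.regularise hε.1.le hε.2).measurable_gradient_sq_div.aestronglyMeasurable
  · filter_upwards [eventually_mem_Ioc] with ε hε
    refine ae_of_all _ fun v => ?_
    have hp := fun v => (regularise_pos (m := m) h0 hε.1 v).le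
    rw [Real.norm_of_nonneg (div_nonneg (sq_nonneg _) (hp v))]
    exact (hf.regularise hε.1.le hε.2).gradient_sq_div_le hp v
  · refine ae_of_all _ fun v => ?_
    have hdec := decay_pos m v
    have e : ∀ ε, ‖gradient (BoltzmannFisher.regularise m ε f) v‖ ^ 2
        / BoltzmannFisher.regularise m ε f v = ‖gradient f v + ε • gradient (decay m) v‖ ^ 2
          / (f v + ε * decay m v) := fun ε => by
      rw [← hf.gradient_add_smul (hasDecay_decay d m)]
      rfl
    simp only [e]
    rcases (h0 v).eq_or_lt with hfv | hfv
    · have hc : Filter.Tendsto (fun ε : ℝ => ε * (‖gradient (decay m) v‖ ^ 2 / decay m v))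
          (nhdsWithin 0 (Ioi 0)) (nhds (‖gradient f v‖ ^ 2 / f v)) := by
        refine Filter.Tendsto.mono_left ?_ nhdsWithin_le_nhds
        refine (Continuous.tendsto (by fun_prop) 0).trans_eq ?_
        simp [← hfv]
      refine hc.congr' ?_
      filter_upwards [self_mem_nhdsWithin] with ε hε
      have hε' : (ε : ℝ) ≠ 0 := (mem_Ioi.mp hε).ne'
      rw [hf.gradient_eq_zero h0 hfv.symm, ← hfv, zero_add, zero_add, norm_smul, mul_pow,
        Real.norm_eq_abs, sq_abs]
      field_simp
    · refine Filter.Tendsto.mono_left ?_ nhdsWithin_le_nhds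
      have hc : ContinuousAt (fun ε : ℝ => (f v + ε * decay m v)⁻¹) 0 :=
        ContinuousAt.inv₀ (by fun_prop) (by simpa using hfv.ne')
      simp only [div_eq_mul_inv]
      refine (ContinuousAt.tendsto (x := (0 : ℝ)) (by fun_prop)).trans_eq ?_
      simp

end Limit

/-! ### Evolution of the regularised Fisher information -/

section Evolution

variable {d m n : ℕ} {C A a b ε : ℝ} {Q : (Vel d → ℝ) → Vel d → ℝ} {f : ℝ → Vel d → ℝ}

/-- A path `f` of nonnegative functions on `[a, b]` with `∂f/∂t = Q(f)`, where `Q` dissipates the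
Fisher information of the regularisations of `f t`; all bounds are uniform in time. -/
structure IsDissipativePath {d : ℕ} (Q : (Vel d → ℝ) → Vel d → ℝ) (a b : ℝ) (m n : ℕ) (C A : ℝ)
    (f : ℝ → Vel d → ℝ) : Prop where
  hasDecay : ∀ t ∈ Icc a b, HasDecay m C (f t)
  nonneg : ∀ t ∈ Icc a b, ∀ v, 0 ≤ f t v
  hasDerivWithinAt : ∀ t ∈ Icc a b, ∀ v,
    HasDerivWithinAt (fun s => f s v) (Q (f t) v) (Icc a b) t
  measurable : ∀ g : Vel d → ℝ, ContDiff ℝ ∞ g → Measurable (Q g)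
  bound : ∀ t ∈ Icc a b, ∀ v, |Q (f t) v| ≤ A * decay n v
  bound_sub : ∀ t ∈ Icc a b, ∀ ε, 0 < ε → ε ≤ 1 → ∀ v,
    |Q (f t) v - Q (regularise m ε (f t)) v| ≤ ε * (A * decay n v)
  dissipation : ∀ t ∈ Icc a b, ∀ ε, 0 < ε → ε ≤ 1 →
    ∫ v, Q (regularise m ε (f t)) v * fisherVariation (regularise m ε (f t)) v ≤ 0

namespace IsDissipativePath

lemma isTame (h : IsDissipativePath Q a b m n C A f) {t : ℝ} (ht : t ∈ Icc a b) (h0 : 0 < ε)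
    (h1 : ε ≤ 1) : IsTame m (regConst m C)
      (regConst m C / ε + (regConst m C / ε) ^ 2) (regularise m ε (f t)) :=
  (h.hasDecay t ht).isTame_regularise (h.nonneg t ht) h0 h1

lemma nonneg_A (h : IsDissipativePath Q a b m n C A f) {t : ℝ} (ht : t ∈ Icc a b) : 0 ≤ A :=
  nonneg_of_mul_nonneg_left ((abs_nonneg _).trans (h.bound t ht 0)) (decay_pos n 0)

lemma abs_sub_le (h : IsDissipativePath Q a b m n C A f) {s t : ℝ} (hs : s ∈ Icc a b)
    (ht : t ∈ Icc a b) (v : Vel d) : |f t v - f s v| ≤ A * decay n v * |t - s| :=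
  (convex_Icc a b).norm_image_sub_le_of_norm_hasDerivWithin_le
    (fun x hx => h.hasDerivWithinAt x hx v) (fun x hx => h.bound x hx v) hs ht

lemma fisherIntegral_sub_le (hm : d < 2 * m) (h : IsDissipativePath Q a b m n C A f) {s t : ℝ}
    (hs : s ∈ Icc a b) (ht : t ∈ Icc a b) (h0 : 0 < ε) (h1 : ε ≤ 1) :
    fisherIntegral (regularise m ε (f t)) - fisherIntegral (regularise m ε (f s))
      ≤ ∫ v, (f t v - f s v) * fisherVariation (regularise m ε (f t)) v := by
  refine ((h.isTame ht h0 h1).fisherIntegral_sub_le hm (h.isTame hs h0 h1)).trans_eq ?_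
  simp only [regularise, add_sub_add_right_eq_sub]

lemma exists_lipschitzOnWith (hm : d < 2 * m) (hn : d < 2 * n)
    (h : IsDissipativePath Q a b m n C A f) (h0 : 0 < ε) (h1 : ε ≤ 1) :
    ∃ K, LipschitzOnWith K (fun t => fisherIntegral (regularise m ε (f t))) (Icc a b) := by
  set L := regConst m C / ε + (regConst m C / ε) ^ 2
  set M := 2 * (d * L) + L ^ 2
  set X := ∫ v : Vel d, A * decay n v * M with hX
  have key : ∀ s ∈ Icc a b, ∀ t ∈ Icc a b, fisherIntegral (regularise m ε (f t))
      - fisherIntegral (regularise m ε (f s)) ≤ X * |t - s| := by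
    intro s hs t ht
    refine (h.fisherIntegral_sub_le hm hs ht h0 h1).trans ((Real.le_norm_self _).trans ?_)
    rw [hX, ← integral_mul_const]
    refine norm_integral_le_of_norm_le
      ((((integrable_decay hn).const_mul A).mul_const M).mul_const _) (ae_of_all _ fun v => ?_)
    rw [norm_mul, mul_right_comm]
    exact mul_le_mul (h.abs_sub_le hs ht v) ((h.isTame ht h0 h1).abs_fisherVariation_le v)
      (norm_nonneg _) ((abs_nonneg _).trans (h.abs_sub_le hs ht v))
  refine ⟨X.toNNReal, LipschitzOnWith.of_dist_le_mul fun t ht s hs => ?_⟩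
  rw [Real.dist_eq, Real.dist_eq]
  refine (abs_le'.mpr ⟨key s hs t ht, ?_⟩).trans
    (mul_le_mul_of_nonneg_right (Real.le_coe_toNNReal X) (abs_nonneg _))
  rw [neg_sub, abs_sub_comm]
  exact key t ht s hs

/-- Since Fisher's information lies above its tangents, its left difference quotients are at most
the integral of the difference quotient of `f` against `fisherVariation`. -/
lemma deriv_fisherIntegral_le (hm : d < 2 * m) (hn : d < 2 * n)
    (h : IsDissipativePath Q a b m n C A f) (h0 : 0 < ε) (h1 : ε ≤ 1) {t : ℝ} (ht : t ∈ Ioo a b)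
    (hd : DifferentiableAt ℝ (fun t => fisherIntegral (regularise m ε (f t))) t) :
    deriv (fun t => fisherIntegral (regularise m ε (f t))) t
      ≤ ∫ v, Q (f t) v * fisherVariation (regularise m ε (f t)) v := by
  have ht' : t ∈ Icc a b := Ioo_subset_Icc_self ht
  have hT := h.isTame ht' h0 h1
  have hev : ∀ᶠ s in nhdsWithin t (Iio t), s ∈ Ioo a t := Ioo_mem_nhdsLT ht.1
  have hmem : ∀ s ∈ Ioo a t, s ∈ Icc a b := fun s hs => ⟨hs.1.le, (hs.2.trans ht.2).le⟩
  have hleft : nhdsWithin t (Iio t) ≤ nhdsWithin t {t}ᶜ :=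
    nhdsWithin_mono _ fun x hx => (mem_Iio.mp hx).ne
  set M := 2 * (d * (regConst m C / ε + (regConst m C / ε) ^ 2))
    + (regConst m C / ε + (regConst m C / ε) ^ 2) ^ 2
  have l1 := (hasDerivAt_iff_tendsto_slope.mp hd.hasDerivAt).mono_left hleft
  have l2 : Filter.Tendsto (fun s => ∫ v, slope (fun s => f s v) t s
      * fisherVariation (regularise m ε (f t)) v) (nhdsWithin t (Iio t))
      (nhds (∫ v, Q (f t) v * fisherVariation (regularise m ε (f t)) v)) := by
    refine tendsto_integral_filter_of_dominated_convergence (fun v => A * decay n v * M) ?_ ?_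
      (((integrable_decay hn).const_mul A).mul_const M) (ae_of_all _ fun v => ?_)
    · filter_upwards [hev] with s hs
      have c1 := (h.hasDecay s (hmem s hs)).smooth.continuous
      have c2 := (h.hasDecay t ht').smooth.continuous
      have c3 := hT.continuous_fisherVariation
      simp only [slope_def_field]
      exact (Continuous.mul ((c1.sub c2).div_const _) c3).aestronglyMeasurable
    · filter_upwards [hev] with s hs
      refine ae_of_all _ fun v => ?_
      have hst : 0 < |s - t| := abs_pos.mpr (sub_ne_zero.mpr hs.2.ne)
      rw [norm_mul, slope_def_field, norm_div, Real.norm_eq_abs, Real.norm_eq_abs]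
      refine mul_le_mul ?_ (hT.abs_fisherVariation_le v) (norm_nonneg _) ?_
      · rw [div_le_iff₀ hst]
        exact h.abs_sub_le ht' (hmem s hs) v
      · exact (abs_nonneg _).trans (h.bound t ht' v)
    · refine Filter.Tendsto.mul_const _ ?_
      exact (hasDerivAt_iff_tendsto_slope.mp ((h.hasDerivWithinAt t ht' v).hasDerivAt
        (Icc_mem_nhds ht.1 ht.2))).mono_left hleft
  refine le_of_tendsto_of_tendsto l1 l2 ?_
  filter_upwards [hev] with s hs
  have hts : 0 < t - s := sub_pos.mpr hs.2
  have e : ∀ x y : ℝ, (y - x) / (s - t) = (t - s)⁻¹ * (x - y) := fun x y => by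
    rw [← neg_sub t s, div_neg, div_eq_inv_mul]
    ring
  simp only [slope_def_field, e, mul_assoc]
  rw [integral_const_mul]
  exact mul_le_mul_of_nonneg_left (h.fisherIntegral_sub_le hm (hmem s hs) ht' h0 h1)
    (inv_nonneg.mpr hts.le)

/-- A bound for the defect of dissipation caused by the regularisation. -/
def defect {d : ℕ} (m n : ℕ) (A ε : ℝ) (f : Vel d → ℝ) : ℝ :=
  ∫ v, A * decay n v * |ε * fisherVariation (regularise m ε f) v|

/-- `Q` does not increase the information along `Q` of the regularised function, so that only the
difference of the two values of `Q` counts. -/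
lemma integral_mul_fisherVariation_le (hn : d < 2 * n) (h : IsDissipativePath Q a b m n C A f)
    (h0 : 0 < ε) (h1 : ε ≤ 1) {t : ℝ} (ht : t ∈ Icc a b) :
    ∫ v, Q (f t) v * fisherVariation (regularise m ε (f t)) v ≤ defect m n A ε (f t) := by
  have hT := h.isTame ht h0 h1
  have hA := h.nonneg_A ht
  have c := hT.continuous_fisherVariation.measurable
  have m1 := h.measurable _ (h.hasDecay t ht).smooth
  have m2 := h.measurable _ hT.smooth
  set M := 2 * (d * (regConst m C / ε + (regConst m C / ε) ^ 2))
    + (regConst m C / ε + (regConst m C / ε) ^ 2) ^ 2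
  have b1 : ∀ v, |Q (f t) v - Q (regularise m ε (f t)) v| ≤ A * decay n v := fun v =>
    (h.bound_sub t ht ε h0 h1 v).trans
      (mul_le_of_le_one_left (mul_nonneg hA (decay_pos n v).le) h1)
  have b2 : ∀ v, |Q (regularise m ε (f t)) v| ≤ 2 * A * decay n v := fun v => by
    have h2 := abs_sub_abs_le_abs_sub (Q (regularise m ε (f t)) v) (Q (f t) v)
    rw [abs_sub_comm] at h2
    linarith [b1 v, h.bound t ht v]
  have i1 : Integrable fun v => (Q (f t) v - Q (regularise m ε (f t)) v)
      * fisherVariation (regularise m ε (f t)) v :=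
    integrable_of_abs_le_decay (A := M * A) hn ((m1.sub m2).mul c) fun v => by
      rw [mul_comm, mul_assoc]
      exact abs_mul_le_mul (hT.abs_fisherVariation_le v) (b1 v)
  have i2 : Integrable fun v => Q (regularise m ε (f t)) v
      * fisherVariation (regularise m ε (f t)) v :=
    integrable_of_abs_le_decay (A := M * (2 * A)) hn (m2.mul c) fun v => by
      rw [mul_comm, mul_assoc]
      exact abs_mul_le_mul (hT.abs_fisherVariation_le v) (b2 v)
  have i3 : Integrable fun v =>
      A * decay n v * |ε * fisherVariation (regularise m ε (f t)) v| := by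
    have md := (continuous_decay (d := d) n).measurable
    refine integrable_of_abs_le_decay (A := ε * M * A) hn (by fun_prop) fun v => ?_
    rw [mul_comm (A * decay n v), mul_assoc]
    refine abs_mul_le_mul ?_ (abs_of_nonneg (mul_nonneg hA (decay_pos n v).le)).le
    rw [abs_abs, abs_mul, abs_of_pos h0]
    gcongr
    exact hT.abs_fisherVariation_le v
  calc ∫ v, Q (f t) v * fisherVariation (regularise m ε (f t)) v
      = ∫ v, ((Q (f t) v - Q (regularise m ε (f t)) v) * fisherVariation (regularise m ε (f t)) v
        + Q (regularise m ε (f t)) v * fisherVariation (regularise m ε (f t)) v) := by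
        congr 1 with v
        ring
    _ ≤ ∫ v, (Q (f t) v - Q (regularise m ε (f t)) v)
        * fisherVariation (regularise m ε (f t)) v := by
        rw [integral_add i1 i2]
        linarith [h.dissipation t ht ε h0 h1]
    _ ≤ _ := by
        refine integral_mono i1 i3 fun v => (le_abs_self _).trans ?_
        rw [abs_mul, abs_mul ε, abs_of_pos h0, ← mul_assoc]
        refine mul_le_mul_of_nonneg_right ?_ (abs_nonneg _)
        exact (h.bound_sub t ht ε h0 h1 v).trans_eq (mul_comm _ _)

lemma defect_le (hn : d < 2 * n) (h : IsDissipativePath Q a b m n C A f) (h0 : 0 < ε)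
    (h1 : ε ≤ 1) {t : ℝ} (ht : t ∈ Icc a b) : defect m n A ε (f t)
      ≤ ∫ v : Vel d, A * decay n v * (2 * d * regConst m C + 4 * 3 ^ m * regConst m C) := by
  have hA := h.nonneg_A ht
  refine integral_mono_of_nonneg (ae_of_all _ fun v => ?_)
    (((integrable_decay hn).const_mul A).mul_const _) (ae_of_all _ fun v => ?_)
  · have := decay_pos n v
    positivity
  · have := decay_pos n v
    dsimp only
    gcongr
    exact (h.hasDecay t ht).abs_mul_fisherVariation_le (h.nonneg t ht) h0 h1 v

lemma tendsto_defect (hn : d < 2 * n) (h : IsDissipativePath Q a b m n C A f) {t : ℝ}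
    (ht : t ∈ Icc a b) :
    Filter.Tendsto (fun ε => defect m n A ε (f t)) (nhdsWithin 0 (Ioi 0)) (nhds 0) := by
  have hA := h.nonneg_A ht
  have hf := h.hasDecay t ht
  have hlim : Filter.Tendsto (fun ε => defect m n A ε (f t)) (nhdsWithin 0 (Ioi 0))
      (nhds (∫ _ : Vel d, (0 : ℝ))) := by
    refine tendsto_integral_filter_of_dominated_convergence
      (fun v => A * decay n v * (2 * d * regConst m C + 4 * 3 ^ m * regConst m C)) ?_ ?_
      (((integrable_decay hn).const_mul A).mul_const _) ?_
    · filter_upwards [eventually_mem_Ioc] with ε hε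
      have c := (h.isTame ht hε.1 hε.2).continuous_fisherVariation
      have c' := continuous_decay (d := d) n
      exact Continuous.aestronglyMeasurable (by fun_prop)
    · filter_upwards [eventually_mem_Ioc] with ε hε
      refine ae_of_all _ fun v => ?_
      have := decay_pos n v
      rw [Real.norm_of_nonneg (by positivity)]
      gcongr
      exact hf.abs_mul_fisherVariation_le (h.nonneg t ht) hε.1 hε.2 v
    · filter_upwards [hf.tendsto_mul_fisherVariation (h.nonneg t ht)] with v hv
      simpa using hv.abs.const_mul (A * decay n v)
  simpa using hlim

theorem fisherIntegral_le (hm : d < 2 * m) (hn : d < 2 * n) (hab : a ≤ b)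
    (h : IsDissipativePath Q a b m n C A f) : fisherIntegral (f b) ≤ fisherIntegral (f a) := by
  have ha : a ∈ Icc a b := left_mem_Icc.mpr hab
  have hb : b ∈ Icc a b := right_mem_Icc.mpr hab
  have hA := h.nonneg_A ha
  set I : ℝ → ℝ → ℝ := fun ε t => fisherIntegral (regularise m ε (f t)) with hI
  set X := ∫ v : Vel d, A * decay n v * (2 * d * regConst m C + 4 * 3 ^ m * regConst m C)
  have hac : ∀ ε, 0 < ε → ε ≤ 1 → AbsolutelyContinuousOnInterval (I ε) a b := fun ε h0 h1 => by
    obtain ⟨K, hK⟩ := h.exists_lipschitzOnWith hm hn h0 h1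
    rw [← uIcc_of_le hab] at hK
    exact hK.absolutelyContinuousOnInterval
  have hdef0 : ∀ ε t, 0 ≤ defect m n A ε (f t) := fun ε t => integral_nonneg fun v => by
    have := decay_pos n v
    positivity
  -- at points where `I ε` is not differentiable, `deriv` is `0` and the bound is trivial
  have hpos : ∀ ε, 0 < ε → ε ≤ 1 → ∀ t ∈ Ioo a b,
      max (deriv (I ε) t) 0 ≤ defect m n A ε (f t) := by
    intro ε h0 h1 t ht
    refine max_le ?_ (hdef0 ε t)
    by_cases hd : DifferentiableAt ℝ (I ε) t
    · exact (h.deriv_fisherIntegral_le hm hn h0 h1 ht hd).trans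
        (h.integral_mul_fisherVariation_le hn h0 h1 (Ioo_subset_Icc_self ht))
    · rw [deriv_zero_of_not_differentiableAt hd]
      exact hdef0 ε t
  have hae : ∀ᵐ t : ℝ, t ∈ uIoc a b → t ∈ Ioo a b := by
    filter_upwards [(measure_singleton (μ := (volume : Measure ℝ)) b :
      volume ({b} : Set ℝ) = 0) |> compl_mem_ae_iff.mpr] with t ht hab'
    rw [uIoc_of_le hab] at hab'
    exact ⟨hab'.1, lt_of_le_of_ne hab'.2 ht⟩
  have hlim : Filter.Tendsto (fun ε => ∫ t in a..b, max (deriv (I ε) t) 0)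
      (nhdsWithin 0 (Ioi 0)) (nhds (∫ t in a..b, (0 : ℝ))) := by
    refine intervalIntegral.tendsto_integral_filter_of_dominated_convergence (fun _ => X) ?_ ?_
      intervalIntegrable_const ?_
    · exact Filter.Eventually.of_forall fun ε =>
        ((measurable_deriv (I ε)).max measurable_const).aestronglyMeasurable
    · filter_upwards [eventually_mem_Ioc] with ε hε
      filter_upwards [hae] with t ht htab
      rw [Real.norm_of_nonneg (le_max_right _ _)]
      exact (hpos ε hε.1 hε.2 t (ht htab)).trans
        (h.defect_le hn hε.1 hε.2 (Ioo_subset_Icc_self (ht htab)))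
    · filter_upwards [hae] with t ht htab
      refine squeeze_zero' (Filter.Eventually.of_forall fun ε => le_max_right _ _) ?_
        (h.tendsto_defect hn (Ioo_subset_Icc_self (ht htab)))
      filter_upwards [eventually_mem_Ioc] with ε hε
      exact hpos ε hε.1 hε.2 t (ht htab)
  rw [intervalIntegral.integral_zero] at hlim
  have la := (h.hasDecay a ha).tendsto_fisherIntegral_regularise hm (h.nonneg a ha)
  have lb := (h.hasDecay b hb).tendsto_fisherIntegral_regularise hm (h.nonneg b hb)
  refine (le_of_tendsto_of_tendsto lb (la.add hlim) ?_).trans_eq (add_zero _)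
  filter_upwards [eventually_mem_Ioc] with ε hε
  have hc := hac ε hε.1 hε.2
  have hi := hc.intervalIntegrable_deriv
  have hmono : ∫ t in a..b, deriv (I ε) t ≤ ∫ t in a..b, max (deriv (I ε) t) 0 :=
    intervalIntegral.integral_mono hab hi ⟨hi.1.pos_part, hi.2.pos_part⟩ fun t => le_max_left _ _
  rw [hc.integral_deriv_eq_sub] at hmono
  simp only [hI] at hmono ⊢
  linarith

end IsDissipativePath

end Evolution

/-! ### Solutions of the Boltzmann equation -/

section Solutions

variable {d m : ℕ} {B : ℝ → ℝ → ℝ}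

lemma measurable_boltzmannQ (hB : Measurable (Function.uncurry B)) {f : Vel d → ℝ}
    (hf : Continuous f) : Measurable (boltzmannQ B f) := by
  have h1 := (measurable_collisionIntegrand hB hf).stronglyMeasurable
  have h2 : StronglyMeasurable fun p : Vel d × Vel d =>
      ∫ σ : Sph d, collisionIntegrand B f p.1 p.2 (σ : Vel d) ∂(surf d) := h1.integral_prod_right
  have h3 : StronglyMeasurable fun v : Vel d =>
      ∫ w : Vel d, ∫ σ : Sph d, collisionIntegrand B f v w (σ : Vel d) ∂(surf d) :=
    h2.integral_prod_right
  exact h3.measurable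

lemma le_mul_decay {x C : ℝ} {v : Vel d} (hx : 0 ≤ x) (h : (1 + ‖v‖) ^ (2 * m) * x ≤ C) :
    x ≤ C * decay m v := by
  rw [decay, ← div_eq_mul_inv, le_div_iff₀ (by positivity), mul_comm]
  refine le_trans (mul_le_mul_of_nonneg_right ?_ hx) h
  rw [pow_mul]
  exact pow_le_pow_left₀ (by positivity) (by nlinarith [norm_nonneg v]) m

lemma gradient_eq_comp (f : Vel d → ℝ) :
    gradient f = (InnerProductSpace.toDual ℝ (Vel d)).symm ∘ fderiv ℝ f := rfl

/-- On a compact time interval a solution decays uniformly, to any algebraic order. -/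
lemma IsBoltzmannSolution.exists_hasDecay {J : Set ℝ} {f : ℝ → Vel d → ℝ}
    (hf : IsBoltzmannSolution B J f) {a b : ℝ} (hab : Icc a b ⊆ J) (m : ℕ) :
    ∃ C, ∀ t ∈ Icc a b, HasDecay m C (f t) := by
  obtain ⟨C₀, h₀⟩ := hf.decay _ hab isCompact_Icc 0 (2 * m)
  obtain ⟨C₁, h₁⟩ := hf.decay _ hab isCompact_Icc 1 (2 * m)
  obtain ⟨C₂, h₂⟩ := hf.decay _ hab isCompact_Icc 2 (2 * m)
  refine ⟨max C₀ (max C₁ C₂), fun t ht => ⟨hf.smooth t (hab ht), fun v => ?_, fun v => ?_,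
    fun v => ?_⟩⟩
  · refine le_mul_decay (abs_nonneg _) (le_trans ?_ (le_max_left _ _))
    simpa using h₀ t ht v
  · refine le_mul_decay (norm_nonneg _) (le_trans ?_ ((le_max_left _ _).trans (le_max_right _ _)))
    have h := h₁ t ht v
    rw [norm_iteratedFDeriv_one] at h
    rwa [gradient, LinearIsometryEquiv.norm_map]
  · refine le_mul_decay (norm_nonneg _) (le_trans ?_ ((le_max_right _ _).trans (le_max_right _ _)))
    have h := h₂ t ht v
    rw [show (2 : ℕ) = 1 + 1 from rfl, ← norm_iteratedFDeriv_fderiv, norm_iteratedFDeriv_one] at h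
    rw [gradient_eq_comp, LinearIsometryEquiv.comp_fderiv]
    refine le_of_eq_of_le ?_ h
    congr 1
    exact LinearIsometry.norm_toContinuousLinearMap_comp
      ((InnerProductSpace.toDual ℝ (Vel d)).symm.toLinearIsometry)

theorem IsBoltzmannSolution.fisherInformation_le (hd : 2 ≤ d) (hB : IsCollisionKernel d B)
    (hc : Criterion1 d B) {J : Set ℝ} {f : ℝ → Vel d → ℝ} (hf : IsBoltzmannSolution B J f)
    {a b : ℝ} (hle : a ≤ b) (hab : Icc a b ⊆ J) :
    fisherInformation (f b) ≤ fisherInformation (f a) := by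
  obtain ⟨m₀, hm₀⟩ := integrable_dominant hd hB
  obtain ⟨N₀, hN₀⟩ := exists_boltzmannQ_bound hB
  set m := m₀ + N₀ + d + 1 with hm
  obtain ⟨K, hK0, hv, hK⟩ := hN₀ m (by omega)
  obtain ⟨C, hC⟩ := hf.exists_hasDecay hab m
  set n := m - N₀ with hn
  have hg := hasDecay_decay d m
  set G : ℝ := 1 + 2 * m + 4 * m * (m + 1)
  have h0 : ∀ t ∈ Icc a b, ∀ v, 0 ≤ f t v := fun t ht => hf.nonneg t (hab ht)
  have hpath : IsDissipativePath (boltzmannQ B) a b m n C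
      (K * C ^ 2 + K * regConst m C ^ 2 + 2 * (K * G ^ 2)) f := by
    refine ⟨hC, h0, fun t ht v => (hf.equation t (hab ht) v).mono hab,
      fun g hg => measurable_boltzmannQ hB.measurable hg.continuous, fun t ht v => ?_,
      fun t ht ε hε hε1 v => ?_, fun t ht ε hε hε1 =>
        ((hC t ht).isTame_regularise (h0 t ht) hε hε1).integral_boltzmannQ_mul_fisherVariation_nonpos
          hd hB hc (hm₀ m (by omega))⟩
    · refine (hK C _ (hC t ht) v).trans ?_
      have := decay_pos n v
      gcongr
      nlinarith [mul_nonneg hK0 (sq_nonneg (regConst m C)), mul_nonneg hK0 (sq_nonneg G)]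
    · have hfg : HasDecay m (regConst m C) fun v => f t v + BoltzmannFisher.decay m v := by
        have h1 := (hC t ht).add_smul hg zero_le_one le_rfl
        simp only [one_mul] at h1
        exact h1
      have e := boltzmannQ_add_smul hB (hv v) (hC t ht) hg hfg ε ((hC t ht).regularise hε.le hε1)
      have b1 := hK _ _ (hC t ht) v
      have b2 := hK _ _ hg v
      have b3 := hK _ _ hfg v
      have e' : boltzmannQ B (f t) v - boltzmannQ B (regularise m ε (f t)) v
          = ε * (boltzmannQ B (f t) v + boltzmannQ B (BoltzmannFisher.decay m) v
            - boltzmannQ B (fun v => f t v + BoltzmannFisher.decay m v) v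
            - ε * boltzmannQ B (BoltzmannFisher.decay m) v) := by
        change _ - boltzmannQ B (fun v => f t v + ε * BoltzmannFisher.decay m v) v = _
        rw [e]
        ring
      have b4 : |ε * boltzmannQ B (BoltzmannFisher.decay m) v|
          ≤ K * G ^ 2 * BoltzmannFisher.decay n v := by
        rw [abs_mul, abs_of_pos hε]
        exact (mul_le_of_le_one_left (abs_nonneg _) hε1).trans b2
      rw [e', abs_mul, abs_of_pos hε]
      gcongr
      refine (abs_sub _ _).trans ?_
      refine (add_le_add ((abs_sub _ _).trans (add_le_add (abs_add_le _ _) le_rfl)) le_rfl).trans ?_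
      linarith
  have hdm : d < 2 * m := by omega
  rw [(hC a (left_mem_Icc.mpr hle)).fisherInformation_eq hdm (h0 a (left_mem_Icc.mpr hle)),
    (hC b (right_mem_Icc.mpr hle)).fisherInformation_eq hdm (h0 b (right_mem_Icc.mpr hle))]
  exact ENNReal.ofReal_le_ofReal (hpath.fisherIntegral_le hdm (by omega) hle)

theorem fisherNonincreasing_of_criterion1 (hd : 2 ≤ d) (hB : IsCollisionKernel d B)
    (hc : Criterion1 d B) : FisherNonincreasing d B :=
  fun _ _ hJ hf _ ha _ hb hle => hf.fisherInformation_le hd hB hc hle (hJ.out ha hb)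

end Solutions

end BoltzmannFisher

end

theorem mainTheorem1 (d : ℕ) (hd : 2 ≤ d) (B : ℝ → ℝ → ℝ)
    (hB : BoltzmannFisher.IsCollisionKernel d B) :
    (BoltzmannFisher.Criterion1 d B → BoltzmannFisher.FisherNonincreasing d B) ∧
    (BoltzmannFisher.Criterion2 d B → BoltzmannFisher.Criterion1 d B) ∧
    (BoltzmannFisher.Criterion3 d B → BoltzmannFisher.Criterion2 d B) := by
  exact ⟨BoltzmannFisher.fisherNonincreasing_of_criterion1 hd hB,
    BoltzmannFisher.criterion1_of_criterion2 hB, BoltzmannFisher.criterion2_of_criterion3⟩
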